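/- Let $V$ be a regular, integral, quasi-projective $\mathbb{Q}$-scheme, let a finite group $G$ act on $V$ from the right by $\mathbb{Q}$-automorphisms, and let $f\colon V\to Q=V/G$ be the projection to the quotient scheme (so $f$ is affine and $G$-invariant, and $\mathcal{O}_Q=(f_*\mathcal{O}_V)^G$). Let $\Sigma\subset Q$ be a closed subset of codimension $\ge 2$ (that is, $\dim\mathcal{O}_{Q,x}\ge 2$ for all $x\in\Sigma$; $\Sigma$ may be empty) containing all singular (i.e. non-regular) points of $Q$, and let $j\colon U\hookrightarrow Q$ be the complementary open subscheme. Put $W=f^{-1}(U)$, with inclusion $w\colon W\hookrightarrow V$, and let $g\colon W\to U$ be the restriction of $f$. Then for every integer $p\ge 0$ there is a canonical isomorphism of $\mathcal{O}_Q$-modules $$\varphi\colon\; j_*\Omega^p_{U/\mathbb{Q}}\;\xrightarrow{\ \sim\ }\;(f_*\Omega^p_{V/\mathbb{Q}})^G .$$ Here $G$ acts on $f_*\Omega^p_{V/\mathbb{Q}}$ by pullback of forms, and canonical means that $\varphi$ is the unique isomorphism such that the composite $$j_*\Omega^p_{U/\mathbb{Q}}\xrightarrow{\varphi}(f_*\Omega^p_{V/\mathbb{Q}})^G\subset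 f_*\Omega^p_{V/\mathbb{Q}}\longrightarrow f_*w_*\Omega^p_{W/\mathbb{Q}}=j_*g_*\Omega^p_{W/\mathbb{Q}},$$ whose last arrow is restriction of forms to $W$, is $j_*$ of the pullback of forms $\Omega^p_{U/\mathbb{Q}}\to g_*\Omega^p_{W/\mathbb{Q}}$. -/

import Mathlib

open CategoryTheory AlgebraicGeometry Opposite

universe u

noncomputable section

/-! ### Sheaves of differential forms

Throughout, schemes over an affine base `Spec k` are objects of `Over (Spec k)`. -/

namespace DiffForms

/-- A `g`-semilinear map `M → N` induces a `g`-semilinear map `⋀^p_A M → ⋀^p_B N`,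
`m₁ ∧ ⋯ ∧ m_p ↦ φ m₁ ∧ ⋯ ∧ φ m_p`. -/
def exteriorPowerMap {A B : CommRingCat.{u}} (g : A ⟶ B) {M : ModuleCat.{u} A}
    {N : ModuleCat.{u} B} (φ : M ⟶ (ModuleCat.restrictScalars g.hom).obj N) (p : ℕ) :
    M.exteriorPower p ⟶ (ModuleCat.restrictScalars g.hom).obj (N.exteriorPower p) :=
  ModuleCat.exteriorPower.desc
    (show _root_.AlternatingMap A M
        ((ModuleCat.restrictScalars g.hom).obj (N.exteriorPower p)) (Fin p) from
    { toFun := fun x => exteriorPower.ιMulti (M := N) B p (fun i => φ.hom (x i))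
      map_update_add' := by
        intro _ m i x y
        have key : ∀ z : M, (fun j => φ.hom (Function.update m i z j)) =
            Function.update (fun j => (φ.hom (m j) : N)) i (φ.hom z) := by
          intro z
          funext j
          by_cases h : j = i
          · subst h; simp
          · simp [h]
        rw [key, key, key, map_add]
        exact (exteriorPower.ιMulti (M := N) B p).map_update_add _ i _ _
      map_update_smul' := by
        intro _ m i c x
        have key : ∀ z : M, (fun j => φ.hom (Function.update m i z j)) =
            Function.update (fun j => (φ.hom (m j) : N)) i (φ.hom z) := by
          intro z
          funext j
          by_cases h : j = i
          · subst h; simp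
          · simp [h]
        rw [key, key, map_smul]
        exact (exteriorPower.ιMulti (M := N) B p).map_update_smul _ i (g.hom c) _
      map_eq_zero_of_eq' := by
        intro v i j hv hij
        exact (exteriorPower.ιMulti (M := N) B p).map_eq_zero_of_eq _
          (show φ.hom (v i) = φ.hom (v j) by rw [hv]) hij })

lemma exteriorPowerMap_mk {A B : CommRingCat.{u}} (g : A ⟶ B) {M : ModuleCat.{u} A}
    {N : ModuleCat.{u} B} (φ : M ⟶ (ModuleCat.restrictScalars g.hom).obj N) (p : ℕ)
    (x : Fin p → M) :
    (exteriorPowerMap g φ p).hom (ModuleCat.exteriorPower.mk x) =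
      ModuleCat.exteriorPower.mk (M := N) (fun i => φ.hom (x i)) :=
  ModuleCat.exteriorPower.desc_mk _ _

/-- The structure map `k → Γ(X, U)` of a scheme `X` over `Spec k`, as a morphism from the
constant presheaf `k` to `𝒪_X`. -/
def baseToSections {k : CommRingCat.{u}} (X : Over (Spec k)) :
    (Functor.const _).obj k ⟶ X.left.presheaf where
  app U := (Scheme.ΓSpecIso k).inv ≫ X.hom.appLE ⊤ U.unop le_top
  naturality U V i := by
    have h := X.hom.appLE_map (U := ⊤) (e := le_top) i
    simp [h]

lemma baseToSections_comp {k : CommRingCat.{u}} {X Y : Over (Spec k)} (h : X ⟶ Y)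
    (U : Y.left.Opensᵒᵖ) :
    𝟙 k ≫ (baseToSections X).app (op (h.left ⁻¹ᵁ U.unop)) =
      (baseToSections Y).app U ≫ h.left.app U.unop := by
  have h1 : Y.hom.appLE ⊤ U.unop le_top ≫ h.left.app U.unop =
      X.hom.appLE ⊤ (h.left ⁻¹ᵁ U.unop) le_top := by
    rw [Scheme.Hom.app_eq_appLE]
    refine (Scheme.Hom.appLE_comp_appLE h.left Y.hom ⊤ U.unop (h.left ⁻¹ᵁ U.unop)
      le_top le_rfl).trans ?_
    have key : ∀ (q : X.left ⟶ Spec k) (_ : q = X.hom) (e : h.left ⁻¹ᵁ U.unop ≤ q ⁻¹ᵁ ⊤),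
        q.appLE ⊤ (h.left ⁻¹ᵁ U.unop) e = X.hom.appLE ⊤ (h.left ⁻¹ᵁ U.unop) le_top := by
      rintro q rfl e
      rfl
    exact key _ (Over.w h) _
  simp [baseToSections, h1]

lemma kaehlerMap_map {A B A' B' B'' : CommRingCat.{u}} {f : A ⟶ B} {f' : A ⟶ B'} {f'' : A' ⟶ B''}
    {s : A ⟶ A} {s' : A ⟶ A'} {g : B ⟶ B'} {g' : B' ⟶ B''} (h : s ≫ f' = f ≫ g)
    (h' : s' ≫ f'' = f' ≫ g') {t : A ⟶ A'} {g'' : B ⟶ B''} (h'' : t ≫ f'' = f ≫ g'')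
    (hg : g ≫ g' = g'') (x : CommRingCat.KaehlerDifferential f) :
    (CommRingCat.KaehlerDifferential.map h').hom ((CommRingCat.KaehlerDifferential.map h).hom x) =
      (CommRingCat.KaehlerDifferential.map h'').hom x := by
  subst hg
  have key : CommRingCat.KaehlerDifferential.map h ≫
      (ModuleCat.restrictScalars g.hom).map (CommRingCat.KaehlerDifferential.map h') =
      CommRingCat.KaehlerDifferential.map h'' ≫ (ModuleCat.restrictScalarsComp'
        g.hom g'.hom (g ≫ g').hom rfl).hom.app _ := by
    ext b
    exact (congrArg (CommRingCat.KaehlerDifferential.map h').hom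
      (CommRingCat.KaehlerDifferential.map_d h b)).trans
      ((CommRingCat.KaehlerDifferential.map_d h' _).trans
        (CommRingCat.KaehlerDifferential.map_d h'' b).symm)
  exact CategoryTheory.congr_fun key x

/-- The presheaf of `𝒪_X`-modules `U ↦ ⋀^p Ω_{Γ(X, U)/k}`. -/
def preForms {k : CommRingCat.{u}} (X : Over (Spec k)) (p : ℕ) :
    X.left.PresheafOfModules where
  obj U := (CommRingCat.KaehlerDifferential ((baseToSections X).app U)).exteriorPower p
  map {U V} i := exteriorPowerMap (X.left.presheaf.map i)
    (CommRingCat.KaehlerDifferential.map (g' := X.left.presheaf.map i)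
      ((baseToSections X).naturality i)) p
  map_id U := by
    ext x
    refine (exteriorPowerMap_mk _ _ p x).trans ?_
    change ModuleCat.exteriorPower.mk _ = ModuleCat.exteriorPower.mk x
    congr 1
    funext l
    exact CategoryTheory.congr_fun ((PresheafOfModules.DifferentialsConstruction.relativeDifferentials'
      (baseToSections X)).map_id U) (x l)
  map_comp i j := by
    ext x
    refine (exteriorPowerMap_mk _ _ p x).trans ?_
    refine Eq.trans ?_ (congrArg (exteriorPowerMap (X.left.presheaf.map j)
      (CommRingCat.KaehlerDifferential.map (g' := X.left.presheaf.map j)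
        ((baseToSections X).naturality j)) p).hom (exteriorPowerMap_mk _ _ p x).symm)
    refine Eq.trans ?_ (exteriorPowerMap_mk _ _ p _).symm
    congr 1
    funext l
    exact (PresheafOfModules.DifferentialsConstruction.relativeDifferentials'
      (baseToSections X)).map_comp_apply i j (x l)

/-- The pullback of forms along a morphism `h : X ⟶ Y` over `Spec k`, before sheafification: the
maps `⋀^p Ω_{Γ(Y, U)/k} → ⋀^p Ω_{Γ(X, h⁻¹ U)/k}` induced by `h`. -/
def preForms.pullback {k : CommRingCat.{u}} {X Y : Over (Spec k)} (h : X ⟶ Y) (p : ℕ) :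
    preForms Y p ⟶
      (PresheafOfModules.pushforward h.left.toRingCatSheafHom.hom).obj (preForms X p) where
  app U := exteriorPowerMap (h.left.app U.unop)
    (CommRingCat.KaehlerDifferential.map (g := 𝟙 k) (g' := h.left.app U.unop)
      (f := (baseToSections Y).app U)
      (f' := (baseToSections X).app (op (h.left ⁻¹ᵁ U.unop)))
      (baseToSections_comp h U)) p
  naturality {U W} i := by
    apply ModuleCat.exteriorPower.hom_ext
    ext x
    refine (congrArg (exteriorPowerMap (h.left.app W.unop) _ p).hom
      (exteriorPowerMap_mk _ _ p x)).trans ?_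
    refine (exteriorPowerMap_mk _ _ p _).trans ?_
    refine Eq.trans ?_ (congrArg ((preForms X p).map _).hom
      (exteriorPowerMap_mk _ _ p x).symm)
    refine Eq.trans ?_ (exteriorPowerMap_mk _ _ p _).symm
    congr 1
    funext l
    have hnat := h.left.naturality i
    refine (kaehlerMap_map (s := 𝟙 k) (s' := 𝟙 k) (t := 𝟙 k) ((baseToSections Y).naturality i)
      (baseToSections_comp h W) (g'' := Y.left.presheaf.map i ≫ h.left.app W.unop)
      (by rw [baseToSections_comp h W, ← Category.assoc]
          erw [← (baseToSections Y).naturality i]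
          simp) rfl (x l)).trans ?_
    exact (kaehlerMap_map (s := 𝟙 k) (s' := 𝟙 k) (t := 𝟙 k) (baseToSections_comp h U)
      ((baseToSections X).naturality _) _ hnat.symm (x l)).symm

/-- The sheaf `Ω^p_{X/k}` of `p`-forms on a scheme `X` over `Spec k`: the `𝒪_X`-module
associated to the presheaf `U ↦ ⋀^p Ω_{Γ(X, U)/k}`. -/
def forms {k : CommRingCat.{u}} (X : Over (Spec k)) (p : ℕ) : X.left.Modules :=
  (PresheafOfModules.sheafification (𝟙 X.left.ringCatSheaf.obj)).obj (preForms X p)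

/-- The canonical map from `U ↦ ⋀^p Ω_{Γ(X, U)/k}` to its sheafification. -/
def toForms {k : CommRingCat.{u}} (X : Over (Spec k)) (p : ℕ) :
    preForms X p ⟶ (forms X p).val :=
  (PresheafOfModules.sheafificationAdjunction (𝟙 X.left.ringCatSheaf.obj)).unit.app
    (preForms X p)

/-- The pullback of forms `Ω^p_{Y/k} ⟶ h_* Ω^p_{X/k}` along a morphism `h : X ⟶ Y` over
`Spec k`. -/
def forms.pullback {k : CommRingCat.{u}} {X Y : Over (Spec k)} (h : X ⟶ Y) (p : ℕ) :
    forms Y p ⟶ (Scheme.Modules.pushforward h.left).obj (forms X p) :=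
  ((PresheafOfModules.sheafificationAdjunction (𝟙 Y.left.ringCatSheaf.obj)).homEquiv _ _).symm
    (preForms.pullback h p ≫
      (PresheafOfModules.pushforward h.left.toRingCatSheafHom.hom).map (toForms X p))

end DiffForms

/-! ### Finite group quotients -/

namespace FiniteQuotient

open DiffForms

variable {k : CommRingCat.{u}}

/-- A right action of `G` on `V` by automorphisms over `Spec k`: `a (g h)` is
`a g` followed by `a h`. -/
abbrev RightAction (G : Type*) [Group G] (V : Over (Spec k)) := G →* (Aut V)ᵐᵒᵖ

/-- The automorphism `x ↦ x · g` of `V`. -/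
abbrev RightAction.aut {G : Type*} [Group G] {V : Over (Spec k)} (a : RightAction G V) (g : G) :
    V ⟶ V := (a g).unop.hom

/-- `f` is `G`-invariant. -/
def IsInvariant {G : Type*} [Group G] {V Q : Over (Spec k)} (a : RightAction G V)
    (f : V ⟶ Q) : Prop :=
  ∀ g : G, a.aut g ≫ f = f

lemma IsInvariant.left {G : Type*} [Group G] {V Q : Over (Spec k)} {a : RightAction G V}
    {f : V ⟶ Q} (hf : IsInvariant a f) (g : G) : (a.aut g).left ≫ f.left = f.left := by
  rw [← Over.comp_left, hf g]

lemma IsInvariant.le {G : Type*} [Group G] {V Q : Over (Spec k)} {a : RightAction G V}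
    {f : V ⟶ Q} (hf : IsInvariant a f) (g : G) (U : Q.left.Opens) :
    f.left ⁻¹ᵁ U ≤ (a.aut g).left ⁻¹ᵁ (f.left ⁻¹ᵁ U) := by
  rw [← Scheme.Hom.comp_preimage, hf.left g]

/-- `f : V ⟶ Q` exhibits `Q` as the quotient scheme `V / G`: it is `G`-invariant and affine, and
`𝒪_Q ⟶ f_* 𝒪_V` identifies `𝒪_Q` with the subsheaf of `G`-invariants. In other words, over every
affine open of `Q` it is `Spec A → Spec A^G`; this is the gluing construction of `V / G`, which
determines `Q` and `f` up to a unique isomorphism. -/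
structure IsQuotient {G : Type*} [Group G] {V Q : Over (Spec k)} (a : RightAction G V)
    (f : V ⟶ Q) : Prop where
  invariant : IsInvariant a f
  isAffineHom : IsAffineHom f.left
  injective : ∀ U : Q.left.Opens, Function.Injective (f.left.app U)
  range_eq : ∀ U : Q.left.Opens, Set.range (f.left.app U) =
    {s | ∀ g : G, (a.aut g).left.appLE (f.left ⁻¹ᵁ U) (f.left ⁻¹ᵁ U) (invariant.le g U) s = s}

/-- The action of `g` on `f_* Ω^p_V`, given by the pullback of forms along `x ↦ x · g`. -/
def actForms {G : Type*} [Group G] {V Q : Over (Spec k)} {a : RightAction G V}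
    {f : V ⟶ Q} (hf : IsInvariant a f) (p : ℕ) (g : G) :
    (Scheme.Modules.pushforward f.left).obj (forms V p) ⟶
      (Scheme.Modules.pushforward f.left).obj (forms V p) :=
  (Scheme.Modules.pushforward f.left).map (forms.pullback (a.aut g) p) ≫
    (Scheme.Modules.pushforwardComp (a.aut g).left f.left).hom.app (forms V p) ≫
    (Scheme.Modules.pushforwardCongr (hf.left g)).hom.app (forms V p)

/-- The `𝒪_Q`-module `(f_* Ω^p_V)^G`: the kernel of `m ↦ (g m - m)_{g ∈ G}`. -/
def invariantForms {G : Type*} [Group G] [Finite G] {V Q : Over (Spec k)} {a : RightAction G V}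
    {f : V ⟶ Q} (hf : IsInvariant a f) (p : ℕ) : Q.left.Modules :=
  Limits.kernel (Limits.Pi.lift fun g : G =>
    actForms hf p g - 𝟙 ((Scheme.Modules.pushforward f.left).obj (forms V p)))

/-- The inclusion `(f_* Ω^p_V)^G ⟶ f_* Ω^p_V`. -/
def invariantForms.ι {G : Type*} [Group G] [Finite G] {V Q : Over (Spec k)}
    {a : RightAction G V} {f : V ⟶ Q} (hf : IsInvariant a f) (p : ℕ) :
    invariantForms hf p ⟶ (Scheme.Modules.pushforward f.left).obj (forms V p) :=
  Limits.kernel.ι _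

/-! ### Open subschemes -/

/-- The open subscheme `U` of `X`, as a scheme over `Spec k`. -/
abbrev opn (X : Over (Spec k)) (U : X.left.Opens) : Over (Spec k) := Over.mk (U.ι ≫ X.hom)

/-- The inclusion `U ⟶ X` of an open subscheme. -/
abbrev incl (X : Over (Spec k)) (U : X.left.Opens) : opn X U ⟶ X := Over.homMk U.ι

/-- The restriction `f⁻¹ U ⟶ U` of `f : V ⟶ Q`. -/
abbrev resHom {V Q : Over (Spec k)} (f : V ⟶ Q) (U : Q.left.Opens) :
    opn V (f.left ⁻¹ᵁ U) ⟶ opn Q U :=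
  Over.homMk (f.left ∣_ U) (by simp [morphismRestrict_ι_assoc])

lemma resHom_comp_incl {V Q : Over (Spec k)} (f : V ⟶ Q) (U : Q.left.Opens) :
    (resHom f U).left ≫ (incl Q U).left = (incl V (f.left ⁻¹ᵁ U)).left ≫ f.left :=
  morphismRestrict_ι f.left U

/-- With `j : U ⟶ Q`, `w : W = f⁻¹ U ⟶ V` the inclusions and `g : W ⟶ U` the restriction of `f`,
the map `j_* Ω^p_U ⟶ j_* g_* Ω^p_W = f_* w_* Ω^p_W` given by the pullback of forms along `g`. -/
def pullbackOnOpen {V Q : Over (Spec k)} (f : V ⟶ Q) (U : Q.left.Opens) (p : ℕ) :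
    (Scheme.Modules.pushforward (incl Q U).left).obj (forms (opn Q U) p) ⟶
      (Scheme.Modules.pushforward f.left).obj
        ((Scheme.Modules.pushforward (incl V (f.left ⁻¹ᵁ U)).left).obj
          (forms (opn V (f.left ⁻¹ᵁ U)) p)) :=
  (Scheme.Modules.pushforward (incl Q U).left).map (forms.pullback (resHom f U) p) ≫
    (Scheme.Modules.pushforwardComp (resHom f U).left (incl Q U).left).hom.app _ ≫
    (Scheme.Modules.pushforwardCongr (resHom_comp_incl f U)).hom.app _ ≫
    (Scheme.Modules.pushforwardComp (incl V (f.left ⁻¹ᵁ U)).left f.left).inv.app _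

/-- With `w : W = f⁻¹ U ⟶ V` the inclusion, the map `f_* Ω^p_V ⟶ f_* w_* Ω^p_W` given by the
restriction of forms from `V` to `W`. -/
def restrictToOpen {V Q : Over (Spec k)} (f : V ⟶ Q) (U : Q.left.Opens) (p : ℕ) :
    (Scheme.Modules.pushforward f.left).obj (forms V p) ⟶
      (Scheme.Modules.pushforward f.left).obj
        ((Scheme.Modules.pushforward (incl V (f.left ⁻¹ᵁ U)).left).obj
          (forms (opn V (f.left ⁻¹ᵁ U)) p)) :=
  (Scheme.Modules.pushforward f.left).map (forms.pullback (incl V (f.left ⁻¹ᵁ U)) p)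

end FiniteQuotient

/-! ### Regularity, codimension, quasi-projectivity -/

namespace SchemeProps

/-- `x` is a regular point of `X`. -/
def IsRegularAt (X : Scheme.{u}) (x : X) : Prop := IsRegularLocalRing (X.presheaf.stalk x)

/-- `X` is a regular scheme. -/
def IsRegular (X : Scheme.{u}) : Prop := ∀ x : X, IsRegularAt X x

/-- The codimension of a closed subset `Z` of `X`, the infimum of `dim 𝒪_{X, x}` over `x ∈ Z`
(equal to `⊤` if `Z` is empty). -/
def codim (X : Scheme.{u}) (Z : Set X) : WithBot ℕ∞ :=
  ⨅ x ∈ Z, ringKrullDim (X.presheaf.stalk x)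

/-- Projective space `ℙ^n` over `Spec k`, the `Proj` of `k[x₀, …, x_n]`. -/
def projectiveSpace (k : CommRingCat.{u}) (n : ℕ) : Over (Spec k) :=
  letI : GradedAlgebra (MvPolynomial.homogeneousSubmodule (Fin (n + 1)) k) :=
    MvPolynomial.gradedAlgebra
  Over.mk (Proj.toSpecZero (MvPolynomial.homogeneousSubmodule (Fin (n + 1)) k) ≫
    Spec.map (CommRingCat.ofHom
      (algebraMap k (MvPolynomial.homogeneousSubmodule (Fin (n + 1)) k 0))))

/-- `X` is quasi-projective over the noetherian ring `k`: it admits an immersion over `Spec k` into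
some `ℙ^n`. -/
def IsQuasiProjective {k : CommRingCat.{u}} (X : Over (Spec k)) : Prop :=
  ∃ (n : ℕ) (i : X ⟶ projectiveSpace k n), IsImmersion i.left

end SchemeProps

end

/-! Let L be the function field of V. It is algebraic over the function field of Q, so in
characteristic zero a basis of differentials at a regular point of V or of U becomes a basis of Ω_L.
Hence a p-form on an open part of V or of U is determined by its value in ⋀^p Ω_L
(`IsGeneric.locallyDetermined`, `eval_injective`). Conversely, ω in ⋀^p Ω_L is the value of a
section over an open set if and only if it is regular at each of its points, that is, a sum of terms
r dx₁ ∧ ⋯ ∧ dx_p with r and all x_i regular there (`eval_mem`, `exists_eval_eq_of_forall_mem`).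
Pullback and restriction do not change values, so the theorem compares two regularity conditions on
the same ω.

Both directions reduce to codimension one. In coordinates at a regular point the coefficients of ω
are rational functions, and a rational function that is not regular at a prime q is already not
regular at some prime of height one below q. This rests on the fact that a regular local ring of
dimension at least two has depth at least two (`exists_prime_notMem_regularForms`).

From U to V: by going down, a prime of height at most one upstairs lies over a prime of height at
most one. The latter belongs to U, where ω is regular by assumption, and regularity pulls back
(`mem_regularForms_locRing_of_quotient`).

From V to U: in a basis dt_i with t_i functions on Q, an invariant form has invariant coefficients,
which are therefore rational functions on Q. At a prime of height one there is an extension R ⊂ S of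
discrete valuation rings with uniformizers t = u s^(e+1). One transcendence basis x of the residue
field of R lifts to coordinates for both rings, and since e + 1 is invertible, s^(-e) dt and the
dx_j can replace ds and the dx_j as coordinates along S. As dt occurs at most once in a monomial,
the coefficients of ω have a pole of order at most e in s. A pole along R would have order at least
e + 1 in s, so there is none (`regularForms.descend`).

Finally, both sheaves embed into j_* g_* Ω^p_W and each embedding factors through the other; this
yields the isomorphism and its uniqueness. -/

noncomputable section

/-! ### Regular local rings -/

namespace IsRegularLocalRing

open IsLocalRing

/-- The quotient of a regular local ring by a member of a minimal generating set of the maximal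
ideal is regular. -/
lemma quotient_of_mem_generators {R : Type*} [CommRing R] [IsRegularLocalRing R] {n : ℕ}
    (s : Finset R) (hs : Ideal.span (s : Set R) = maximalIdeal R) (hcard : s.card = n + 1)
    (hdim : ringKrullDim R = (n + 1 : ℕ)) {x : R} (hx : x ∈ s) :
    IsRegularLocalRing (R ⧸ Ideal.span {x}) ∧ ringKrullDim (R ⧸ Ideal.span {x}) = n := by
  have hxm : x ∈ maximalIdeal R := hs ▸ Ideal.subset_span hx
  have hne : Ideal.span {x} ≠ ⊤ := fun h => by
    have := (Ideal.span_singleton_le_iff_mem (maximalIdeal R)).2 hxm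
    exact (maximalIdeal.isMaximal R).ne_top (top_le_iff.1 (h ▸ this))
  have : Nontrivial (R ⧸ Ideal.span {x}) := Ideal.Quotient.nontrivial_iff.2 hne
  have hloc : IsLocalRing (R ⧸ Ideal.span {x}) :=
    IsLocalRing.of_surjective' _ Ideal.Quotient.mk_surjective
  have hmap : maximalIdeal (R ⧸ Ideal.span {x}) =
      (maximalIdeal R).map (Ideal.Quotient.mk (Ideal.span {x})) := by
    refine (IsLocalRing.map_maximalIdeal_of_surjective _ Ideal.Quotient.mk_surjective).symm
  -- Dividing by one element lowers the dimension by at most one, while the remaining n generators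
  -- generate the new maximal ideal. The two bounds meet at n.
  have hle : ringKrullDim R ≤ ringKrullDim (R ⧸ Ideal.span {x}) + 1 := by
    have := ringKrullDim_le_ringKrullDim_quotient_add_encard (R := R) {x} (by
      simpa [IsLocalRing.ringJacobson_eq_maximalIdeal] using hxm)
    simpa using this
  classical
  have hfr : (maximalIdeal (R ⧸ Ideal.span {x})).spanFinrank ≤ n := by
    have h1 : maximalIdeal (R ⧸ Ideal.span {x}) =
        Ideal.span (((s.erase x).image (Ideal.Quotient.mk (Ideal.span {x})) : Finset _) :
          Set (R ⧸ Ideal.span {x})) := by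
      rw [hmap, ← hs, Ideal.map_span]
      apply le_antisymm
      · rw [Ideal.span_le]
        rintro _ ⟨y, hy, rfl⟩
        by_cases hyx : y = x
        · subst hyx
          have : Ideal.Quotient.mk (Ideal.span {y}) y = 0 :=
            Ideal.Quotient.eq_zero_iff_mem.2 (Ideal.mem_span_singleton_self y)
          rw [this]
          exact zero_mem _
        · exact Ideal.subset_span (by
            simp only [Finset.coe_image]
            exact ⟨y, by simpa [hyx] using hy, rfl⟩)
      · apply Ideal.span_mono
        simp only [Finset.coe_image]
        exact Set.image_mono (by simp)
    rw [h1]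
    refine (Submodule.spanFinrank_span_le_ncard_of_finite (Finset.finite_toSet _)).trans ?_
    rw [Set.ncard_coe_finset]
    refine Finset.card_image_le.trans ?_
    rw [Finset.card_erase_of_mem hx, hcard]
    simp
  have hge : (n : WithBot ℕ∞) ≤ ringKrullDim (R ⧸ Ideal.span {x}) := by
    rw [hdim] at hle
    have : ((n : WithBot ℕ∞) + 1) ≤ ringKrullDim (R ⧸ Ideal.span {x}) + 1 := by exact_mod_cast hle
    generalize ringKrullDim (R ⧸ Ideal.span {x}) = d at this ⊢
    induction d with
    | bot => simp at this
    | coe d =>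
      have h2 : ((n : ℕ∞) + 1) ≤ d + 1 := by exact_mod_cast this
      have h3 : (n : ℕ∞) ≤ d := (ENat.add_le_add_iff_right (by simp)).1 h2
      exact_mod_cast h3
  have hreg : IsRegularLocalRing (R ⧸ Ideal.span {x}) :=
    IsRegularLocalRing.of_spanFinrank_maximalIdeal_le _ (le_trans (by exact_mod_cast hfr) hge)
  refine ⟨hreg, le_antisymm ?_ hge⟩
  rw [← hreg.spanFinrank_maximalIdeal]
  exact_mod_cast hfr

/-- Induction on the dimension. Let P be the bottom of a chain of primes of maximal length and x a
minimal generator outside P; the quotient by x is a domain by induction. A dimension count forces P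
⊆ (x), hence P = xP because x is not in P, and Nakayama gives P = 0. -/
lemma isDomain_of_ringKrullDim_eq (n : ℕ) : ∀ (R : Type u) [CommRing R] [IsRegularLocalRing R],
    ringKrullDim R = n → IsDomain R := by
  induction n with
  | zero =>
    intro R _ hR hdim
    have h1 : (maximalIdeal R).spanFinrank = 0 := by
      have := hR.spanFinrank_maximalIdeal
      rw [hdim] at this
      exact_mod_cast this
    have h2 := (Submodule.spanFinrank_eq_zero_iff_eq_bot (IsNoetherian.noetherian _)).1 h1
    have := (IsLocalRing.isField_iff_maximalIdeal_eq).2 h2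
    exact this.isDomain
  | succ n ih =>
    intro R _ hR hdim
    have h1 : (maximalIdeal R).spanFinrank = n + 1 := by
      have := hR.spanFinrank_maximalIdeal
      rw [hdim] at this
      exact_mod_cast this
    obtain ⟨s, hcard, hs⟩ := Submodule.FG.exists_span_finset_card_eq_spanFinrank
      (IsNoetherian.noetherian (maximalIdeal R))
    rw [h1] at hcard
    obtain ⟨l, hl⟩ : ∃ l : LTSeries (PrimeSpectrum R), l.length = n + 1 := by
      have := (Order.le_krullDim_iff (α := PrimeSpectrum R) (n := n + 1)).1 hdim.ge
      exact this
    set P := l.head.asIdeal with hP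
    have hPdim : ((n + 1 : ℕ) : WithBot ℕ∞) ≤ ringKrullDim (R ⧸ P) := by
      rw [ringKrullDim_quotient]
      refine (Order.le_krullDim_iff).2 ⟨⟨l.length, fun i => ⟨l i, ?_⟩, fun i => l.step i⟩, hl⟩
      exact (LTSeries.head_le l i : l.head ≤ l i)
    obtain ⟨x, hx, hxP⟩ : ∃ x ∈ s, x ∉ P := by
      by_contra! hcon
      have hle : maximalIdeal R ≤ P := hs ▸ Ideal.span_le.2 hcon
      have hPm : P = maximalIdeal R := le_antisymm (le_maximalIdeal l.head.2.ne_top) hle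
      have : IsField (R ⧸ P) := by
        rw [hPm]
        exact (Ideal.Quotient.maximal_ideal_iff_isField_quotient _).1 (maximalIdeal.isMaximal R)
      rw [ringKrullDim_eq_zero_of_isField this] at hPdim
      have : n + 1 ≤ 0 := by exact_mod_cast hPdim
      omega
    obtain ⟨hreg, hd⟩ := quotient_of_mem_generators s hs hcard hdim hx
    have hdom := ih _ hd
    have hxm : x ∈ maximalIdeal R := hs ▸ Ideal.subset_span hx
    -- If y in P were nonzero modulo x, then R/(x, y) would have dimension at most n - 1. Its
    -- quotient R/(P, x) has dimension at least n, because R/P has dimension at least n + 1.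
    have hPx : P ≤ Ideal.span {x} := by
      intro y hy
      by_contra hyx
      set y' := Ideal.Quotient.mk (Ideal.span {x}) y
      have hy' : y' ≠ 0 := fun h => hyx (Ideal.Quotient.eq_zero_iff_mem.1 h)
      have h2 := ringKrullDim_quotient_succ_le_of_nonZeroDivisor (R := R ⧸ Ideal.span {x})
        (mem_nonZeroDivisors_of_ne_zero hy')
      rw [hd] at h2
      -- `R/P/x` is a quotient of `R/x/y`
      have hx' : Ideal.Quotient.mk P x ∈ Ring.jacobson (R ⧸ P) := by
        have hloc : IsLocalRing (R ⧸ P) := by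
          have : Nontrivial (R ⧸ P) := Ideal.Quotient.nontrivial_iff.2 l.head.2.ne_top
          exact IsLocalRing.of_surjective' _ Ideal.Quotient.mk_surjective
        rw [IsLocalRing.ringJacobson_eq_maximalIdeal,
          ← IsLocalRing.map_maximalIdeal_of_surjective (Ideal.Quotient.mk P)
            Ideal.Quotient.mk_surjective]
        exact Ideal.mem_map_of_mem _ hxm
      have h3 := ringKrullDim_le_ringKrullDim_quotient_add_encard (R := R ⧸ P)
        {Ideal.Quotient.mk P x} (by simpa using hx')
      have h4 : ringKrullDim ((R ⧸ P) ⧸ Ideal.span {Ideal.Quotient.mk P x}) ≤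
          ringKrullDim ((R ⧸ Ideal.span {x}) ⧸ Ideal.span {y'}) := by
        refine ringKrullDim_le_of_surjective
          (Ideal.Quotient.lift (Ideal.span {y'}) (Ideal.Quotient.lift (Ideal.span {x})
            ((Ideal.Quotient.mk (Ideal.span {Ideal.Quotient.mk P x})).comp (Ideal.Quotient.mk P))
            ?_) ?_) ?_
        · intro a ha
          obtain ⟨c, rfl⟩ := Ideal.mem_span_singleton'.1 ha
          simp only [map_mul, RingHom.comp_apply]
          rw [Ideal.Quotient.eq_zero_iff_mem.2 (Ideal.mem_span_singleton_self (Ideal.Quotient.mk P x)), mul_zero]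
        · intro a ha
          obtain ⟨c, rfl⟩ := Ideal.mem_span_singleton'.1 ha
          rw [map_mul, Ideal.Quotient.lift_mk, RingHom.comp_apply,
            Ideal.Quotient.eq_zero_iff_mem.2 hy, map_zero, mul_zero]
        · apply Ideal.Quotient.lift_surjective_of_surjective
          apply Ideal.Quotient.lift_surjective_of_surjective
          exact Ideal.Quotient.mk_surjective.comp Ideal.Quotient.mk_surjective
      rw [Set.encard_singleton, show ((1 : ℕ∞) : WithBot ℕ∞) = 1 from rfl] at h3
      have h5 : ((n + 1 : ℕ) : WithBot ℕ∞) ≤ n := hPdim.trans <| h3.trans <|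
        (add_le_add_left h4 1).trans h2
      have : n + 1 ≤ n := by exact_mod_cast h5
      omega
    have hPbot : P = ⊥ := by
      refine Submodule.eq_bot_of_le_smul_of_le_jacobson_bot (maximalIdeal R) P
        (IsNoetherian.noetherian P) ?_ (IsLocalRing.maximalIdeal_le_jacobson _)
      intro y hy
      obtain ⟨z, rfl⟩ := Ideal.mem_span_singleton'.1 (hPx hy)
      have hz : z ∈ P := (l.head.2.mem_or_mem hy).resolve_right hxP
      rw [mul_comm]
      exact Submodule.smul_mem_smul hxm hz
    have := l.head.2
    rw [← hP, hPbot] at this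
    exact (IsDomain.of_bot_isPrime R)

instance (priority := low) isDomain (R : Type u) [CommRing R] [IsRegularLocalRing R] :
    IsDomain R :=
  isDomain_of_ringKrullDim_eq (maximalIdeal R).spanFinrank R
    (IsRegularLocalRing.spanFinrank_maximalIdeal (R := R)).symm

/-- Depth two: an element of the fraction field of a regular local ring of dimension at least two
is integral as soon as it is so after multiplication by each element of the maximal ideal. -/
lemma dvd_of_forall_mem_maximalIdeal {R : Type u} [CommRing R] [IsRegularLocalRing R]
    (hdim : 2 ≤ ringKrullDim R) {a b : R} (hb : b ≠ 0)
    (h : ∀ y ∈ maximalIdeal R, b ∣ y * a) : b ∣ a := by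
  have hfr := IsRegularLocalRing.spanFinrank_maximalIdeal (R := R)
  rw [← hfr] at hdim
  have hdim' : 2 ≤ (maximalIdeal R).spanFinrank := by exact_mod_cast hdim
  obtain ⟨n, hn⟩ : ∃ n, (maximalIdeal R).spanFinrank = n + 1 := ⟨_, (Nat.sub_add_cancel (by omega)).symm⟩
  obtain ⟨s, hcard, hs⟩ := Submodule.FG.exists_span_finset_card_eq_spanFinrank
    (IsNoetherian.noetherian (maximalIdeal R))
  obtain ⟨t, ht⟩ : s.Nonempty := Finset.card_pos.1 (by omega)
  have htm : t ∈ maximalIdeal R := hs ▸ Ideal.subset_span ht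
  obtain ⟨hreg, -⟩ := quotient_of_mem_generators s hs (hcard.trans hn) (by rw [← hfr, hn]) ht
  have hprime : (Ideal.span {t}).IsPrime := (Ideal.Quotient.isDomain_iff_prime _).1 inferInstance
  -- Zero could be dropped from a generating set of minimal size.
  have ht0 : t ≠ 0 := by
    rintro rfl
    classical
    have : Ideal.span ((s.erase 0 : Finset R) : Set R) = maximalIdeal R := by
      rw [Finset.coe_erase, Ideal.span_sdiff_singleton_zero]; exact hs
    have h2 := Submodule.spanFinrank_span_le_ncard_of_finite (R := R) (Finset.finite_toSet (s.erase 0))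
    rw [Set.ncard_coe_finset, Finset.card_erase_of_mem ht, hcard] at h2
    have h3 : (Submodule.span R ((s.erase 0 : Finset R) : Set R)).spanFinrank = _ := congrArg _ this
    omega
  have htp : Prime t := (Ideal.span_singleton_prime ht0).1 hprime
  -- In dimension at least two the maximal ideal is not principal, so t is not its only generator.
  obtain ⟨y, hy, hyt⟩ : ∃ y ∈ maximalIdeal R, ¬ t ∣ y := by
    by_contra! hcon
    have : maximalIdeal R = Ideal.span {t} := le_antisymm
      (fun y hy => Ideal.mem_span_singleton.2 (hcon y hy))
      ((Ideal.span_singleton_le_iff_mem _).2 htm)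
    have h2 := Submodule.spanFinrank_singleton (R := R) ht0
    have h3 : (maximalIdeal R).spanFinrank = 1 := by rw [this]; exact h2
    omega
  obtain ⟨c, hc⟩ := h t htm
  -- The prime t divides b * c. If it divides b = t * b', then a = b' * c, and testing the
  -- hypothesis on y gives y * c = t * d with t not dividing y.
  have key : t ∣ c := by
    rcases htp.dvd_or_dvd (Dvd.intro a hc : t ∣ b * c) with ⟨b', rfl⟩ | h
    · have ha : a = b' * c := mul_left_cancel₀ ht0 (by rw [hc]; ring)
      have hb' : b' ≠ 0 := right_ne_zero_of_mul hb
      obtain ⟨d, hd⟩ := h y hy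
      have : y * c = t * d := mul_left_cancel₀ hb' (by rw [ha] at hd; linear_combination hd)
      exact (htp.dvd_or_dvd (Dvd.intro d this.symm)).resolve_left hyt
    · exact h
  obtain ⟨c', rfl⟩ := key
  exact ⟨c', mul_left_cancel₀ ht0 (by rw [hc]; ring)⟩

lemma dvd_of_forall_mem_maximalIdeal_pow {R : Type u} [CommRing R] [IsRegularLocalRing R]
    (hdim : 2 ≤ ringKrullDim R) {b : R} (hb : b ≠ 0) (n : ℕ) : ∀ {a : R},
    (∀ y ∈ maximalIdeal R ^ n, b ∣ y * a) → b ∣ a := by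
  induction n with
  | zero => intro a h; simpa using h 1 (by simp)
  | succ n ih =>
    intro a h
    refine ih fun y hy => dvd_of_forall_mem_maximalIdeal hdim hb fun z hz => ?_
    rw [← mul_assoc]
    exact h _ (by rw [pow_succ']; exact Ideal.mul_mem_mul hz hy)

end IsRegularLocalRing

/-- Let `B` be a noetherian domain all of whose localizations at primes contained in `q` are
regular. If the fraction `a / b` is not in `B_q`, it is not in `B_p` for some `p ≤ q` of height
one. -/
lemma exists_prime_ringKrullDim_eq_one {B : Type u} [CommRing B] [IsDomain B] [IsNoetherianRing B]
    (q : Ideal B) [q.IsPrime]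
    (hreg : ∀ (p : Ideal B) [p.IsPrime], p ≤ q → IsRegularLocalRing (Localization.AtPrime p))
    {a b : B} (hb : b ≠ 0) (hab : ¬ ∃ h, h ∉ q ∧ b ∣ h * a) :
    ∃ (p : Ideal B) (_ : p.IsPrime), p ≤ q ∧ ringKrullDim (Localization.AtPrime p) = 1 ∧
      ¬ ∃ h, h ∉ p ∧ b ∣ h * a := by
  -- The ideal of denominators of a / b. A minimal prime p over J inside q is a generic point of the
  -- polar locus.
  let J : Ideal B :=
    { carrier := {h | b ∣ h * a}
      add_mem' := fun hx hy => by simpa [add_mul] using dvd_add hx hy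
      zero_mem' := by simp
      smul_mem' := fun c x hx => by
        simp only [Set.mem_ofPred_eq, smul_eq_mul, mul_assoc]; exact Dvd.dvd.mul_left hx c }
  have hJ : ∀ h, h ∈ J ↔ b ∣ h * a := fun _ => Iff.rfl
  have hJq : J ≤ q := fun h hh => by_contra fun hq => hab ⟨h, hq, hh⟩
  obtain ⟨p, hp, hpq⟩ := Ideal.exists_minimalPrimes_le hJq
  have hpp : p.IsPrime := hp.1.1
  have hJp : J ≤ p := hp.1.2
  have hnot : ¬ ∃ h, h ∉ p ∧ b ∣ h * a := fun ⟨h, h1, h2⟩ => h1 (hJp h2)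
  refine ⟨p, hpp, hpq, ?_, hnot⟩
  have := hreg p hpq
  have hinj : Function.Injective (algebraMap B (Localization.AtPrime p)) :=
    IsLocalization.injective _ p.primeCompl_le_nonZeroDivisors
  set R := Localization.AtPrime p
  -- By minimality of p the ideal J becomes primary to the maximal ideal of B_p, so a power of that
  -- ideal multiplies a / b into B_p. In dimension at least two the depth argument then puts a / b
  -- itself into B_p.
  have hrad : IsLocalRing.maximalIdeal R ≤ (J.map (algebraMap B R)).radical := by
    rw [Ideal.radical_eq_sInf]
    refine le_sInf fun P ⟨hP, hPp⟩ => ?_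
    have h1 : P.comap (algebraMap B R) ≤ p := by
      exact (Ideal.comap_mono (IsLocalRing.le_maximalIdeal hPp.ne_top)).trans
        (Localization.AtPrime.under_maximalIdeal (I := p)).le
    have h2 : p ≤ P.comap (algebraMap B R) := hp.2 ⟨inferInstance, Ideal.map_le_iff_le_comap.1 hP⟩ h1
    rw [← Localization.AtPrime.map_eq_maximalIdeal]
    exact Ideal.map_le_iff_le_comap.2 h2
  have hlt : ¬ 2 ≤ ringKrullDim R := by
    intro h2
    obtain ⟨n, hn⟩ := Ideal.exists_pow_le_of_le_radical_of_fg hrad (IsNoetherian.noetherian _)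
    have h3 : algebraMap B R b ∣ algebraMap B R a := by
      refine IsRegularLocalRing.dvd_of_forall_mem_maximalIdeal_pow h2
        (by rwa [Ne, map_eq_zero_iff _ hinj]) n fun y hy => ?_
      refine Submodule.span_induction (p := fun y _ => algebraMap B R b ∣ y * algebraMap B R a)
        ?_ ?_ ?_ ?_ (hn hy)
      · rintro _ ⟨h, hh, rfl⟩
        rw [← map_mul]
        exact map_dvd _ ((hJ h).1 hh)
      · simp
      · intro x y _ _ hx hy
        rw [add_mul]; exact dvd_add hx hy
      · intro c x _ hx
        rw [smul_eq_mul, mul_assoc]; exact Dvd.dvd.mul_left hx c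
    obtain ⟨c, hc⟩ := h3
    obtain ⟨c, h, rfl⟩ := IsLocalization.exists_mk'_eq p.primeCompl c
    refine hnot ⟨h, h.2, c, hinj ?_⟩
    rw [map_mul, hc, map_mul, mul_comm, mul_assoc, IsLocalization.mk'_spec]
  have hfr := IsRegularLocalRing.spanFinrank_maximalIdeal (R := R)
  rw [← hfr] at hlt ⊢
  have hlt' : (IsLocalRing.maximalIdeal R).spanFinrank < 2 := by
    by_contra hcon
    exact hlt (by exact_mod_cast not_lt.1 hcon)
  -- Dimension zero is excluded because b is a nonzero element of J, hence of p.
  have hne : (IsLocalRing.maximalIdeal R).spanFinrank ≠ 0 := by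
    intro h0
    have h2 := (Submodule.spanFinrank_eq_zero_iff_eq_bot (IsNoetherian.noetherian _)).1 h0
    have h3 : algebraMap B R b ∈ IsLocalRing.maximalIdeal R := by
      rw [← Localization.AtPrime.map_eq_maximalIdeal]
      exact Ideal.mem_map_of_mem _ (hJp ((hJ b).2 (dvd_mul_right b a)))
    rw [h2, Ideal.mem_bot, map_eq_zero_iff _ hinj] at h3
    exact hb h3
  have : (IsLocalRing.maximalIdeal R).spanFinrank = 1 := by omega
  rw [this]; rfl

end

noncomputable section

/-! ### Differentials in characteristic zero -/

open KaehlerDifferential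

/-- Passing to the fraction field is a localization, and an algebraic extension in characteristic
zero is separable; both steps are formally étale. -/
lemma Algebra.FormallyEtale.of_isAlgebraic_of_charZero (R L : Type u) [CommRing R] [IsDomain R]
    [Field L] [CharZero L] [Algebra R L] [FaithfulSMul R L] [Algebra.IsAlgebraic R L] :
    Algebra.FormallyEtale R L := by
  let F := FractionRing R
  let : Algebra F L := FractionRing.liftAlgebra R L
  have : IsScalarTower R F L := FractionRing.isScalarTower_liftAlgebra R L
  have : CharZero F := (algebraMap F L).charZero
  have : Algebra.IsAlgebraic F L := Algebra.IsAlgebraic.extendScalars (R := R)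
    (IsFractionRing.injective R F)
  have : Algebra.FormallyEtale R F := Algebra.FormallyEtale.of_isLocalization (nonZeroDivisors R)
  have : Algebra.FormallyEtale F L := Algebra.FormallyEtale.of_isSeparable F L
  exact Algebra.FormallyEtale.comp R F L

/-- If `L` is formally étale over `R`, then the differentials of a generating family of `Ω_R`
generate `Ω_L`. -/
lemma KaehlerDifferential.span_eq_top_of_formallyEtale {k R L : Type u} [CommRing k] [CommRing R]
    [Field L] [Algebra k R] [Algebra k L] [Algebra R L] [IsScalarTower k R L]
    [Algebra.FormallyEtale R L] {ι : Type*} {v : ι → Ω[R⁄k]}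
    (hv : Submodule.span R (Set.range v) = ⊤) :
    Submodule.span L (Set.range fun i => KaehlerDifferential.map k k R L (v i)) = ⊤ := by
  have h := (KaehlerDifferential.isBaseChange_of_formallyEtale k R L)
  have key : ∀ m : Ω[R⁄k], KaehlerDifferential.map k k R L m ∈
      Submodule.span L (Set.range fun i => KaehlerDifferential.map k k R L (v i)) := by
    intro m
    have : m ∈ Submodule.span R (Set.range v) := hv ▸ Submodule.mem_top
    induction this using Submodule.span_induction with
    | mem x hx =>
      obtain ⟨i, rfl⟩ := hx
      exact Submodule.subset_span ⟨i, rfl⟩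
    | zero => simp
    | add x y _ _ hx hy => rw [map_add]; exact add_mem hx hy
    | smul a x _ hx =>
      rw [map_smul, ← algebraMap_smul L a]
      exact Submodule.smul_mem _ _ hx
  rw [eq_top_iff]
  intro x _
  refine h.inductionOn x (fun x => x ∈ Submodule.span L
    (Set.range fun i => KaehlerDifferential.map k k R L (v i))) (zero_mem _) key
    (fun s n hn => Submodule.smul_mem _ _ hn) fun a b ha hb => add_mem ha hb

lemma IsTranscendenceBasis.isAlgebraic_aeval {k L : Type*} [Field k] [Field L]
    [Algebra k L] {ι : Type*} {y : ι → L} (hy : IsTranscendenceBasis k y) :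
    letI : Algebra (MvPolynomial ι k) L := (MvPolynomial.aeval y).toAlgebra
    Algebra.IsAlgebraic (MvPolynomial ι k) L := by
  let : Algebra (MvPolynomial ι k) L := (MvPolynomial.aeval y).toAlgebra
  have := hy.isAlgebraic
  refine Algebra.IsAlgebraic.of_ringHom_of_comp_eq (S := Algebra.adjoin k (Set.range y)) (B := L)
    hy.1.aevalEquiv (RingHom.id L) hy.1.aevalEquiv.surjective Function.injective_id ?_
  ext x
  · simp [RingHom.algebraMap_toAlgebra]
  · simp [RingHom.algebraMap_toAlgebra]

/-- L is formally étale over the polynomial ring k[y], so Ω_L is the base change of a free module on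
the dX_i, and the differentials of the y_i form a basis. -/
lemma IsTranscendenceBasis.linearIndependent_D {k L : Type u} [Field k] [CharZero k] [Field L]
    [Algebra k L] {ι : Type u} {y : ι → L} (hy : IsTranscendenceBasis k y) :
    LinearIndependent L (fun i => D k L (y i)) := by
  have : CharZero L := charZero_of_injective_algebraMap (algebraMap k L).injective
  let : Algebra (MvPolynomial ι k) L := (MvPolynomial.aeval y).toAlgebra
  have : IsScalarTower k (MvPolynomial ι k) L := IsScalarTower.of_algebraMap_eq' (by
    exact (MvPolynomial.aeval y).comp_algebraMap.symm)
  have : FaithfulSMul (MvPolynomial ι k) L := (faithfulSMul_iff_algebraMap_injective _ _).2 hy.1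
  have : Algebra.IsAlgebraic (MvPolynomial ι k) L := hy.isAlgebraic_aeval
  have := Algebra.FormallyEtale.of_isAlgebraic_of_charZero (MvPolynomial ι k) L
  let b := ((mvPolynomialBasis k ι).baseChange L).map
    (tensorKaehlerEquivOfFormallyEtale k (MvPolynomial ι k) L)
  convert b.linearIndependent with i
  simp [b, RingHom.algebraMap_toAlgebra]

lemma AlgebraicIndependent.linearIndependent_D {k L : Type u} [Field k] [CharZero k] [Field L]
    [Algebra k L] {ι : Type*} {y : ι → L} (hy : AlgebraicIndependent k y) :
    LinearIndependent L (fun i => D k L (y i)) := by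
  obtain ⟨s, hs, hb⟩ := exists_isTranscendenceBasis_superset
    (show AlgebraicIndepOn k id (Set.range y) from hy.to_subtype_range)
  have := hb.linearIndependent_D
  let e : ι → s := fun i => ⟨y i, hs ⟨i, rfl⟩⟩
  exact this.comp e fun i j hij => hy.injective (congrArg Subtype.val hij)

lemma AlgebraicIndependent.linearIndependent_D_algebraMap {k R L : Type u} [Field k] [CharZero k]
    [CommRing R] [Algebra k R] [Field L] [Algebra k L] [Algebra R L] [IsScalarTower k R L]
    [FaithfulSMul R L] {ι : Type*} {y : ι → R} (hy : AlgebraicIndependent k y) :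
    LinearIndependent L (fun i => D k L (algebraMap R L (y i))) :=
  (hy.map' (f := IsScalarTower.toAlgHom k R L)
    (FaithfulSMul.algebraMap_injective R L)).linearIndependent_D

/-- Adjoining to lifts of algebraically independent elements a nonzero element of the kernel
gives an algebraically independent family. -/
lemma AlgebraicIndependent.option_of_mem_ker {k A B : Type*} [Field k] [CommRing A] [IsDomain A]
    [CommRing B] [Algebra k A] [Algebra k B] (φ : A →ₐ[k] B) {ι : Type*} {x : ι → A}
    (hx : AlgebraicIndependent k fun i => φ (x i)) {a : A} (ha : a ≠ 0) (hφ : φ a = 0) :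
    AlgebraicIndependent k (fun o : Option ι => o.elim a x) := by
  have hx' : AlgebraicIndependent k x := AlgebraicIndependent.of_comp φ hx
  rw [hx'.option_iff_transcendental]
  intro halg
  -- A relation satisfied by a can be chosen with nonzero constant coefficient. Applying φ, which
  -- kills a, leaves only that coefficient, a polynomial in the x_i whose image vanishes;
  -- independence of the φ(x_i) makes it zero.
  obtain ⟨q, hq0, hq⟩ := halg.exists_nonzero_coeff_and_aeval_eq_zero
    (mem_nonZeroDivisors_of_ne_zero ha)
  have h1 : φ (q.coeff 0) = 0 := by
    have := congrArg φ hq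
    rw [← Polynomial.divX_mul_X_add q] at this
    simpa [hφ] using this
  obtain ⟨P, hP⟩ : ∃ P : MvPolynomial ι k, MvPolynomial.aeval x P = q.coeff 0 := by
    have := Algebra.adjoin_range_eq_range_aeval k x
    exact (this.le (q.coeff 0).2 :)
  have h2 : P = 0 := by
    apply hx
    rw [map_zero, ← h1, ← hP, ← AlgHom.comp_apply, MvPolynomial.comp_aeval]
  rw [h2, map_zero] at hP
  exact hq0 (Subtype.ext hP.symm)

/-- Each strict inclusion in the chain contributes one element of the larger prime outside the
smaller one, which `AlgebraicIndependent.option_of_mem_ker` adjoins to the family. Applied to a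
chain of maximal length, this bounds the rank of Ω_L from below in `IsRegularLocalRing.coordinates`.
-/
lemma exists_algebraicIndependent_of_ltSeries {k R : Type*} [Field k] [CommRing R] [Algebra k R]
    (l : LTSeries (PrimeSpectrum R)) {m : ℕ} (x : Fin m → R)
    (hx : AlgebraicIndependent k fun i => Ideal.Quotient.mkₐ k l.last.asIdeal (x i)) :
    ∃ y : Fin (m + l.length) → R,
      AlgebraicIndependent k fun i => Ideal.Quotient.mkₐ k l.head.asIdeal (y i) := by
  -- Descending induction along the chain: i is the number of steps below its top.
  have key : ∀ i ≤ l.length, ∀ j : Fin (l.length + 1), j + i = l.length →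
      ∃ y : Fin (m + i) → R,
        AlgebraicIndependent k fun a => Ideal.Quotient.mkₐ k (l j).asIdeal (y a) := by
    intro i
    induction i with
    | zero =>
      intro _ j hj
      obtain rfl : j = Fin.last _ := Fin.ext (by simpa using hj)
      exact ⟨x, hx⟩
    | succ i ih =>
      intro hi j hj
      obtain ⟨y, hy⟩ := ih (by omega) ⟨j + 1, by omega⟩ (by simp; omega)
      set j' : Fin (l.length + 1) := ⟨j + 1, by omega⟩
      have hlt : (l j).asIdeal < (l j').asIdeal :=
        l.strictMono (show j < j' from Fin.lt_def.2 (Nat.lt_succ_self _))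
      obtain ⟨a, ha, ha'⟩ := SetLike.exists_of_lt hlt
      have := AlgebraicIndependent.option_of_mem_ker
        (Ideal.Quotient.factorₐ k hlt.le) (x := fun i => Ideal.Quotient.mkₐ k (l j).asIdeal (y i))
        hy (a := Ideal.Quotient.mkₐ k (l j).asIdeal a)
        (fun h => ha' (Ideal.Quotient.eq_zero_iff_mem.1 h))
        (Ideal.Quotient.eq_zero_iff_mem.2 ha)
      let e : Fin (m + (i + 1)) ≃ Option (Fin (m + i)) := finSuccEquiv (m + i)
      refine ⟨fun b => (e b).elim a y, ?_⟩
      have h2 := this.comp e e.injective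
      have h3 : ((fun o : Option (Fin (m + i)) => o.elim (Ideal.Quotient.mkₐ k (l j).asIdeal a)
          fun i => Ideal.Quotient.mkₐ k (l j).asIdeal (y i)) ∘ e) =
          fun b => Ideal.Quotient.mkₐ k (l j).asIdeal ((e b).elim a y) := by
        funext b
        simp only [Function.comp_apply]
        cases e b <;> rfl
      rw [h3] at h2
      exact h2
  exact key l.length le_rfl 0 (by simp)

/-- Over a local `k`-algebra, the differentials of generators of the maximal ideal and of lifts of
a transcendence basis of the residue field generate the module of differentials. -/
lemma IsLocalRing.span_D_eq_top {k R : Type*} [Field k] [CharZero k] [CommRing R] [IsLocalRing R]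
    [Algebra k R] [Module.Finite R Ω[R⁄k]] {σ ι : Type*} {s : σ → R}
    (hs : Ideal.span (Set.range s) = maximalIdeal R) {x : ι → R}
    (hx : IsTranscendenceBasis k fun i => residue R (x i)) :
    Submodule.span R (Set.range fun i => D k R (Sum.elim s x i)) = ⊤ := by
  set N := Submodule.span R (Set.range fun i => D k R (Sum.elim s x i)) with hN
  -- By Nakayama it is enough to generate modulo the maximal ideal.
  suffices h : (⊤ : Submodule R Ω[R⁄k]) ≤ N ⊔ maximalIdeal R • ⊤ by
    exact top_le_iff.1 (Submodule.le_of_le_smul_of_le_jacobson_bot Module.Finite.fg_top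
      (maximalIdeal_le_jacobson _) h)
  set N' := N ⊔ maximalIdeal R • (⊤ : Submodule R Ω[R⁄k])
  have hm : ∀ r ∈ maximalIdeal R, ∀ ω : Ω[R⁄k], r • ω ∈ N' := fun r hr ω =>
    le_sup_right (a := N) (Submodule.smul_mem_smul hr trivial)
  have hgen : ∀ i, D k R (Sum.elim s x i) ∈ N' := fun i =>
    le_sup_left (b := maximalIdeal R • (⊤ : Submodule R Ω[R⁄k])) (Submodule.subset_span ⟨i, rfl⟩)
  have hDm : ∀ r ∈ maximalIdeal R, D k R r ∈ N' := by
    intro r hr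
    rw [← hs] at hr
    induction hr using Submodule.span_induction with
    | mem r hr => obtain ⟨i, rfl⟩ := hr; exact hgen (Sum.inl i)
    | zero => simp
    | add a b _ _ ha hb => rw [map_add]; exact add_mem ha hb
    | smul c r hr h =>
      rw [smul_eq_mul, Derivation.leibniz]
      exact add_mem (Submodule.smul_mem _ _ h) (hm _ (hs ▸ hr) _)
  let A := MvPolynomial ι k
  let : Algebra A R := (MvPolynomial.aeval x).toAlgebra
  let : Algebra A (ResidueField R) := (MvPolynomial.aeval fun i => residue R (x i)).toAlgebra
  have htow : IsScalarTower A R (ResidueField R) := IsScalarTower.of_algebraMap_eq' (by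
    refine congrArg AlgHom.toRingHom (?_ : MvPolynomial.aeval (fun i => residue R (x i)) =
      (IsScalarTower.toAlgHom k R (ResidueField R)).comp (MvPolynomial.aeval x))
    rw [MvPolynomial.comp_aeval]
    rfl)
  have hinj : Function.Injective (algebraMap A (ResidueField R)) := hx.1
  have halg' : Algebra.IsAlgebraic A (ResidueField R) := hx.isAlgebraic_aeval
  have hDA : ∀ a : A, D k R (algebraMap A R a) ∈ N' := by
    intro a
    change D k R (MvPolynomial.aeval x a) ∈ N'
    induction a using MvPolynomial.induction_on with
    | C c => simp
    | add a b ha hb => rw [map_add, map_add]; exact add_mem ha hb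
    | mul_X a i ha =>
      rw [map_mul, Derivation.leibniz, MvPolynomial.aeval_X]
      exact add_mem (Submodule.smul_mem _ _ (hgen (Sum.inr i))) (Submodule.smul_mem _ _ ha)
  have hDr : ∀ r : R, D k R r ∈ N' := by
    intro r
    -- Modulo N' the differentials of the coefficients vanish, so only the term p'(r) dr of d(p(r))
    -- survives.
    have hpoly : ∀ p : Polynomial A, D k R (Polynomial.aeval r p) -
        Polynomial.aeval r p.derivative • D k R r ∈ N' := by
      intro p
      induction p using Polynomial.induction_on' with
      | add p q hp hq =>
        convert add_mem hp hq using 1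
        simp only [map_add, add_smul]
        abel
      | monomial n a =>
        have : D k R (Polynomial.aeval r (Polynomial.monomial n a)) -
            Polynomial.aeval r (Polynomial.monomial n a).derivative • D k R r =
            r ^ n • D k R (algebraMap A R a) := by
          simp only [Polynomial.aeval_monomial, Polynomial.derivative_monomial,
            Derivation.leibniz, Derivation.leibniz_pow, map_mul, map_natCast]
          rw [← Nat.cast_smul_eq_nsmul R, smul_smul, smul_smul]
          abel
        rw [this]
        exact Submodule.smul_mem _ _ (hDA a)
    have halg : IsAlgebraic A (residue R r) := halg'.isAlgebraic _
    classical
    -- A polynomial of least degree killing the residue of r has, in characteristic zero, a nonzero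
    -- derivative of smaller degree, which by minimality does not kill it. So p'(r) is a unit while
    -- p(r) lies in the maximal ideal, and dr can be solved for.
    have hex : ∃ n : ℕ, ∃ p : Polynomial A, p ≠ 0 ∧ Polynomial.aeval (residue R r) p = 0 ∧
        p.natDegree = n := by
      obtain ⟨p, hp, hp'⟩ := halg
      exact ⟨_, p, hp, hp', rfl⟩
    obtain ⟨p, hp, hp0, hpd⟩ := Nat.find_spec hex
    have hd0 : p.natDegree ≠ 0 := by
      intro h0
      rw [Polynomial.eq_C_of_natDegree_eq_zero h0, Polynomial.aeval_C] at hp0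
      rw [map_eq_zero_iff _ hinj] at hp0
      rw [Polynomial.eq_C_of_natDegree_eq_zero h0, hp0, map_zero] at hp
      exact hp rfl
    have hder : p.derivative ≠ 0 := fun h => hd0 (Polynomial.derivative_eq_zero.1 h)
    have hne : Polynomial.aeval (residue R r) p.derivative ≠ 0 := fun h =>
      Nat.find_min hex (hpd ▸ Polynomial.natDegree_derivative_lt hd0) ⟨_, hder, h, rfl⟩
    have hres : ∀ q : Polynomial A, Polynomial.aeval (residue R r) q =
        residue R (Polynomial.aeval r q) := fun q => by
      rw [show residue R r = algebraMap R (ResidueField R) r from rfl,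
        Polynomial.aeval_algebraMap_apply]
      rfl
    rw [hres] at hne hp0
    have hunit : IsUnit (Polynomial.aeval r p.derivative) := by
      by_contra hcon
      exact hne ((residue_eq_zero_iff _).2 hcon)
    have h1 := hDm _ ((residue_eq_zero_iff _).1 hp0)
    have h2 := sub_mem h1 (hpoly p)
    rw [sub_sub_cancel] at h2
    exact (Submodule.smul_mem_iff_of_isUnit N' hunit).1 h2
  rw [← KaehlerDifferential.span_range_derivation, Submodule.span_le]
  rintro _ ⟨r, rfl⟩
  exact hDr r

/-- Let `L` be an algebraic field extension of the fraction field of a regular local ring `R` of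
characteristic zero. A regular system of parameters of `R`, together with lifts of a transcendence
basis of the residue field, is a system of coordinates: its differentials generate `Ω_R` and
are a basis of `Ω_L`. -/
theorem IsRegularLocalRing.coordinates {k R L : Type u} [Field k] [CharZero k] [CommRing R]
    [IsRegularLocalRing R] [Algebra k R] [Module.Finite R Ω[R⁄k]] [Field L] [Algebra k L]
    [Algebra R L] [IsScalarTower k R L] [FaithfulSMul R L] [Algebra.IsAlgebraic R L] {d : ℕ}
    (hd : ringKrullDim R = d) {s : Fin d → R}
    (hs : Ideal.span (Set.range s) = IsLocalRing.maximalIdeal R) {ι : Type*} {x : ι → R}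
    (hx : IsTranscendenceBasis k fun i => IsLocalRing.residue R (x i)) :
    Finite ι ∧ Submodule.span R (Set.range fun i => D k R (Sum.elim s x i)) = ⊤ ∧
      LinearIndependent L (fun i => D k L (algebraMap R L (Sum.elim s x i))) ∧
      Submodule.span L (Set.range fun i => D k L (algebraMap R L (Sum.elim s x i))) = ⊤ := by
  have : CharZero L := charZero_of_injective_algebraMap (algebraMap k L).injective
  have hR := IsLocalRing.span_D_eq_top hs hx
  have := Algebra.FormallyEtale.of_isAlgebraic_of_charZero R L
  have hL : Submodule.span L
      (Set.range fun i => D k L (algebraMap R L (Sum.elim s x i))) = ⊤ := by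
    simpa only [KaehlerDifferential.map_D] using
      KaehlerDifferential.span_eq_top_of_formallyEtale (L := L) hR
  have hfin : Module.Finite L Ω[L⁄k] := by
    obtain ⟨n, v, hv⟩ := Module.Finite.exists_fin (R := R) (M := Ω[R⁄k])
    have := KaehlerDifferential.span_eq_top_of_formallyEtale (L := L) hv
    exact ⟨⟨(Set.finite_range fun i => KaehlerDifferential.map k k R L (v i)).toFinset,
      by simpa using this⟩⟩
  have hxR : AlgebraicIndependent k x :=
    AlgebraicIndependent.of_comp (IsScalarTower.toAlgHom k R (IsLocalRing.ResidueField R)) hx.1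
  have hι : Finite ι := (hxR.linearIndependent_D_algebraMap (L := L)).finite
  refine ⟨hι, hR, ?_, hL⟩
  obtain ⟨m, ⟨e⟩⟩ := Finite.exists_equiv_fin ι
  -- A chain of length d together with the m elements x gives m + d algebraically independent
  -- elements, so Ω_L has dimension at least m + d. The m + d generators are then a basis.
  obtain ⟨l, hl⟩ : ∃ l : LTSeries (PrimeSpectrum R), l.length = d :=
    (Order.le_krullDim_iff (α := PrimeSpectrum R) (n := d)).1 hd.ge
  have hle : l.last.asIdeal ≤ IsLocalRing.maximalIdeal R :=
    IsLocalRing.le_maximalIdeal l.last.2.ne_top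
  have hxl : AlgebraicIndependent k fun i => Ideal.Quotient.mkₐ k l.last.asIdeal (x (e.symm i)) :=
    AlgebraicIndependent.of_comp (Ideal.Quotient.factorₐ k hle)
      (hx.1.comp e.symm e.symm.injective)
  obtain ⟨y, hy⟩ := exists_algebraicIndependent_of_ltSeries l (fun i => x (e.symm i)) hxl
  have hyR : AlgebraicIndependent k y := AlgebraicIndependent.of_comp _ hy
  have hcard := (hyR.linearIndependent_D_algebraMap (L := L)).fintype_card_le_finrank
  have : Fintype ι := Fintype.ofFinite ι
  have hιm : Fintype.card ι = m := by simpa using Fintype.card_congr e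
  refine linearIndependent_of_top_le_span_of_card_eq_finrank hL.ge (le_antisymm ?_ ?_)
  · simpa [hl, hιm, add_comm] using hcard
  · have := finrank_range_le_card (R := L) fun i => D k L (algebraMap R L (Sum.elim s x i))
    rwa [Set.finrank, hL, finrank_top] at this

/-- A regular local ring, essentially of finite type over a field of characteristic zero, has a
system of coordinates. -/
theorem IsRegularLocalRing.exists_coordinates {k : Type u} (R L : Type u) [Field k] [CharZero k]
    [CommRing R] [IsRegularLocalRing R] [Algebra k R] [Module.Finite R Ω[R⁄k]] [Field L]
    [Algebra k L] [Algebra R L] [IsScalarTower k R L] [FaithfulSMul R L]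
    [Algebra.IsAlgebraic R L] :
    ∃ (n : ℕ) (t : Fin n → R), Submodule.span R (Set.range fun i => D k R (t i)) = ⊤ ∧
      LinearIndependent L (fun i => D k L (algebraMap R L (t i))) ∧
      Submodule.span L (Set.range fun i => D k L (algebraMap R L (t i))) = ⊤ := by
  obtain ⟨S, hcard, hS⟩ := Submodule.FG.exists_span_finset_card_eq_spanFinrank
    (IsNoetherian.noetherian (IsLocalRing.maximalIdeal R))
  let e := Finset.equivFinOfCardEq hcard
  obtain ⟨B, hB⟩ := exists_isTranscendenceBasis k (IsLocalRing.ResidueField R)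
  choose x hx using fun b : B => IsLocalRing.residue_surjective (b : IsLocalRing.ResidueField R)
  have hs : Ideal.span (Set.range fun i => ((e.symm i : S) : R)) = IsLocalRing.maximalIdeal R := by
    refine Eq.trans (congrArg _ ?_) hS
    ext y
    constructor
    · rintro ⟨i, rfl⟩; exact (e.symm i).2
    · intro hy; exact ⟨e ⟨y, hy⟩, by simp⟩
  have hx' : IsTranscendenceBasis k fun b : B => IsLocalRing.residue R (x b) := by
    convert hB with b; exact hx b
  obtain ⟨hfin, h1, h2, h3⟩ := IsRegularLocalRing.coordinates (k := k) (L := L)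
    (IsRegularLocalRing.spanFinrank_maximalIdeal (R := R)).symm hs hx'
  obtain ⟨n, ⟨e'⟩⟩ := Finite.exists_equiv_fin (Fin (IsLocalRing.maximalIdeal R).spanFinrank ⊕ B)
  refine ⟨n, fun i => Sum.elim _ x (e'.symm i), ?_, h2.comp _ e'.symm.injective, ?_⟩
  · rw [← h1]; exact congrArg _ (e'.symm.surjective.range_comp fun i => D k R (Sum.elim _ x i))
  · rw [← h3]
    exact congrArg _ (e'.symm.surjective.range_comp
      fun i => D k L (algebraMap R L (Sum.elim _ x i)))

end

noncomputable section

/-! ### Forms that are regular along a subring of a field -/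

open KaehlerDifferential Module

/-- The `p`-forms on the field `L` that are sums of `r dx₁ ∧ ⋯ ∧ dx_p` with `r, x₁, …, x_p` in the
subring `R`. -/
def regularForms (k : Type*) {L : Type*} [CommRing k] [CommRing L] [Algebra k L] (R : Subring L)
    (p : ℕ) : AddSubgroup (⋀[L]^p Ω[L⁄k]) :=
  AddSubgroup.closure {ω | ∃ r ∈ R, ∃ x : Fin p → L, (∀ i, x i ∈ R) ∧
    ω = r • exteriorPower.ιMulti L p fun i => D k L (x i)}

namespace regularForms

variable {k L : Type*} [Field k] [Field L] [Algebra k L] {R : Subring L} {p : ℕ}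

lemma smul_ιMulti_mem {r : L} (hr : r ∈ R) {x : Fin p → L} (hx : ∀ i, x i ∈ R) :
    r • exteriorPower.ιMulti L p (fun i => D k L (x i)) ∈ regularForms k R p :=
  AddSubgroup.subset_closure ⟨r, hr, x, hx, rfl⟩

lemma mono {R' : Subring L} (h : R ≤ R') : regularForms k R p ≤ regularForms k R' p :=
  AddSubgroup.closure_mono fun _ ⟨r, hr, x, hx, e⟩ => ⟨r, h hr, x, fun i => h (hx i), e⟩

variable {ι : Type*}

/-- If the differentials of elements of `R` have coordinates in `R`, so do the `p`-forms regular
along `R`. -/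
lemma repr_mem [LinearOrder ι] (b : Basis ι L Ω[L⁄k]) (hb : ∀ r ∈ R, ∀ i, b.repr (D k L r) i ∈ R)
    {ω : ⋀[L]^p Ω[L⁄k]} (hω : ω ∈ regularForms k R p) (s : Set.powersetCard ι p) :
    (b.exteriorPower p).repr ω s ∈ R := by
  induction hω using AddSubgroup.closure_induction with
  | mem ω hω =>
    obtain ⟨r, hr, x, hx, rfl⟩ := hω
    -- The coordinates of dx₁ ∧ ⋯ ∧ dx_p are minors of the matrix of coordinates of the dx_i.
    rw [map_smul, Finsupp.smul_apply, smul_eq_mul, exteriorPower.basis_repr_apply,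
      exteriorPower.ιMultiDual_apply_ιMulti, Matrix.det_apply]
    refine R.mul_mem hr (R.sum_mem fun σ _ => ?_)
    rw [Units.smul_def]
    exact R.zsmul_mem (R.prod_mem fun i _ => hb _ (hx _) _) _
  | zero => simp
  | add a b _ _ ha hb => rw [map_add]; exact R.add_mem ha hb
  | neg a _ ha => rw [map_neg]; exact R.neg_mem ha

/-- A `p`-form whose coordinates in a basis `dt₁, …, dt_n` with `t_i ∈ R` are in `R` is regular
along `R`. -/
lemma mem_of_repr_mem [LinearOrder ι] (b : Basis ι L Ω[L⁄k]) (hb : ∀ i, ∃ t ∈ R, b i = D k L t)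
    {ω : ⋀[L]^p Ω[L⁄k]} (hω : ∀ s, (b.exteriorPower p).repr ω s ∈ R) :
    ω ∈ regularForms k R p := by
  rw [← (b.exteriorPower p).linearCombination_repr ω, Finsupp.linearCombination_apply]
  refine AddSubgroup.sum_mem _ fun s _ => ?_
  choose t ht htb using hb
  beta_reduce
  rw [exteriorPower.basis_apply, exteriorPower.ιMulti_family]
  convert smul_ιMulti_mem (hω s) (x := fun i => t (Set.powersetCard.ofFinEmbEquiv.symm s i))
    (fun i => ht _) using 3
  funext i
  exact htb _

/-- The coordinates of differentials extend to localizations. -/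
lemma repr_D_mem_of_frac {R' : Subring L} (hle : R ≤ R')
    (hfrac : ∀ c ∈ R', ∃ x ∈ R, ∃ y ∈ R, y⁻¹ ∈ R' ∧ c = x / y) (b : Basis ι L Ω[L⁄k])
    (hb : ∀ r ∈ R, ∀ i, b.repr (D k L r) i ∈ R) : ∀ r ∈ R', ∀ i, b.repr (D k L r) i ∈ R' := by
  intro c hc i
  obtain ⟨x, hx, y, hy, hy', rfl⟩ := hfrac c hc
  rw [Derivation.leibniz_div, map_smul, map_sub, map_smul, map_smul, Finsupp.smul_apply,
    Finsupp.sub_apply, Finsupp.smul_apply, Finsupp.smul_apply, smul_eq_mul, smul_eq_mul,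
    smul_eq_mul]
  exact R'.mul_mem (pow_mem hy' 2) (sub_mem (R'.mul_mem (hle hy) (hle (hb _ hx i)))
    (R'.mul_mem (hle hx) (hle (hb _ hy i))))

/-- Rescaling a basis rescales the coordinates of `p`-forms. -/
lemma repr_exteriorPower_unitsSMul [LinearOrder ι] (b : Basis ι L Ω[L⁄k]) (w : ι → Lˣ) (ω : ⋀[L]^p Ω[L⁄k])
    (s : Set.powersetCard ι p) :
    (b.exteriorPower p).repr ω s =
      (∏ i, (w (Set.powersetCard.ofFinEmbEquiv.symm s i) : L)) *
        ((b.unitsSMul w).exteriorPower p).repr ω s := by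
  classical
  have key : ∀ t : Set.powersetCard ι p, (b.unitsSMul w).exteriorPower p t =
      (∏ i, (w (Set.powersetCard.ofFinEmbEquiv.symm t i) : L)) • b.exteriorPower p t := by
    intro t
    simp only [exteriorPower.basis_apply, exteriorPower.ιMulti_family]
    rw [← AlternatingMap.map_smul_univ]
    congr 1
    funext i
    simp [Basis.unitsSMul_apply, Units.smul_def]
  conv_lhs => rw [← ((b.unitsSMul w).exteriorPower p).linearCombination_repr ω]
  rw [Finsupp.linearCombination_apply, Finsupp.sum, map_sum, Finset.sum_apply']
  simp only [key, map_smul, Finsupp.smul_apply, Basis.repr_self, smul_eq_mul,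
    Finsupp.single_apply]
  by_cases hs : s ∈ (((b.unitsSMul w).exteriorPower p).repr ω).support
  · rw [Finset.sum_eq_single_of_mem s hs]
    · simp [mul_comm]
    · intro t _ hts; simp [hts]
  · rw [Finset.sum_eq_zero, Finsupp.notMem_support_iff.1 hs, mul_zero]
    intro t ht
    rw [if_neg (by rintro rfl; exact hs ht)]
    simp

end regularForms

/-- Coordinates of differentials with respect to generators `dt_i` of `Ω_R`. -/
lemma Module.Basis.repr_D_mem_range {k R L : Type*} [Field k] [CommRing R] [Algebra k R] [Field L]
    [Algebra k L] [Algebra R L] [IsScalarTower k R L] {ι : Type*} {t : ι → R}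
    (ht : Submodule.span R (Set.range fun i => D k R (t i)) = ⊤) (b : Basis ι L Ω[L⁄k])
    (hb : ∀ i, b i = D k L (algebraMap R L (t i))) :
    ∀ r ∈ (algebraMap R L).range, ∀ i, b.repr (D k L r) i ∈ (algebraMap R L).range := by
  rintro _ ⟨r, rfl⟩ i
  have hr : D k R r ∈ Submodule.span R (Set.range fun i => D k R (t i)) := ht ▸ trivial
  rw [← KaehlerDifferential.map_D k k R L]
  generalize D k R r = v at hr
  induction hr using Submodule.span_induction with
  | mem x hx =>
    classical
    obtain ⟨j, rfl⟩ := hx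
    rw [KaehlerDifferential.map_D, ← hb, Basis.repr_self, Finsupp.single_apply]
    split_ifs
    · exact one_mem _
    · exact zero_mem _
  | zero => simp
  | add x y _ _ hx hy => rw [map_add, map_add]; exact add_mem hx hy
  | smul a x _ hx =>
    rw [map_smul, ← algebraMap_smul L a, map_smul]
    exact mul_mem ⟨a, rfl⟩ hx

set_option maxHeartbeats 1000000 in
/-- Let `R ⊂ S` be discrete valuation rings of characteristic zero with algebraic residue
extension. A form on the fraction field of `R` that is regular along `S` is regular along `R`. -/
theorem regularForms.descend {k R S L : Type u} [Field k] [CharZero k] [CommRing R] [IsDomain R]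
    [IsDiscreteValuationRing R] [CommRing S] [IsDomain S] [IsDiscreteValuationRing S] [Field L]
    [Algebra k R] [Algebra k S] [Algebra k L] [Algebra R S] [Algebra R L] [Algebra S L]
    [IsScalarTower k R S] [IsScalarTower k R L] [IsScalarTower k S L] [IsScalarTower R S L]
    [FaithfulSMul R L] [FaithfulSMul S L] [Algebra.IsAlgebraic R L]
    [Algebra.IsAlgebraic S L] [Module.Finite R Ω[R⁄k]] [Module.Finite S Ω[S⁄k]]
    [IsLocalHom (algebraMap R S)]
    [Algebra.IsAlgebraic (IsLocalRing.ResidueField R) (IsLocalRing.ResidueField S)]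
    {p : ℕ} (K : Subring L) (hRK : (algebraMap R L).range ≤ K)
    (hK : ∀ c ∈ K, ∃ a b : R, b ≠ 0 ∧ c = algebraMap R L a / algebraMap R L b)
    (hK' : ∀ c ∈ K, c⁻¹ ∈ K)
    {ω : ⋀[L]^p Ω[L⁄k]} (hω : ω ∈ regularForms k (algebraMap S L).range p)
    (hωK : ω ∈ regularForms k K p) : ω ∈ regularForms k (algebraMap R L).range p := by
  have hinjR : Function.Injective (algebraMap R L) := FaithfulSMul.algebraMap_injective R L
  have hinjS : Function.Injective (algebraMap S L) := FaithfulSMul.algebraMap_injective S L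
  obtain ⟨t, ht⟩ := IsDiscreteValuationRing.exists_irreducible R
  obtain ⟨s, hs⟩ := IsDiscreteValuationRing.exists_irreducible S
  obtain ⟨B, hB⟩ := exists_isTranscendenceBasis k (IsLocalRing.ResidueField R)
  choose x hx using fun b : B => IsLocalRing.residue_surjective (b : IsLocalRing.ResidueField R)
  have hxR : IsTranscendenceBasis k fun b : B => IsLocalRing.residue R (x b) := by
    convert hB with b; exact hx b
  -- The residue extension is algebraic, so the same x complete both t and s to systems of
  -- coordinates.
  have hxS : IsTranscendenceBasis k fun b : B => IsLocalRing.residue S (algebraMap R S (x b)) :=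
    hxR.algebraMap_comp (A := IsLocalRing.ResidueField S)
  have hdimR : ringKrullDim R = (1 : ℕ) := by
    rw [IsDiscreteValuationRing.ringKrullDim_eq_one]; rfl
  have hdimS : ringKrullDim S = (1 : ℕ) := by
    rw [IsDiscreteValuationRing.ringKrullDim_eq_one]; rfl
  obtain ⟨hfin, hR1, hR2, hR3⟩ := IsRegularLocalRing.coordinates (L := L) hdimR
    (s := fun _ => t) (by simpa using ht.maximalIdeal_eq.symm) hxR
  obtain ⟨-, hS1, hS2, hS3⟩ := IsRegularLocalRing.coordinates (L := L) hdimS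
    (s := fun _ => s) (by simpa using hs.maximalIdeal_eq.symm) hxS
  let ι := Fin 1 ⊕ B
  let : Fintype B := Fintype.ofFinite B
  let : Fintype ι := inferInstanceAs (Fintype (Fin 1 ⊕ B))
  let : LinearOrder ι := by classical exact linearOrderOfSTO WellOrderingRel
  let bR : Basis ι L Ω[L⁄k] := Basis.mk hR2 hR3.ge
  let bS : Basis ι L Ω[L⁄k] := Basis.mk hS2 hS3.ge
  have hbR : ∀ i, bR i = _ := fun i => Basis.mk_apply hR2 hR3.ge i
  have hbS : ∀ i, bS i = _ := fun i => Basis.mk_apply hS2 hS3.ge i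
  have hDR := bR.repr_D_mem_range hR1 hbR
  have hDS := bS.repr_D_mem_range hS1 hbS
  -- the ramification index
  have htS : algebraMap R S t ∈ IsLocalRing.maximalIdeal S := fun h =>
    ht.not_isUnit (isUnit_of_map_unit (algebraMap R S) t h)
  have hinj : Function.Injective (algebraMap R S) := by
    refine Function.Injective.of_comp (f := algebraMap S L) ?_
    rw [← RingHom.coe_comp, ← IsScalarTower.algebraMap_eq]
    exact hinjR
  obtain ⟨e, u, heu⟩ := IsDiscreteValuationRing.eq_unit_mul_pow_irreducible
    (x := algebraMap R S t) (by rw [Ne, map_eq_zero_iff _ hinj]; exact ht.ne_zero) hs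
  obtain ⟨e, rfl⟩ : ∃ e', e = e' + 1 := by
    cases e with
    | zero =>
      rw [pow_zero, mul_one] at heu
      rw [heu] at htS
      exact absurd u.isUnit htS
    | succ e => exact ⟨e, rfl⟩
  have hs0 : algebraMap S L s ≠ 0 := by
    rw [Ne, map_eq_zero_iff _ hinjS]; exact hs.ne_zero
  -- The exponent was shifted so that t = u s^(e+1). The basis y consists of s^(-e) dt and the dx_j.
  let w : ι → Lˣ := Sum.elim (fun _ => (Units.mk0 _ (pow_ne_zero e hs0))⁻¹) (fun _ => 1)
  let y := bR.unitsSMul w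
  -- vectors with coordinates in `S`
  let P : Ω[L⁄k] → Prop := fun v => ∀ j, y.repr v j ∈ (algebraMap S L).range
  have hadd : ∀ v v', P v → P v' → P (v + v') := fun v v' h h' j => by
    rw [map_add]; exact add_mem (h j) (h' j)
  have hsmul : ∀ (c : S) v, P v → P (algebraMap S L c • v) := fun c v h j => by
    rw [map_smul]; exact mul_mem ⟨c, rfl⟩ (h j)
  have hsub : ∀ v v', P v → P v' → P (v - v') := fun v v' h h' j => by
    rw [map_sub]; exact sub_mem (h j) (h' j)
  have hy : ∀ i, P (y i) := fun i j => by
    classical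
    rw [Basis.repr_self, Finsupp.single_apply]
    split_ifs
    · exact one_mem _
    · exact zero_mem _
  have hyj : ∀ j, bS (Sum.inr j) = y (Sum.inr j) := fun j => by
    rw [Basis.unitsSMul_apply, hbS, hbR]
    simp [w, ← IsScalarTower.algebraMap_apply]
  -- Apart from its ds component, a vector with coordinates in S is an S-combination of the dx_j,
  -- which belong to both bases. Only ds remains to be expressed through y.
  have hPsum : ∀ v, (∀ i, bS.repr v i ∈ (algebraMap S L).range) →
      P (v - bS.repr v (Sum.inl 0) • bS (Sum.inl 0)) := by
    intro v hv
    have : v - bS.repr v (Sum.inl 0) • bS (Sum.inl 0) =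
        ∑ j : B, bS.repr v (Sum.inr j) • y (Sum.inr j) := by
      rw [sub_eq_iff_eq_add]
      conv_lhs => rw [← bS.sum_repr v, Fintype.sum_sum_type]
      simp only [Finset.univ_unique, Fin.default_eq_zero, Finset.sum_singleton, hyj]
      exact add_comm _ _
    rw [this]
    refine Finset.sum_induction _ P hadd (fun j => by simp) fun j _ => ?_
    obtain ⟨c, hc⟩ := hv (Sum.inr j)
    rw [← hc]
    exact hsmul c _ (hy _)
  have hDs : P (bS (Sum.inl 0)) := by
    have hDu := hDS (algebraMap S L u) ⟨_, rfl⟩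
    obtain ⟨α, hα⟩ := hDu (Sum.inl 0)
    have h1 := hPsum _ hDu
    rw [← hα] at h1
    have hds : bS (Sum.inl 0) = D k L (algebraMap S L s) := by rw [hbS]; rfl
    rw [hds] at h1 ⊢
    -- With α the ds coordinate of du, this is the ds coefficient of s^(-e) dt = (e + 1) u ds + s
    -- du. It is a unit since e + 1 is invertible in a ring containing a field of characteristic
    -- zero and s lies in the maximal ideal.
    have hunit : IsUnit ((e + 1 : ℕ) * (u : S) + s * α) := by
      by_contra hcon
      have h2 : ((e + 1 : ℕ) : S) * (u : S) ∈ IsLocalRing.maximalIdeal S := by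
        have h3 : s * α ∈ IsLocalRing.maximalIdeal S := Ideal.mul_mem_right _ _ (by
          rw [hs.maximalIdeal_eq]; exact Ideal.mem_span_singleton_self s)
        have := sub_mem ((IsLocalRing.mem_maximalIdeal _).2 hcon) h3
        simpa using this
      have h4 : IsUnit (((e + 1 : ℕ) : S) * (u : S)) := by
        refine IsUnit.mul ?_ u.isUnit
        have : IsUnit (algebraMap k S ((e + 1 : ℕ) : k)) :=
          (IsUnit.mk0 _ (Nat.cast_ne_zero.2 (Nat.succ_ne_zero e))).map _
        simpa using this
      exact h2 h4
    obtain ⟨ε, hε⟩ := hunit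
    have hy0 : y (Sum.inl 0) = algebraMap S L ε • D k L (algebraMap S L s) +
        algebraMap S L s • (D k L (algebraMap S L u) -
          algebraMap S L α • D k L (algebraMap S L s)) := by
      have h5 : bR (Sum.inl 0) = D k L (algebraMap S L (u * s ^ (e + 1))) := by
        rw [hbR, ← heu, ← IsScalarTower.algebraMap_apply]; rfl
      rw [Basis.unitsSMul_apply, h5, hε, map_mul, map_pow, Derivation.leibniz,
        Derivation.leibniz_pow, Units.smul_def]
      simp only [w, Sum.elim_inl, Units.val_inv_eq_inv_val, Units.val_mk0, smul_add, smul_sub,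
        smul_smul, ← Nat.cast_smul_eq_nsmul L, add_tsub_cancel_right]
      rw [map_add, map_mul, map_mul, map_natCast]
      have h6 : (algebraMap S L s ^ e)⁻¹ * (algebraMap S L u *
          ((e + 1 : ℕ) * algebraMap S L s ^ e)) = (e + 1 : ℕ) * algebraMap S L u := by
        field_simp
      have h7 : (algebraMap S L s ^ e)⁻¹ * algebraMap S L s ^ (e + 1) = algebraMap S L s := by
        field_simp
        ring
      rw [h6, h7, add_smul]
      abel
    have h8 : D k L (algebraMap S L s) = algebraMap S L (ε⁻¹ : Sˣ) • (y (Sum.inl 0) -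
        algebraMap S L s • (D k L (algebraMap S L u) -
          algebraMap S L α • D k L (algebraMap S L s))) := by
      rw [hy0, add_sub_cancel_right, smul_smul, ← map_mul, Units.inv_mul, map_one, one_smul]
    rw [h8]
    exact hsmul _ _ (hsub _ _ (hy _) (hsmul _ _ h1))
  have hDy : ∀ r ∈ (algebraMap S L).range, ∀ i, y.repr (D k L r) i ∈ (algebraMap S L).range := by
    intro r hr
    have h1 := hPsum _ (hDS r hr)
    obtain ⟨c, hc⟩ := hDS r hr (Sum.inl 0)
    rw [← hc] at h1
    have := hadd _ _ h1 (hsmul c _ hDs)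
    rwa [sub_add_cancel] at this
  have hDK : ∀ r ∈ K, ∀ i, bR.repr (D k L r) i ∈ K :=
    regularForms.repr_D_mem_of_frac hRK (fun c hc => by
      obtain ⟨a, b, hb, h⟩ := hK c hc
      exact ⟨_, RingHom.mem_range_self _ a, _, RingHom.mem_range_self _ b,
        hK' _ (hRK ⟨b, rfl⟩), h⟩) bR hDR
  refine regularForms.mem_of_repr_mem bR (fun i => ⟨_, RingHom.mem_range_self _ _, hbR i⟩) fun I => ?_
  have hcK := regularForms.repr_mem bR hDK hωK I
  -- The coordinates of ω in y lie in S. Returning to dt costs a factor s^(-e), once, for the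
  -- monomials containing dt, and nothing for the others.
  have hcS : ∃ z : S, (bR.exteriorPower p).repr ω I * algebraMap S L s ^ e = algebraMap S L z := by
    obtain ⟨z, hz⟩ := regularForms.repr_mem y hDy hω I
    rw [regularForms.repr_exteriorPower_unitsSMul bR w, ← hz]
    set em := Set.powersetCard.ofFinEmbEquiv.symm I
    have hw : ∀ i, i ≠ Sum.inl 0 → (w i : L) = 1 := by
      rintro (i | i) hi
      · exact absurd (congrArg Sum.inl (Subsingleton.elim i 0)) hi
      · rfl
    by_cases hI : ∃ a, em a = Sum.inl 0
    · obtain ⟨a, ha⟩ := hI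
      rw [Finset.prod_eq_single a]
      · refine ⟨z, ?_⟩
        rw [ha]
        simp only [w, Sum.elim_inl, Units.val_inv_eq_inv_val, Units.val_mk0]
        field_simp
      · intro b _ hba
        exact hw _ fun h => hba (em.injective (h.trans ha.symm))
      · simp
    · rw [Finset.prod_eq_one fun a _ => hw _ fun h => hI ⟨a, h⟩]
      exact ⟨z * s ^ e, by rw [one_mul, map_mul, map_pow]⟩
  generalize (bR.exteriorPower p).repr ω I = c at hcK hcS
  obtain ⟨a, b, hb, rfl⟩ := hK c hcK
  obtain ⟨z, hz⟩ := hcS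
  have hb0 : algebraMap R L b ≠ 0 := by rwa [Ne, map_eq_zero_iff _ hinjR]
  -- The coefficient a / b is in R unless b / a is a nonunit. Then t divides b / a, so s^(e+1)
  -- divides it in S, whereas s^e * a / b is in S; this would make s a unit.
  rcases ValuationRing.dvd_total b a with ⟨d, rfl⟩ | ⟨d, rfl⟩
  · exact ⟨d, by rw [map_mul]; field_simp⟩
  · have ha0 : algebraMap R L a ≠ 0 := by
      rw [map_mul] at hb0; exact left_ne_zero_of_mul hb0
    by_cases hd : IsUnit d
    · obtain ⟨d, rfl⟩ := hd
      refine ⟨(d⁻¹ : Rˣ), ?_⟩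
      rw [map_mul, eq_div_iff (by rwa [map_mul] at hb0), mul_left_comm, ← map_mul, Units.inv_mul,
        map_one, mul_one]
    · exfalso
      have hd' : d ∈ IsLocalRing.maximalIdeal R := hd
      rw [ht.maximalIdeal_eq, Ideal.mem_span_singleton] at hd'
      obtain ⟨d', rfl⟩ := hd'
      have h1 : algebraMap S L (s ^ e) =
          algebraMap S L (s ^ e * (s * (z * algebraMap R S d' * u))) := by
        have h2 : algebraMap R L t = algebraMap S L u * algebraMap S L s ^ (e + 1) := by
          rw [IsScalarTower.algebraMap_apply R S L, heu, map_mul, map_pow]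
        have h3 : algebraMap R L d' = algebraMap S L (algebraMap R S d') :=
          IsScalarTower.algebraMap_apply R S L d'
        have h4 := hb0
        rw [map_mul, map_mul] at h4
        rw [map_mul, map_mul, div_mul_eq_mul_div, div_eq_iff h4] at hz
        have h5 : algebraMap S L s ^ e = algebraMap S L z * (algebraMap R L t * algebraMap R L d') :=
          mul_left_cancel₀ ha0 (by rw [hz]; ring)
        simp only [map_mul, map_pow]
        rw [← h3]
        linear_combination h5 + algebraMap S L z * algebraMap R L d' * h2
      have h6 := hinjS h1
      have h7 : s * (z * algebraMap R S d' * u) = 1 :=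
        (mul_right_eq_self₀.1 h6.symm).resolve_right (pow_ne_zero _ hs.ne_zero)
      exact hs.not_isUnit (IsUnit.of_mul_eq_one _ h7)

end

noncomputable section

/-! ### Local rings of a domain inside a field -/

open KaehlerDifferential Module

/-- The fractions `a / h` in `L` with `a, h ∈ B` and `h ∉ q`. -/
def locRing {B : Type*} (L : Type*) [CommRing B] [Field L] [Algebra B L] (q : Ideal B) [q.IsPrime] :
    Subring L where
  -- When B embeds into L the nonvanishing of the image of h follows from h ∉ q; requiring it
  -- separately makes this a subring without injectivity.
  carrier := {c | ∃ a h : B, h ∉ q ∧ algebraMap B L h ≠ 0 ∧ c = algebraMap B L a / algebraMap B L h}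
  mul_mem' := by
    rintro _ _ ⟨a, h, hq, h0, rfl⟩ ⟨a', h', hq', h0', rfl⟩
    refine ⟨a * a', h * h', Ideal.IsPrime.mul_notMem ‹_› hq hq', ?_, ?_⟩
    · rw [map_mul]; exact mul_ne_zero h0 h0'
    · rw [map_mul, map_mul, div_mul_div_comm]
  one_mem' := ⟨1, 1, q.one_notMem, by simp, by simp⟩
  add_mem' := by
    rintro _ _ ⟨a, h, hq, h0, rfl⟩ ⟨a', h', hq', h0', rfl⟩
    refine ⟨a * h' + h * a', h * h', Ideal.IsPrime.mul_notMem ‹_› hq hq', ?_, ?_⟩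
    · rw [map_mul]; exact mul_ne_zero h0 h0'
    · rw [map_add, map_mul, map_mul, map_mul, div_add_div _ _ h0 h0']
  zero_mem' := ⟨0, 1, q.one_notMem, by simp, by simp⟩
  neg_mem' := by
    rintro _ ⟨a, h, hq, h0, rfl⟩
    exact ⟨-a, h, hq, h0, by rw [map_neg, neg_div]⟩

section locRing

variable {B L : Type*} [CommRing B] [Field L] [Algebra B L] {q : Ideal B} [q.IsPrime]

lemma algebraMap_mem_locRing (b : B) : algebraMap B L b ∈ locRing L q :=
  ⟨b, 1, q.one_notMem, by simp, by simp⟩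

lemma locRing_mono {p : Ideal B} [p.IsPrime] (h : p ≤ q) : locRing L q ≤ locRing L p := by
  rintro _ ⟨a, b, hb, h0, rfl⟩
  exact ⟨a, b, fun h' => hb (h h'), h0, rfl⟩

/-- The ring `locRing L p` consists of fractions of elements of a smaller ring `R'`, containing
the image of `B`. -/
lemma exists_frac_of_mem_locRing {R : Subring L} (hR : (algebraMap B L).range ≤ R) {c : L}
    (hc : c ∈ locRing L q) : ∃ x ∈ R, ∃ y ∈ R, y⁻¹ ∈ locRing L q ∧ c = x / y := by
  obtain ⟨a, h, hq, h0, rfl⟩ := hc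
  exact ⟨_, hR (RingHom.mem_range_self _ a), _, hR (RingHom.mem_range_self _ h),
    ⟨1, h, hq, h0, by simp⟩, rfl⟩

lemma range_le_locRing : (algebraMap B L).range ≤ locRing L q := by
  rintro _ ⟨b, rfl⟩
  exact algebraMap_mem_locRing b

lemma range_eq_locRing [FaithfulSMul B L] (R : Type*) [CommRing R] [Algebra B R]
    [IsLocalization.AtPrime R q] [Algebra R L] [IsScalarTower B R L] :
    (algebraMap R L).range = locRing L q := by
  have h0 : ∀ h : B, h ∉ q → algebraMap B L h ≠ 0 := fun h hq h' => by
    rw [FaithfulSMul.algebraMap_eq_zero_iff] at h'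
    exact hq (h' ▸ q.zero_mem)
  ext c
  constructor
  · rintro ⟨r, rfl⟩
    obtain ⟨a, h, rfl⟩ := IsLocalization.exists_mk'_eq q.primeCompl r
    refine ⟨a, h, h.2, h0 _ h.2, ?_⟩
    rw [eq_div_iff (h0 _ h.2), IsScalarTower.algebraMap_apply B R L h, ← map_mul,
      IsLocalization.mk'_spec, ← IsScalarTower.algebraMap_apply]
  · rintro ⟨a, h, hq, hh, rfl⟩
    let y : q.primeCompl := ⟨h, hq⟩
    refine ⟨IsLocalization.mk' R a y, ?_⟩
    rw [eq_div_iff hh, IsScalarTower.algebraMap_apply B R L h, ← map_mul,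
      IsLocalization.mk'_spec R a y, ← IsScalarTower.algebraMap_apply]

/-- Clearing denominators turns regularity of a fraction into the divisibility condition used by
`exists_prime_ringKrullDim_eq_one`. -/
lemma div_mem_locRing_iff [FaithfulSMul B L] {a b : B} (hb : b ≠ 0) :
    algebraMap B L a / algebraMap B L b ∈ locRing L q ↔ ∃ h, h ∉ q ∧ b ∣ h * a := by
  have hb' : algebraMap B L b ≠ 0 := by rwa [Ne, FaithfulSMul.algebraMap_eq_zero_iff]
  constructor
  · rintro ⟨c, h, hq, h0, e⟩
    refine ⟨h, hq, c, FaithfulSMul.algebraMap_injective B L ?_⟩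
    rw [div_eq_div_iff hb' h0] at e
    rw [map_mul, map_mul]
    linear_combination e
  · rintro ⟨h, hq, c, e⟩
    have h0 : algebraMap B L h ≠ 0 := fun h' => by
      rw [FaithfulSMul.algebraMap_eq_zero_iff] at h'
      exact hq (h' ▸ q.zero_mem)
    refine ⟨c, h, hq, h0, ?_⟩
    rw [div_eq_div_iff hb' h0, ← map_mul, ← map_mul, mul_comm a, e, mul_comm]

end locRing

lemma exists_algebra_localization {k B L : Type u} [Field k] [CommRing B] [Field L] [Algebra k B]
    [Algebra k L] [Algebra B L] [IsScalarTower k B L] [FaithfulSMul B L] (q : Ideal B) [q.IsPrime] :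
    ∃ _ : Algebra (Localization.AtPrime q) L, IsScalarTower B (Localization.AtPrime q) L ∧
      IsScalarTower k (Localization.AtPrime q) L ∧ FaithfulSMul (Localization.AtPrime q) L := by
  have hu : ∀ y : q.primeCompl, IsUnit (algebraMap B L y) := fun y => by
    refine IsUnit.mk0 _ fun h => y.2 ?_
    rw [FaithfulSMul.algebraMap_eq_zero_iff] at h
    rw [h]
    exact q.zero_mem
  let := (IsLocalization.lift (S := Localization.AtPrime q) hu).toAlgebra
  have h1 : IsScalarTower B (Localization.AtPrime q) L := .of_algebraMap_eq fun b =>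
    (IsLocalization.lift_eq hu b).symm
  refine ⟨inferInstance, h1, .of_algebraMap_eq fun c => ?_, ?_⟩
  · rw [IsScalarTower.algebraMap_apply k B (Localization.AtPrime q),
      ← IsScalarTower.algebraMap_apply B, ← IsScalarTower.algebraMap_apply]
  · rw [faithfulSMul_iff_algebraMap_injective]
    refine (IsLocalization.lift_injective_iff hu).2 fun x y => ?_
    have : IsDomain B := (FaithfulSMul.algebraMap_injective B L).isDomain _
    rw [(FaithfulSMul.algebraMap_injective B L).eq_iff,
      (IsLocalization.injective (Localization.AtPrime q) q.primeCompl_le_nonZeroDivisors).eq_iff]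

/-! ### Coordinates at regular points and purity for differential forms. -/

section chart

variable {k B L : Type u} [Field k] [CharZero k] [CommRing B] [Field L] [Algebra k B]
    [Algebra k L] [Algebra B L] [IsScalarTower k B L] [FaithfulSMul B L] [Algebra.FiniteType k B]
    [Algebra.IsAlgebraic B L]

/-- Around a regular point, the differentials of suitable functions form a basis of `Ω_L` in which
the differentials of functions have regular coordinates. -/
theorem exists_basis_of_isRegularLocalRing (q : Ideal B) [q.IsPrime]
    [IsRegularLocalRing (Localization.AtPrime q)] :
    ∃ (n : ℕ) (b : Basis (Fin n) L Ω[L⁄k]), (∀ i, ∃ t ∈ locRing L q, b i = D k L t) ∧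
      ∀ r ∈ locRing L q, ∀ i, b.repr (D k L r) i ∈ locRing L q := by
  obtain ⟨_, h1, h2, h3⟩ := exists_algebra_localization (k := k) (L := L) q
  have : Algebra.EssFiniteType k (Localization.AtPrime q) := .comp _ B _
  have : Algebra.IsAlgebraic (Localization.AtPrime q) L :=
    Algebra.IsAlgebraic.extendScalars (R := B) (by
      have : IsDomain B := (FaithfulSMul.algebraMap_injective B L).isDomain _
      exact IsLocalization.injective (Localization.AtPrime q) q.primeCompl_le_nonZeroDivisors)
  obtain ⟨n, t, ht, hli, hsp⟩ :=
    IsRegularLocalRing.exists_coordinates (k := k) (Localization.AtPrime q) L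
  rw [← range_eq_locRing (L := L) (q := q) (Localization.AtPrime q)]
  refine ⟨n, Basis.mk hli hsp.ge, fun i => ⟨_, RingHom.mem_range_self _ (t i), ?_⟩, ?_⟩
  · exact Basis.mk_apply hli hsp.ge i
  · exact Basis.repr_D_mem_range ht _ fun i => Basis.mk_apply hli hsp.ge i

/-- Purity: on a regular domain, forms extend over codimension two. -/
theorem exists_prime_notMem_regularForms [IsDomain B] (q : Ideal B) [q.IsPrime]
    (hreg : ∀ (p : Ideal B) [p.IsPrime], p ≤ q → IsRegularLocalRing (Localization.AtPrime p)) {r : ℕ}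
    {ω : ⋀[L]^r Ω[L⁄k]} {K : Subring L}
    (hK : ∀ c ∈ K, ∃ a b : B, b ≠ 0 ∧ c = algebraMap B L a / algebraMap B L b)
    (hK' : ∀ c ∈ K, c⁻¹ ∈ K) (hBK : (algebraMap B L).range ≤ K)
    (hωK : ω ∈ regularForms k K r) (hω : ω ∉ regularForms k (locRing L q) r) :
    ∃ (p : Ideal B) (_ : p.IsPrime), p ≤ q ∧ ringKrullDim (Localization.AtPrime p) = 1 ∧
      ω ∉ regularForms k (locRing L p) r := by
  have := hreg q le_rfl
  have : IsNoetherianRing B := Algebra.FiniteType.isNoetherianRing k B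
  obtain ⟨n, b, hb, hDb⟩ := exists_basis_of_isRegularLocalRing (k := k) (L := L) q
  have hqK : locRing L q ≤ K := by
    rintro _ ⟨x, y, -, -, rfl⟩
    rw [div_eq_mul_inv]
    exact K.mul_mem (hBK (RingHom.mem_range_self _ x)) (hK' _ (hBK (RingHom.mem_range_self _ y)))
  have hDK : ∀ c ∈ K, ∀ i, b.repr (D k L c) i ∈ K :=
    regularForms.repr_D_mem_of_frac hqK (fun c hc => by
      obtain ⟨x, y, -, rfl⟩ := hK c hc
      exact ⟨_, algebraMap_mem_locRing x, _, algebraMap_mem_locRing y,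
        hK' _ (hBK (RingHom.mem_range_self _ y)), rfl⟩) b hDb
  -- Some coefficient of ω fails to be regular at q; it is a fraction, so it already fails at a
  -- height-one prime p ≤ q. The basis chosen at q still computes regularity at p, because
  -- coordinates of differentials extend to the localization.
  obtain ⟨s, hs⟩ : ∃ s, (b.exteriorPower r).repr ω s ∉ locRing L q := by
    by_contra! hcon
    exact hω (regularForms.mem_of_repr_mem b hb hcon)
  obtain ⟨x, y, hy, hxy⟩ := hK _ (regularForms.repr_mem b hDK hωK s)
  rw [hxy, div_mem_locRing_iff hy] at hs
  obtain ⟨p, hp, hpq, hdim, hxp⟩ := exists_prime_ringKrullDim_eq_one q hreg hy hs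
  refine ⟨p, hp, hpq, hdim, fun hωp => hxp ?_⟩
  rw [← div_mem_locRing_iff (L := L) hy, ← hxy]
  exact regularForms.repr_mem b (regularForms.repr_D_mem_of_frac (locRing_mono hpq)
    (fun c hc => exists_frac_of_mem_locRing range_le_locRing hc) b hDb) hωp s

end chart

end

noncomputable section

/-! ### Prime ideals in finite group quotients -/

open KaehlerDifferential Module Pointwise

lemma IsRegularLocalRing.isDiscreteValuationRing {R : Type u} [CommRing R] [IsRegularLocalRing R]
    (h : ringKrullDim R = 1) : IsDiscreteValuationRing R := by
  rw [← IsLocalRing.finrank_CotangentSpace_eq_one_iff]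
  have h1 := (IsRegularLocalRing.iff_finrank_cotangentSpace R).1 ‹_›
  rw [h] at h1
  exact_mod_cast h1

/-- Lie over the smaller prime, go up to a prime over the contraction of Q, and move the result to Q
with an element of G, which acts transitively on fibres. No normality of A is needed. -/
lemma Algebra.IsInvariant.hasGoingDown (A B G : Type*) [CommRing A] [CommRing B] [Algebra A B]
    [FaithfulSMul A B] [Group G] [Finite G] [MulSemiringAction G B] [SMulCommClass G A B]
    [Algebra.IsInvariant A B G] : Algebra.HasGoingDown A B where
  exists_ideal_le_liesOver_of_lt {p} _ Q _ hlt := by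
    have := Algebra.IsInvariant.isIntegral A B G
    obtain ⟨P', -, hP', hP'p⟩ := Ideal.exists_ideal_over_prime_of_isIntegral p (⊥ : Ideal B)
      (by simp [← RingHom.ker_eq_comap_bot])
    obtain ⟨Q', hPQ', hQ', hQ'Q⟩ := Ideal.exists_ideal_over_prime_of_isIntegral_of_isPrime
      (Q.under A) P' (hP'p.trans_le hlt.le)
    obtain ⟨g, rfl⟩ := Algebra.IsInvariant.exists_smul_of_under_eq A B G Q' Q hQ'Q
    refine ⟨_, Ideal.pointwise_smul_le_pointwise_smul_iff.2 hPQ', hP'.smul g, ⟨?_⟩⟩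
    rw [Ideal.under_smul]
    exact hP'p.symm

/-- By incomparability in an integral extension, strict chains of primes contract to strict chains.
-/
lemma Ideal.height_le_of_liesOver_of_isIntegral {A B : Type*} [CommRing A] [CommRing B]
    [Algebra A B] [Algebra.IsIntegral A B] (p : Ideal A) [p.IsPrime] (q : Ideal B) [q.IsPrime]
    [q.LiesOver p] : q.height ≤ p.height := by
  obtain rfl := q.over_def p
  rw [PrimeSpectrum.height_eq_orderHeight ⟨q, ‹_›⟩,
    PrimeSpectrum.height_eq_orderHeight ⟨q.under A, ‹_›⟩]
  refine Order.height_le_height_apply_of_strictMono (PrimeSpectrum.comap (algebraMap A B))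
    (fun x y hxy => ?_) ⟨q, ‹_›⟩
  obtain ⟨z, hz, hz'⟩ := SetLike.exists_of_lt (show x.asIdeal < y.asIdeal from hxy)
  exact Ideal.comap_lt_comap_of_integral_mem_sdiff (show x.asIdeal ≤ y.asIdeal from hxy.le)
    ⟨hz, hz'⟩ (Algebra.IsIntegral.isIntegral z)

lemma Ideal.height_le_of_liesOver_of_hasGoingDown {A B : Type*} [CommRing A] [CommRing B]
    [Algebra A B] [IsNoetherianRing A] [IsNoetherianRing B] [Algebra.HasGoingDown A B] (p : Ideal A) [p.IsPrime]
    (q : Ideal B) [q.IsPrime] [q.LiesOver p] : p.height ≤ q.height := by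
  rw [Ideal.height_eq_height_add_of_liesOver_of_hasGoingDown p q]
  exact le_self_add

/-- Noether's finiteness theorem: B is integral and of finite type over A, hence finite, and the
Artin–Tate lemma applies. -/
lemma Algebra.IsInvariant.finiteType (k A B G : Type*) [CommRing k] [IsNoetherianRing k]
    [CommRing A] [CommRing B] [Algebra k A] [Algebra k B] [Algebra A B] [IsScalarTower k A B]
    [FaithfulSMul A B] [Group G] [Finite G] [MulSemiringAction G B]
    [Algebra.IsInvariant A B G] [Algebra.FiniteType k B] : Algebra.FiniteType k A := by
  have := Algebra.IsInvariant.isIntegral A B G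
  have : Algebra.FiniteType A B := .of_restrictScalars_finiteType k A B
  have : Module.Finite A B := Algebra.IsIntegral.finite
  exact ⟨fg_of_fg_of_fg k A B Algebra.FiniteType.out Module.Finite.fg_top
    (FaithfulSMul.algebraMap_injective A B)⟩

lemma locRing_le_of_liesOver {A B L : Type*} [CommRing A] [CommRing B] [Field L] [Algebra A B]
    [Algebra A L] [Algebra B L] [IsScalarTower A B L] (p : Ideal A) [p.IsPrime] (q : Ideal B)
    [q.IsPrime] [q.LiesOver p] : locRing L p ≤ locRing L q := by
  rintro _ ⟨a, h, hp, h0, rfl⟩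
  rw [IsScalarTower.algebraMap_apply A B L, IsScalarTower.algebraMap_apply A B L] at *
  refine ⟨_, _, fun hq => hp ?_, h0, rfl⟩
  rw [q.over_def p]
  exact hq

section fractions

variable {B L : Type*} [CommRing B] [Field L] [Algebra B L] [IsDomain B]

/-- The ring `locRing L ⊥` serves as the fraction field of B inside L. Together with
`inv_mem_locRing_bot` this verifies what purity and `regularForms.descend` ask of K. -/
lemma exists_div_of_mem_locRing_bot {c : L} (hc : c ∈ locRing L (⊥ : Ideal B)) :
    ∃ a b : B, b ≠ 0 ∧ c = algebraMap B L a / algebraMap B L b := by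
  obtain ⟨a, h, hq, h0, rfl⟩ := hc
  exact ⟨a, h, hq, rfl⟩

lemma inv_mem_locRing_bot {c : L} (hc : c ∈ locRing L (⊥ : Ideal B)) :
    c⁻¹ ∈ locRing L (⊥ : Ideal B) := by
  obtain ⟨a, h, hq, h0, rfl⟩ := hc
  by_cases ha : algebraMap B L a = 0
  · rw [ha, zero_div, inv_zero]
    exact zero_mem _
  · refine ⟨h, a, fun ha' => ha ?_, ha, inv_div _ _⟩
    rw [Ideal.mem_bot.1 ha', map_zero]

end fractions

/-! ### Regularity of forms upstairs and on the quotient, for rings. -/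

section goingDown

variable {k A B L : Type u} [Field k] [CharZero k] [CommRing A] [CommRing B] [Field L]
  [Algebra k B] [Algebra k L] [Algebra A B] [Algebra A L] [Algebra B L] [IsScalarTower k B L]
  [IsScalarTower A B L] [IsFractionRing B L] [IsDomain B] [Algebra.FiniteType k B]
  {r : ℕ} {ω : ⋀[L]^r Ω[L⁄k]}

/-- A form on the regular part of the quotient gives a form upstairs. -/
theorem mem_regularForms_locRing_of_quotient [IsNoetherianRing A] [Algebra.HasGoingDown A B]
    (hB : ∀ (q : Ideal B) [q.IsPrime], IsRegularLocalRing (Localization.AtPrime q))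
    (U : Set (PrimeSpectrum A))
    (hU : ∀ x, x ∉ U → 2 ≤ ringKrullDim (Localization.AtPrime x.asIdeal))
    (hω : ∀ x ∈ U, ω ∈ regularForms k (locRing L x.asIdeal) r) (q : Ideal B) [q.IsPrime] :
    ω ∈ regularForms k (locRing L q) r := by
  have : IsNoetherianRing B := Algebra.FiniteType.isNoetherianRing k B
  have : Algebra.IsAlgebraic B L := IsLocalization.isAlgebraic L (nonZeroDivisors B)
  -- Going down bounds the height of the contraction by that of p, so the contraction lies in U.
  -- Purity reduces all other primes to these, with ⊥ giving the coefficients in the fraction field.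
  have key : ∀ (p : Ideal B) [p.IsPrime], ringKrullDim (Localization.AtPrime p) ≤ 1 →
      ω ∈ regularForms k (locRing L p) r := by
    intro p _ hp
    have hmem : (⟨p.under A, inferInstance⟩ : PrimeSpectrum A) ∈ U := by
      by_contra hcon
      have h1 := hU _ hcon
      have h2 := Ideal.height_le_of_liesOver_of_hasGoingDown (p.under A) p
      rw [IsLocalization.AtPrime.ringKrullDim_eq_height p] at hp
      rw [IsLocalization.AtPrime.ringKrullDim_eq_height (p.under A)] at h1
      have h3 : (2 : ℕ∞) ≤ 1 := WithBot.coe_le_coe.1 (h1.trans ((WithBot.coe_le_coe.2 h2).trans hp))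
      exact absurd h3 (by norm_num)
    have hle : locRing L (p.under A) ≤ locRing L p := locRing_le_of_liesOver (p.under A) p
    have h0 : ω ∈ regularForms k (locRing L (p.under A)) r := hω ⟨p.under A, inferInstance⟩ hmem
    exact regularForms.mono hle h0
  by_contra hcon
  obtain ⟨p, hp, -, hdim, hωp⟩ := exists_prime_notMem_regularForms q (fun p _ _ => hB p)
    (K := locRing L (⊥ : Ideal B)) (fun c hc => exists_div_of_mem_locRing_bot hc)
    (fun c hc => inv_mem_locRing_bot hc) range_le_locRing (key ⊥ (by
      rw [IsLocalization.AtPrime.ringKrullDim_eq_height (⊥ : Ideal B)]; simp)) hcon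
  exact hωp (key p hdim.le)

end goingDown

section quotient

variable {k A B L : Type u} {G : Type*} [Field k] [CharZero k] [CommRing A] [CommRing B] [Field L]
  [Algebra k A] [Algebra k B] [Algebra k L] [Algebra A B] [Algebra A L] [Algebra B L]
  [IsScalarTower k A B] [IsScalarTower k A L] [IsScalarTower k B L] [IsScalarTower A B L]
  [FaithfulSMul A B] [IsFractionRing B L] [IsDomain B] [IsDomain A] [Algebra.FiniteType k B]
  [Group G] [Finite G] [MulSemiringAction G B] [SMulCommClass G A B] [Algebra.IsInvariant A B G]
  {r : ℕ} {ω : ⋀[L]^r Ω[L⁄k]}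

variable (G) in
-- Since B is algebraic over A, a fraction can be rewritten with denominator in A. An invariant
-- fraction then has an invariant numerator, which comes from A.
lemma mem_locRing_bot_of_invariant (σ : G → L →+* L)
    (hσ : ∀ g b, σ g (algebraMap B L b) = algebraMap B L (g • b)) {c : L}
    (hc : ∀ g, σ g c = c) : c ∈ locRing L (⊥ : Ideal A) := by
  have := Algebra.IsInvariant.isIntegral A B G
  obtain ⟨x, y, hy, rfl⟩ := IsFractionRing.div_surjective B c
  have hy0 := nonZeroDivisors.ne_zero hy
  have hy' : algebraMap B L y ≠ 0 := by
    rwa [Ne, FaithfulSMul.algebraMap_eq_zero_iff]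
  obtain ⟨b, a, ha, hb⟩ := (Algebra.IsAlgebraic.isAlgebraic (R := A) y).exists_smul_eq_mul x hy
  rw [mul_comm, Algebra.smul_def, mul_comm] at hb
  have ha' : algebraMap A L a ≠ 0 := by
    rw [IsScalarTower.algebraMap_apply A B L, Ne, FaithfulSMul.algebraMap_eq_zero_iff,
      FaithfulSMul.algebraMap_eq_zero_iff]
    exact ha
  have hxy : algebraMap B L x / algebraMap B L y = algebraMap B L b / algebraMap A L a := by
    rw [div_eq_div_iff hy' ha', IsScalarTower.algebraMap_apply A B L, ← map_mul, hb, map_mul]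
  rw [hxy] at hc ⊢
  obtain ⟨d, rfl⟩ := Algebra.IsInvariant.isInvariant (A := A) (G := G) b fun g => by
    have h1 := hc g
    rw [map_div₀, IsScalarTower.algebraMap_apply A B L, hσ, hσ, smul_algebraMap,
      ← IsScalarTower.algebraMap_apply A B L, div_left_inj' ha'] at h1
    exact FaithfulSMul.algebraMap_injective B L h1
  exact ⟨d, a, ha, ha', by rw [← IsScalarTower.algebraMap_apply]⟩

set_option maxHeartbeats 1000000 in
/-- An invariant form upstairs gives a form on the regular part of the quotient. -/
theorem mem_regularForms_locRing_of_invariant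
    (hB : ∀ (q : Ideal B) [q.IsPrime], IsRegularLocalRing (Localization.AtPrime q))
    (σ : G → L →+* L) (hσ : ∀ g b, σ g (algebraMap B L b) = algebraMap B L (g • b))
    (ψ : G → (⋀[L]^r Ω[L⁄k]) →+ ⋀[L]^r Ω[L⁄k])
    (hψ : ∀ g c (x : Fin r → L), ψ g (c • exteriorPower.ιMulti L r fun i => D k L (x i)) =
      σ g c • exteriorPower.ιMulti L r fun i => D k L (σ g (x i)))
    (hψω : ∀ g, ψ g ω = ω)
    (hω : ∀ (q : Ideal B) [q.IsPrime], ω ∈ regularForms k (locRing L q) r) (p : Ideal A) [p.IsPrime]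
    (hp : ∀ (p' : Ideal A) [p'.IsPrime], p' ≤ p → IsRegularLocalRing (Localization.AtPrime p')) :
    ω ∈ regularForms k (locRing L p) r := by
  have : IsNoetherianRing B := Algebra.FiniteType.isNoetherianRing k B
  have := Algebra.IsInvariant.hasGoingDown A B G
  have := Algebra.IsInvariant.isIntegral A B G
  have := Algebra.IsInvariant.finiteType k A B G
  have : IsNoetherianRing A := Algebra.FiniteType.isNoetherianRing k A
  have : FaithfulSMul A L := .trans A B L
  have : Algebra.IsAlgebraic B L := IsLocalization.isAlgebraic L (nonZeroDivisors B)
  have : Algebra.IsAlgebraic A L := .trans A B L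
  have := hp p le_rfl
  obtain ⟨n, b, hb, hDb⟩ := exists_basis_of_isRegularLocalRing (k := k) (L := L) p
  -- The basis consists of differentials of fractions of elements of A, which G fixes. Invariance of
  -- ω and uniqueness of coordinates make the coefficients invariant.
  have hωK : ω ∈ regularForms k (locRing L (⊥ : Ideal A)) r := by
    refine regularForms.mem_of_repr_mem b (fun i => ?_) fun s =>
      mem_locRing_bot_of_invariant G (A := A) σ hσ fun g => ?_
    · obtain ⟨t, ht, h⟩ := hb i
      exact ⟨t, locRing_mono bot_le ht, h⟩
    · choose t ht hbt using hb
      have hσt : ∀ i, σ g (t i) = t i := fun i => by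
        obtain ⟨x, y, -, -, e⟩ := ht i
        rw [e, map_div₀, IsScalarTower.algebraMap_apply A B L, IsScalarTower.algebraMap_apply A B L,
          hσ, hσ, smul_algebraMap, smul_algebraMap]
      have h1 : ψ g ω = ∑ s, σ g ((b.exteriorPower r).repr ω s) • b.exteriorPower r s := by
        conv_lhs => rw [← (b.exteriorPower r).sum_repr ω]
        rw [map_sum]
        refine Finset.sum_congr rfl fun s _ => ?_
        rw [exteriorPower.basis_apply, exteriorPower.ιMulti_family]
        have h2 := hψ g ((b.exteriorPower r).repr ω s)
          fun i => t (Set.powersetCard.ofFinEmbEquiv.symm s i)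
        simp only [hσt, ← hbt] at h2
        exact h2
      rw [hψω g] at h1
      have h3 := congrArg (fun v => (b.exteriorPower r).repr v s) h1
      simp only [map_sum, map_smul, Basis.repr_self, Finsupp.coe_finsetSum, Finset.sum_apply,
        Finsupp.smul_apply, Finsupp.single_apply, smul_eq_mul, mul_ite, mul_one, mul_zero,
        Finset.sum_ite_eq', Finset.mem_univ, if_true] at h3
      exact h3.symm
  by_contra hcon
  obtain ⟨P, hP, hPp, hdim, hωP⟩ := exists_prime_notMem_regularForms p hp
    (K := locRing L (⊥ : Ideal A)) (fun c hc => exists_div_of_mem_locRing_bot hc)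
    (fun c hc => inv_mem_locRing_bot hc) range_le_locRing hωK hcon
  refine hωP ?_
  obtain ⟨Q, -, hQ, hQP⟩ := Ideal.exists_ideal_over_prime_of_isIntegral P (⊥ : Ideal B)
      (by simp [← RingHom.ker_eq_comap_bot])
  have : Q.LiesOver P := ⟨hQP.symm⟩
  -- Incomparability gives one inequality of heights and going down the other, so both local rings
  -- are discrete valuation rings.
  have hdimQ : ringKrullDim (Localization.AtPrime Q) = 1 := by
    rw [IsLocalization.AtPrime.ringKrullDim_eq_height Q,
      le_antisymm (Ideal.height_le_of_liesOver_of_isIntegral P Q)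
        (Ideal.height_le_of_liesOver_of_hasGoingDown P Q),
      ← IsLocalization.AtPrime.ringKrullDim_eq_height P (Localization.AtPrime P), hdim]
  have := hB Q
  have := hp P hPp
  have := IsRegularLocalRing.isDiscreteValuationRing hdim
  have := IsRegularLocalRing.isDiscreteValuationRing hdimQ
  obtain ⟨_, h1, h2, h3⟩ := exists_algebra_localization (k := k) (L := L) P
  obtain ⟨_, h4, h5, h6⟩ := exists_algebra_localization (k := k) (L := L) Q
  let := Localization.AtPrime.algebraOfLiesOver P Q
  have : IsScalarTower A (Localization.AtPrime P) (Localization.AtPrime Q) := inferInstance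
  have h7 : IsScalarTower (Localization.AtPrime P) (Localization.AtPrime Q) L := by
    refine .of_algebraMap_eq' (IsLocalization.ringHom_ext P.primeCompl ?_)
    rw [← IsScalarTower.algebraMap_eq, RingHom.comp_assoc,
      ← IsScalarTower.algebraMap_eq A (Localization.AtPrime P) (Localization.AtPrime Q),
      IsScalarTower.algebraMap_eq A B (Localization.AtPrime Q), ← RingHom.comp_assoc,
      ← IsScalarTower.algebraMap_eq, ← IsScalarTower.algebraMap_eq]
  have : Algebra.IsAlgebraic (Localization.AtPrime P) L := .extendScalars (R := A)
    (IsLocalization.injective (Localization.AtPrime P) P.primeCompl_le_nonZeroDivisors)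
  have : Algebra.IsAlgebraic (Localization.AtPrime Q) L := .extendScalars (R := B)
    (IsLocalization.injective (Localization.AtPrime Q) Q.primeCompl_le_nonZeroDivisors)
  have : Algebra.EssFiniteType k (Localization.AtPrime P) := .comp _ A _
  have : Algebra.EssFiniteType k (Localization.AtPrime Q) := .comp _ B _
  have : IsScalarTower k (Localization.AtPrime P) (Localization.AtPrime Q) := inferInstance
  have : IsLocalHom (algebraMap (Localization.AtPrime P) (Localization.AtPrime Q)) :=
    Localization.isLocalHom_localRingHom P Q (algebraMap A B) Ideal.LiesOver.over
  have : Algebra.IsAlgebraic (IsLocalRing.ResidueField (Localization.AtPrime P))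
      (IsLocalRing.ResidueField (Localization.AtPrime Q)) :=
    inferInstanceAs (Algebra.IsAlgebraic P.ResidueField Q.ResidueField)
  have hωQ := hω Q
  rw [← range_eq_locRing (L := L) (Localization.AtPrime Q)] at hωQ
  rw [← range_eq_locRing (L := L) (Localization.AtPrime P)]
  refine regularForms.descend (S := Localization.AtPrime Q) (locRing L (⊥ : Ideal A)) ?_
    (fun c hc => ?_) (fun c hc => inv_mem_locRing_bot hc) hωQ hωK
  · rw [range_eq_locRing (L := L) (q := P)]
    exact locRing_mono bot_le
  · obtain ⟨x, y, hy, rfl⟩ := exists_div_of_mem_locRing_bot hc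
    refine ⟨algebraMap _ _ x, algebraMap _ _ y, ?_, ?_⟩
    · rw [Ne, map_eq_zero_iff _ (IsLocalization.injective (Localization.AtPrime P)
        P.primeCompl_le_nonZeroDivisors)]
      exact hy
    · rw [← IsScalarTower.algebraMap_apply, ← IsScalarTower.algebraMap_apply]

end quotient

end

noncomputable section

/-! ### Sections of the sheaves of differential forms -/

/-- The exact differentials span Ω_A and scalars can be absorbed into r, so the forms r dx₁ ∧ ⋯ ∧
dx_p already generate additively. Statements about additive maps can thus be checked on them. -/
lemma regularForms_top (k A : Type*) [CommRing k] [CommRing A] [Algebra k A] (p : ℕ) :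
    regularForms k (⊤ : Subring A) p = ⊤ := by
  rw [eq_top_iff]
  rintro ω -
  have h := exteriorPower.ιMulti_span_of_span A p _
    (KaehlerDifferential.span_range_derivation k A)
  have hω : ω ∈ Submodule.span A ((exteriorPower.ιMulti A p) '' {x : Fin p → Ω[A⁄k] |
      Set.range x ⊆ Set.range (KaehlerDifferential.D k A)}) := by
    rw [h]; trivial
  induction hω using Submodule.span_induction with
  | mem v hv =>
    obtain ⟨x, hx, rfl⟩ := hv
    choose y hy using fun i => hx ⟨i, rfl⟩
    refine AddSubgroup.subset_closure ⟨1, trivial, y, fun _ => trivial, ?_⟩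
    rw [one_smul]
    congr 1
    exact (funext hy).symm
  | zero => exact zero_mem _
  | add v w _ _ hv hw => exact add_mem hv hw
  | smul c v hvs hv =>
    clear hvs
    induction hv using AddSubgroup.closure_induction with
    | mem v hv =>
      obtain ⟨r, -, x, -, rfl⟩ := hv
      rw [smul_smul]
      exact AddSubgroup.subset_closure ⟨c * r, trivial, x, fun _ => trivial, rfl⟩
    | zero => rw [smul_zero]; exact zero_mem _
    | add v w _ _ hv hw => rw [smul_add]; exact add_mem hv hw
    | neg v _ hv => rw [smul_neg]; exact neg_mem hv

/-- Additive maps on `⋀^p Ω_A` agree if they agree on the forms `r dx₁ ∧ ⋯ ∧ dx_p`. -/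
lemma exteriorPower_addHom_ext {k A M : Type*} [CommRing k] [CommRing A] [Algebra k A]
    [AddGroup M] {p : ℕ} {f g : (⋀[A]^p Ω[A⁄k]) →+ M}
    (h : ∀ (r : A) (x : Fin p → A),
      f (r • exteriorPower.ιMulti A p fun i => KaehlerDifferential.D k A (x i)) =
        g (r • exteriorPower.ιMulti A p fun i => KaehlerDifferential.D k A (x i))) : f = g := by
  refine AddMonoidHom.eq_of_eqOn_topM ?_
  intro ω _
  have hω : ω ∈ regularForms k (⊤ : Subring A) p := by rw [regularForms_top]; trivial
  induction hω using AddSubgroup.closure_induction with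
  | mem v hv => obtain ⟨r, -, x, -, rfl⟩ := hv; exact h r x
  | zero => rw [map_zero, map_zero]
  | add v w _ _ hv hw => rw [map_add, map_add, hv trivial, hw trivial]
  | neg v _ hv => rw [map_neg, map_neg, hv trivial]

namespace DiffForms

variable {k : CommRingCat.{u}}

/-- The sections of the structure sheaf of a scheme over `Spec k` form a `k`-algebra. -/
@[reducible]
def algebraSections (X : Over (Spec k)) (N : X.left.Opens) : Algebra k Γ(X.left, N) :=
  ((baseToSections X).app (op N)).hom.toAlgebra

attribute [local instance] algebraSections

/-- `⋀^p Ω_{Γ(X, N)/k}`. -/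
abbrev NaiveForms (X : Over (Spec k)) (N : X.left.Opens) (p : ℕ) : Type u :=
  ⋀[Γ(X.left, N)]^p Ω[Γ(X.left, N)⁄k]

/-- The form `r dx₁ ∧ ⋯ ∧ dx_p`. -/
abbrev mkForm {X : Over (Spec k)} {N : X.left.Opens} {p : ℕ} (r : Γ(X.left, N))
    (x : Fin p → Γ(X.left, N)) : NaiveForms X N p :=
  r • exteriorPower.ιMulti Γ(X.left, N) p fun i => KaehlerDifferential.D k Γ(X.left, N) (x i)

/-- The restriction maps of `N ↦ ⋀^p Ω_{Γ(X, N)/k}`. -/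
def naiveRes {X : Over (Spec k)} {p : ℕ} {N N' : X.left.Opens} (i : N' ⟶ N) :
    NaiveForms X N p →+ NaiveForms X N' p :=
  AddMonoidHom.mk' (fun m => ((preForms X p).map i.op).hom m)
    fun a b => map_add ((preForms X p).map i.op).hom a b

/-- The pullback of naive forms. -/
def naivePullback {X Y : Over (Spec k)} (h : X ⟶ Y) (p : ℕ) (N : Y.left.Opens) :
    NaiveForms Y N p →+ NaiveForms X (h.left ⁻¹ᵁ N) p :=
  AddMonoidHom.mk' (fun m => ((preForms.pullback h p).app (op N)).hom m)
    fun a b => map_add ((preForms.pullback h p).app (op N)).hom a b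

lemma naiveRes_mkForm {X : Over (Spec k)} {p : ℕ} {N N' : X.left.Opens} (i : N' ⟶ N)
    (r : Γ(X.left, N)) (x : Fin p → Γ(X.left, N)) :
    naiveRes i (mkForm r x) =
      mkForm (X.left.presheaf.map i.op r) fun l => X.left.presheaf.map i.op (x l) := by
  refine (((preForms X p).map i.op).hom.map_smul r _).trans ?_
  refine congrArg (fun v : NaiveForms X N' p => X.left.presheaf.map i.op r • v)
    ((exteriorPowerMap_mk _ _ p _).trans ?_)
  refine congrArg (exteriorPower.ιMulti Γ(X.left, N') p) (funext fun l => ?_)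
  exact CommRingCat.KaehlerDifferential.map_d _ _

lemma naivePullback_mkForm {X Y : Over (Spec k)} (h : X ⟶ Y) {p : ℕ} {N : Y.left.Opens}
    (r : Γ(Y.left, N)) (x : Fin p → Γ(Y.left, N)) :
    naivePullback h p N (mkForm r x) = mkForm (h.left.app N r) fun l => h.left.app N (x l) := by
  refine (((preForms.pullback h p).app (op N)).hom.map_smul r _).trans ?_
  refine congrArg (fun v : NaiveForms X (h.left ⁻¹ᵁ N) p => h.left.app N r • v)
    ((exteriorPowerMap_mk _ _ p _).trans ?_)
  refine congrArg (exteriorPower.ιMulti Γ(X.left, h.left ⁻¹ᵁ N) p) (funext fun l => ?_)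
  exact CommRingCat.KaehlerDifferential.map_d _ _

/-- On underlying abelian presheaves the unit is the usual sheafification map, hence locally
surjective and locally injective. -/
lemma toPresheaf_map_toForms (X : Over (Spec k)) (p : ℕ) :
    (PresheafOfModules.toPresheaf _).map (toForms X p) =
      CategoryTheory.toSheafify (Opens.grothendieckTopology X.left) (preForms X p).presheaf := by
  have := PresheafOfModules.toPresheaf_map_sheafificationHomEquiv_def
    (𝟙 X.left.ringCatSheaf.obj) (𝟙 (forms X p))
  refine Eq.trans ?_ (this.trans ?_)
  · rfl
  · exact Category.comp_id _

/-- The section of the sheaf of forms given by a naive form. -/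
def sec {X : Over (Spec k)} {p : ℕ} {N : X.left.Opens} : NaiveForms X N p →+ Γ(forms X p, N) :=
  AddMonoidHom.mk' (fun m => ((toForms X p).app (op N)).hom m)
    fun a b => map_add ((toForms X p).app (op N)).hom a b

lemma exists_sec_eq {X : Over (Spec k)} {p : ℕ} {N : X.left.Opens} (s : Γ(forms X p, N)) (x : X.left)
    (hx : x ∈ N) : ∃ (N' : X.left.Opens) (i : N' ⟶ N) (m : NaiveForms X N' p),
      x ∈ N' ∧ sec m = (forms X p).presheaf.map i.op s := by
  have h : Presheaf.IsLocallySurjective (Opens.grothendieckTopology X.left)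
      ((PresheafOfModules.toPresheaf _).map (toForms X p)) := by
    rw [toPresheaf_map_toForms]
    exact ((Opens.grothendieckTopology X.left).W_toSheafify
      (preForms X p).presheaf).isLocallySurjective
  obtain ⟨N', i, ⟨m, hm⟩, hxN⟩ := h.imageSieve_mem (U := N) s x hx
  exact ⟨N', i, m, hxN, hm⟩

lemma exists_naiveRes_eq {X : Over (Spec k)} {p : ℕ} {N : X.left.Opens}
    (m m' : NaiveForms X N p) (h : sec m = sec m') (x : X.left)
    (hx : x ∈ N) : ∃ (N' : X.left.Opens) (i : N' ⟶ N), x ∈ N' ∧ naiveRes i m = naiveRes i m' := by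
  have h' : Presheaf.IsLocallyInjective (Opens.grothendieckTopology X.left)
      ((PresheafOfModules.toPresheaf _).map (toForms X p)) := by
    rw [toPresheaf_map_toForms]
    exact ((Opens.grothendieckTopology X.left).W_toSheafify
      (preForms X p).presheaf).isLocallyInjective
  obtain ⟨N', i, hm, hxN⟩ := h'.equalizerSieve_mem (X := op N) m m' h x hx
  exact ⟨N', i, hxN, hm⟩

lemma map_sec {X : Over (Spec k)} {p : ℕ} {N N' : X.left.Opens} (i : N' ⟶ N)
    (m : NaiveForms X N p) : (forms X p).presheaf.map i.op (sec m) = sec (naiveRes i m) :=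
  (PresheafOfModules.naturality_apply (toForms X p) i.op m).symm

lemma pullback_sec {X Y : Over (Spec k)} (h : X ⟶ Y) (p : ℕ) {N : Y.left.Opens}
    (m : NaiveForms Y N p) :
    (forms.pullback h p).app N (sec m) = sec (N := h.left ⁻¹ᵁ N) (naivePullback h p N m) := by
  have h1 : toForms Y p ≫ (forms.pullback h p).val = preForms.pullback h p ≫
      (PresheafOfModules.pushforward h.left.toRingCatSheafHom.hom).map (toForms X p) := by
    have := ((PresheafOfModules.sheafificationAdjunction
      (𝟙 Y.left.ringCatSheaf.obj)).homEquiv (preForms Y p)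
        ((Scheme.Modules.pushforward h.left).obj (forms X p))).apply_symm_apply
        (preForms.pullback h p ≫
      (PresheafOfModules.pushforward h.left.toRingCatSheafHom.hom).map (toForms X p))
    exact (Adjunction.homEquiv_unit _ _ _ _).symm.trans this
  exact congrArg (fun f => (f.app (op N)).hom m) h1

/-! ### Evaluation of forms at a one-point scheme -/

section eval

variable {T X : Over (Spec k)} {p : ℕ}

/-- The only neighbourhood of the point is the whole space, so local bijectivity of sheafification
is bijectivity. This lets values of forms live in ⋀^p Ω of a ring. -/
lemma sec_top_bijective [Unique T.left] :
    Function.Bijective (sec : NaiveForms T ⊤ p → Γ(forms T p, ⊤)) := by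
  have htop : ∀ {N : T.left.Opens}, default ∈ N → N = ⊤ := fun {N} h => by
    ext y
    simpa [Subsingleton.elim y default] using h
  constructor
  · intro m m' h
    obtain ⟨N', i, hx, h'⟩ := exists_naiveRes_eq m m' h default trivial
    obtain rfl := htop hx
    have hi : i = 𝟙 _ := Subsingleton.elim _ _
    subst hi
    have h1 : naiveRes (𝟙 (⊤ : T.left.Opens)) = AddMonoidHom.id (NaiveForms T ⊤ p) :=
      exteriorPower_addHom_ext fun r x => by
        rw [naiveRes_mkForm]
        simp
    simpa [h1] using h'
  · intro s
    obtain ⟨N', i, m, hx, h⟩ := exists_sec_eq s default trivial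
    obtain rfl := htop hx
    have hi : i = 𝟙 _ := Subsingleton.elim _ _
    subst hi
    exact ⟨m, by simpa using h⟩

/-- Evaluation of naive forms along a morphism from a one-point scheme. -/
def naiveEval (e : T ⟶ X) {N : X.left.Opens} (hN : ⊤ ≤ e.left ⁻¹ᵁ N) :
    NaiveForms X N p →+ NaiveForms T ⊤ p :=
  (naiveRes (homOfLE hN)).comp (naivePullback e p N)

lemma naiveEval_mkForm (e : T ⟶ X) {N : X.left.Opens} (hN : ⊤ ≤ e.left ⁻¹ᵁ N)
    (r : Γ(X.left, N)) (x : Fin p → Γ(X.left, N)) :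
    naiveEval e hN (mkForm r x) =
      mkForm (e.left.appLE N ⊤ hN r) fun l => e.left.appLE N ⊤ hN (x l) := by
  rw [naiveEval, AddMonoidHom.comp_apply, naivePullback_mkForm, naiveRes_mkForm]
  rfl

/-- On a one-point scheme, naive forms are forms. -/
def secEquiv (T : Over (Spec k)) (p : ℕ) [Unique T.left] : NaiveForms T ⊤ p ≃+ Γ(forms T p, ⊤) :=
  AddEquiv.ofBijective (sec (X := T) (p := p) (N := ⊤)) sec_top_bijective

/-- Evaluation of forms along a morphism from a one-point scheme. -/
def eval [Unique T.left] (e : T ⟶ X) {N : X.left.Opens} (hN : ⊤ ≤ e.left ⁻¹ᵁ N) :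
    Γ(forms X p, N) →+ NaiveForms T ⊤ p :=
  (secEquiv T p).symm.toAddMonoidHom.comp
    ((((forms.pullback e p).app N) ≫ (forms T p).presheaf.map (homOfLE hN).op).hom)

variable [Unique T.left] (e : T ⟶ X) {N : X.left.Opens} (hN : ⊤ ≤ e.left ⁻¹ᵁ N)

lemma eval_sec (m : NaiveForms X N p) : eval e hN (sec m) = naiveEval e hN m := by
  rw [eval, AddMonoidHom.comp_apply]
  refine (AddEquiv.symm_apply_eq (secEquiv T p)).2 ?_
  change (forms T p).presheaf.map (homOfLE hN).op ((forms.pullback e p).app N (sec m)) = _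
  rw [pullback_sec]
  exact map_sec _ _

lemma eval_map {N' : X.left.Opens} (hN' : ⊤ ≤ e.left ⁻¹ᵁ N') (i : N' ⟶ N) (s : Γ(forms X p, N)) :
    eval e hN' ((forms X p).presheaf.map i.op s) = eval e hN s := by
  rw [eval, eval, AddMonoidHom.comp_apply, AddMonoidHom.comp_apply]
  congr 1
  change (forms T p).presheaf.map (homOfLE hN').op ((forms.pullback e p).app N'
    ((forms X p).presheaf.map i.op s)) =
      (forms T p).presheaf.map (homOfLE hN).op ((forms.pullback e p).app N s)
  have h1 := NatTrans.naturality_apply (forms.pullback e p).mapPresheaf i.op s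
  refine (congrArg _ h1).trans ?_
  have h2 := (forms T p).presheaf.map_comp ((TopologicalSpace.Opens.map e.left.base).map i).op (homOfLE hN').op
  exact (ConcreteCategory.congr_hom h2 _).symm

/-- A form has a naive representative around the point at which it is evaluated. -/
lemma exists_eval_eq (s : Γ(forms X p, N)) : ∃ (N' : X.left.Opens) (hN' : ⊤ ≤ e.left ⁻¹ᵁ N')
    (i : N' ⟶ N) (m : NaiveForms X N' p), sec m = (forms X p).presheaf.map i.op s ∧
      eval e hN s = naiveEval e hN' m := by
  obtain ⟨N', i, m, hx, h⟩ := exists_sec_eq s (e.left default) (hN (x := default) trivial)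
  have hN' : ⊤ ≤ e.left ⁻¹ᵁ N' := fun y _ => by
    rw [Subsingleton.elim y default]; exact hx
  exact ⟨N', hN', i, m, h, by rw [← eval_map e hN hN' i, ← h, eval_sec]⟩

lemma eval_pullback {Y : Over (Spec k)} (h : X ⟶ Y) (e' : T ⟶ Y) (he : e ≫ h = e') {M : Y.left.Opens}
    (hM : ⊤ ≤ e.left ⁻¹ᵁ h.left ⁻¹ᵁ M) (hM' : ⊤ ≤ e'.left ⁻¹ᵁ M) (s : Γ(forms Y p, M)) :
    eval e hM ((forms.pullback h p).app M s) = eval e' hM' s := by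
  subst he
  -- Both sides depend only on s near the image of the point, where it is given by a naive form.
  obtain ⟨N', hN', i, m, hm, hs⟩ := exists_eval_eq (e ≫ h) hM' s
  rw [hs]
  have hN'' : ⊤ ≤ e.left ⁻¹ᵁ h.left ⁻¹ᵁ N' := hN'
  refine (eval_map e hM hN'' ((TopologicalSpace.Opens.map h.left.base).map i) _).symm.trans ?_
  have h1 := NatTrans.naturality_apply (forms.pullback h p).mapPresheaf i.op s
  refine (congrArg (eval e hN'') h1.symm).trans ?_
  refine (congrArg (fun t => eval e hN'' ((forms.pullback h p).app N' t)) hm.symm).trans ?_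
  rw [pullback_sec, eval_sec]
  have : (naiveEval e hN'').comp (naivePullback h p N') = naiveEval (e ≫ h) hN' :=
    exteriorPower_addHom_ext fun r x => by
      rw [AddMonoidHom.comp_apply, naivePullback_mkForm, naiveEval_mkForm, naiveEval_mkForm]
      have : ∀ c, e.left.appLE (h.left ⁻¹ᵁ N') ⊤ hN'' (h.left.app N' c) =
          (e ≫ h).left.appLE N' ⊤ hN' c := fun c => by
        rw [← CommRingCat.comp_apply, Scheme.Hom.app_eq_appLE, Scheme.Hom.appLE_comp_appLE]
        rfl
      simp only [this]
  rw [← this]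
  rfl

end eval

end DiffForms

end

/-! ### Sections of the sheaf of forms as forms at the generic point with local conditions. -/

noncomputable section

namespace DiffForms

variable {k : CommRingCat.{u}}

attribute [local instance] algebraSections

variable {T X : Over (Spec k)} {p : ℕ} (e : T ⟶ X)

variable {e} in
lemma top_le_preimage_inf {N N' : X.left.Opens} (hN : ⊤ ≤ e.left ⁻¹ᵁ N) (hN' : ⊤ ≤ e.left ⁻¹ᵁ N') :
    ⊤ ≤ e.left ⁻¹ᵁ (N ⊓ N') :=
  fun _ h => ⟨hN h, hN' h⟩

/-- The ring of values along `e` of the functions defined around `x`. -/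
def valueRing (x : X.left) : Subring Γ(T.left, ⊤) where
  carrier := {c | ∃ (N : X.left.Opens) (_ : x ∈ N) (hN : ⊤ ≤ e.left ⁻¹ᵁ N) (s : Γ(X.left, N)),
    e.left.appLE N ⊤ hN s = c}
  mul_mem' := by
    rintro _ _ ⟨N, hx, hN, s, rfl⟩ ⟨N', hx', hN', s', rfl⟩
    refine ⟨N ⊓ N', ⟨hx, hx'⟩, top_le_preimage_inf hN hN', X.left.presheaf.map (homOfLE inf_le_left).op s *
      X.left.presheaf.map (homOfLE inf_le_right).op s', ?_⟩
    rw [map_mul, ← CommRingCat.comp_apply, ← CommRingCat.comp_apply, Scheme.Hom.map_appLE,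
      Scheme.Hom.map_appLE]
  one_mem' := ⟨⊤, trivial, le_rfl, 1, map_one _⟩
  add_mem' := by
    rintro _ _ ⟨N, hx, hN, s, rfl⟩ ⟨N', hx', hN', s', rfl⟩
    refine ⟨N ⊓ N', ⟨hx, hx'⟩, top_le_preimage_inf hN hN', X.left.presheaf.map (homOfLE inf_le_left).op s +
      X.left.presheaf.map (homOfLE inf_le_right).op s', ?_⟩
    rw [map_add, ← CommRingCat.comp_apply, ← CommRingCat.comp_apply, Scheme.Hom.map_appLE,
      Scheme.Hom.map_appLE]
  zero_mem' := ⟨⊤, trivial, le_rfl, 0, map_zero _⟩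
  neg_mem' := by
    rintro _ ⟨N, hx, hN, s, rfl⟩
    exact ⟨N, hx, hN, -s, map_neg _ _⟩

variable {e} in
lemma appLE_mem_valueRing {x : X.left} {N : X.left.Opens} (hx : x ∈ N) (hN : ⊤ ≤ e.left ⁻¹ᵁ N)
    (s : Γ(X.left, N)) : e.left.appLE N ⊤ hN s ∈ valueRing e x :=
  ⟨N, hx, hN, s, rfl⟩

variable {e} in
lemma exists_family_of_mem_valueRing {x : X.left} : ∀ {n : ℕ} {c : Fin n → Γ(T.left, ⊤)},
    (∀ i, c i ∈ valueRing e x) → ∃ (N : X.left.Opens) (_ : x ∈ N) (hN : ⊤ ≤ e.left ⁻¹ᵁ N)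
      (s : Fin n → Γ(X.left, N)), ∀ i, e.left.appLE N ⊤ hN (s i) = c i
  | 0, c, _ => ⟨⊤, trivial, le_rfl, Fin.elim0, fun i => i.elim0⟩
  | n + 1, c, hc => by
    obtain ⟨N, hx, hN, s, hs⟩ := exists_family_of_mem_valueRing fun i => hc (Fin.succ i)
    obtain ⟨N', hx', hN', s', hs'⟩ := hc 0
    refine ⟨N ⊓ N', ⟨hx, hx'⟩, top_le_preimage_inf hN hN',
      Fin.cons (X.left.presheaf.map (homOfLE inf_le_right).op s')
        fun i => X.left.presheaf.map (homOfLE inf_le_left).op (s i), fun i => ?_⟩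
    refine Fin.cases ?_ (fun i => ?_) i
    · rw [Fin.cons_zero, ← CommRingCat.comp_apply, Scheme.Hom.map_appLE, hs']
    · rw [Fin.cons_succ, ← CommRingCat.comp_apply, Scheme.Hom.map_appLE, hs]

lemma naiveEval_mem {x : X.left} {N : X.left.Opens} (hx : x ∈ N) (hN : ⊤ ≤ e.left ⁻¹ᵁ N)
    (m : NaiveForms X N p) : naiveEval e hN m ∈ regularForms k (valueRing e x) p := by
  have hm : m ∈ regularForms k (⊤ : Subring Γ(X.left, N)) p := by rw [regularForms_top]; trivial
  induction hm using AddSubgroup.closure_induction with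
  | mem v hv =>
    obtain ⟨r, -, y, -, rfl⟩ := hv
    refine AddSubgroup.subset_closure ⟨_, appLE_mem_valueRing hx hN r, _,
      fun i => appLE_mem_valueRing hx hN (y i), naiveEval_mkForm e hN r y⟩
  | zero => rw [map_zero]; exact zero_mem _
  | add v w _ _ hv hw => rw [map_add]; exact add_mem hv hw
  | neg v _ hv => rw [map_neg]; exact neg_mem hv

section unique

variable [Unique T.left]

lemma naiveEval_naiveRes {N N' : X.left.Opens} (hN : ⊤ ≤ e.left ⁻¹ᵁ N) (hN' : ⊤ ≤ e.left ⁻¹ᵁ N')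
    (i : N' ⟶ N) (m : NaiveForms X N p) : naiveEval e hN' (naiveRes i m) = naiveEval e hN m := by
  rw [← eval_sec, ← eval_sec, ← map_sec, eval_map]

lemma exists_naiveEval_eq {x : X.left} {ω : NaiveForms T ⊤ p}
    (hω : ω ∈ regularForms k (valueRing e x) p) : ∃ (N : X.left.Opens) (_ : x ∈ N)
      (hN : ⊤ ≤ e.left ⁻¹ᵁ N) (m : NaiveForms X N p), naiveEval e hN m = ω := by
  induction hω using AddSubgroup.closure_induction with
  | mem v hv =>
    obtain ⟨r, hr, y, hy, rfl⟩ := hv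
    obtain ⟨N, hx, hN, s, hs⟩ := exists_family_of_mem_valueRing
      (c := Fin.cons r y) (Fin.cases hr hy)
    refine ⟨N, hx, hN, mkForm (s 0) fun i => s i.succ, ?_⟩
    rw [naiveEval_mkForm]
    simp only [hs, Fin.cons_zero, Fin.cons_succ]
  | zero => exact ⟨⊤, trivial, le_rfl, 0, map_zero _⟩
  | add v w _ _ hv hw =>
    obtain ⟨N, hx, hN, m, rfl⟩ := hv
    obtain ⟨N', hx', hN', m', rfl⟩ := hw
    refine ⟨N ⊓ N', ⟨hx, hx'⟩, top_le_preimage_inf hN hN', naiveRes (homOfLE inf_le_left) m +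
      naiveRes (homOfLE inf_le_right) m', ?_⟩
    rw [map_add, naiveEval_naiveRes e hN, naiveEval_naiveRes e hN']
  | neg v _ hv =>
    obtain ⟨N, hx, hN, m, rfl⟩ := hv
    exact ⟨N, hx, hN, -m, map_neg _ _⟩

lemma eval_mem {x : X.left} {N : X.left.Opens} (hx : x ∈ N) (hN : ⊤ ≤ e.left ⁻¹ᵁ N)
    (hdense : ∀ N : X.left.Opens, (N : Set X.left).Nonempty → ⊤ ≤ e.left ⁻¹ᵁ N)
    (s : Γ(forms X p, N)) : eval e hN s ∈ regularForms k (valueRing e x) p := by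
  obtain ⟨N', i, m, hxN', hm⟩ := exists_sec_eq s x hx
  have hN' := hdense N' ⟨x, hxN'⟩
  rw [← eval_map e hN hN' i, ← hm, eval_sec]
  exact naiveEval_mem e hxN' hN' m

/-- Every point has arbitrarily small neighbourhoods on which naive forms are determined by their
value along `e`. -/
def LocallyDetermined (p : ℕ) : Prop :=
  ∀ (x : X.left) (N : X.left.Opens), x ∈ N → ∃ (N' : X.left.Opens) (_ : N' ⟶ N)
    (hN' : ⊤ ≤ e.left ⁻¹ᵁ N'), x ∈ N' ∧
      Function.Injective (naiveEval e hN' : NaiveForms X N' p →+ NaiveForms T ⊤ p)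

variable {e}

/-- A section with value zero has, near each point, a naive representative on a neighbourhood where
naive forms are determined by their value. So it vanishes locally, and therefore globally. -/
lemma eval_injective (he : LocallyDetermined e p) {N : X.left.Opens} (hN : ⊤ ≤ e.left ⁻¹ᵁ N) :
    Function.Injective (eval e hN : Γ(forms X p, N) →+ NaiveForms T ⊤ p) := by
  rw [injective_iff_map_eq_zero]
  intro s hs
  have key : ∀ x : N, ∃ (N' : X.left.Opens) (i : N' ⟶ N), x.1 ∈ N' ∧
      (forms X p).presheaf.map i.op s = 0 := by
    rintro ⟨x, hx⟩
    obtain ⟨N', i, m, hxN', hm⟩ := exists_sec_eq s x hx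
    obtain ⟨N'', j, hN'', hxN'', hinj⟩ := he x N' hxN'
    refine ⟨N'', j ≫ i, hxN'', ?_⟩
    have h1 : (forms X p).presheaf.map (j ≫ i).op s = sec (naiveRes j m) := by
      rw [← map_sec, hm]
      exact ConcreteCategory.congr_hom ((forms X p).presheaf.map_comp i.op j.op) s
    have h2 : naiveRes j m = 0 := by
      apply hinj
      rw [map_zero, ← eval_sec, ← h1, eval_map e hN, hs]
    rw [h1, h2, map_zero]
  choose N' i hx h using key
  refine TopCat.Sheaf.eq_of_locally_eq' ⟨(forms X p).presheaf, (forms X p).isSheaf⟩ N' N i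
    (fun x hxN => TopologicalSpace.Opens.mem_iSup.2 ⟨⟨x, hxN⟩, hx _⟩) s 0 fun x => ?_
  rw [map_zero]
  exact h x

/-- Local naive forms with value ω agree on overlaps by `eval_injective`, so they glue. With
`eval_mem` this describes the sections over N as the ω regular at every point of N. -/
lemma exists_eval_eq_of_forall_mem (he : LocallyDetermined e p) {N : X.left.Opens}
    (hN : ⊤ ≤ e.left ⁻¹ᵁ N) {ω : NaiveForms T ⊤ p}
    (hω : ∀ x ∈ N, ω ∈ regularForms k (valueRing e x) p) : ∃ s : Γ(forms X p, N), eval e hN s = ω := by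
  have key : ∀ x : N, ∃ (N' : X.left.Opens) (_ : N' ⟶ N) (hN' : ⊤ ≤ e.left ⁻¹ᵁ N')
      (t : Γ(forms X p, N')), x.1 ∈ N' ∧ eval e hN' t = ω := by
    rintro ⟨x, hx⟩
    obtain ⟨N', hxN', hN', m, hm⟩ := exists_naiveEval_eq e (hω x hx)
    refine ⟨N' ⊓ N, homOfLE inf_le_right, top_le_preimage_inf hN' hN,
      sec (naiveRes (homOfLE inf_le_left) m), ⟨hxN', hx⟩, ?_⟩
    rw [eval_sec, naiveEval_naiveRes e hN', hm]
  choose N' i hN' t hx ht using key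
  obtain ⟨s, hs, -⟩ := TopCat.Sheaf.existsUnique_gluing'
    ⟨(forms X p).presheaf, (forms X p).isSheaf⟩ N' N i
    (fun x hxN => TopologicalSpace.Opens.mem_iSup.2 ⟨⟨x, hxN⟩, hx _⟩) t fun x y => by
      have hxy : ⊤ ≤ e.left ⁻¹ᵁ (N' x ⊓ N' y) := top_le_preimage_inf (hN' x) (hN' y)
      apply eval_injective he hxy
      exact (eval_map e (hN' x) hxy _ _).trans ((ht x).trans ((ht y).symm.trans
        (eval_map e (hN' y) hxy _ _).symm))
  obtain ⟨x⟩ : Nonempty N := ⟨⟨e.left default, hN (x := default) trivial⟩⟩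
  refine ⟨s, ?_⟩
  rw [← eval_map e hN (hN' x) (i x), ← ht x]
  exact congrArg _ (hs x)

end unique

end DiffForms

end

noncomputable section

/-! ### Injectivity of the evaluation of naive forms near regular points -/

open KaehlerDifferential

/-- The monomials in the w_i generate ⋀^p Ω_A and their images are linearly independent over L, so a
combination mapped to zero has zero coefficients. -/
lemma exteriorPower_addHom_injective {k A L : Type*} [CommRing k] [CommRing A] [Field L]
    [Algebra k A] [Algebra k L] [Algebra A L] [IsScalarTower k A L] [FaithfulSMul A L] {n p : ℕ}
    {w : Fin n → Ω[A⁄k]} (hw : Submodule.span A (Set.range w) = ⊤)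
    (hli : LinearIndependent L fun i => KaehlerDifferential.map k k A L (w i))
    {F : (⋀[A]^p Ω[A⁄k]) →+ ⋀[L]^p Ω[L⁄k]}
    (hF : ∀ (r : A) (x : Fin p → A), F (r • exteriorPower.ιMulti A p fun i => D k A (x i)) =
      algebraMap A L r • exteriorPower.ιMulti L p fun i => D k L (algebraMap A L (x i))) :
    Function.Injective F := by
  let g : Ω[A⁄k] [⋀^Fin p]→ₗ[A] ⋀[L]^p Ω[L⁄k] :=
    AlternatingMap.compLinearMap
      { (exteriorPower.ιMulti L p).toMultilinearMap.restrictScalars A with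
        map_eq_zero_of_eq' := fun v i j => (exteriorPower.ιMulti L p).map_eq_zero_of_eq v }
      (KaehlerDifferential.map k k A L)
  let G : (⋀[A]^p Ω[A⁄k]) →ₗ[A] ⋀[L]^p Ω[L⁄k] := exteriorPower.alternatingMapLinearEquiv g
  have hG : ∀ y, G (exteriorPower.ιMulti A p y) =
      exteriorPower.ιMulti L p fun i => KaehlerDifferential.map k k A L (y i) := fun y =>
    exteriorPower.alternatingMapLinearEquiv_apply_ιMulti g y
  have hFG : F = G.toAddMonoidHom := exteriorPower_addHom_ext fun r x => by
    rw [hF]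
    change _ = G (r • exteriorPower.ιMulti A p fun i => D k A (x i))
    rw [map_smul, hG, algebraMap_smul]
    simp only [KaehlerDifferential.map_D]
  rw [hFG]
  change Function.Injective G
  rw [injective_iff_map_eq_zero]
  intro m hm
  have hspan := exteriorPower.ιMulti_family_span_of_span (n := p) A hw
  obtain ⟨c, rfl⟩ := (Submodule.mem_span_range_iff_exists_fun A).1
    (show m ∈ Submodule.span A (Set.range (exteriorPower.ιMulti_family A p w)) by
      rw [hspan]; trivial)
  have hli' := exteriorPower.ιMulti_family_linearIndependent_field p hli
  rw [Fintype.linearIndependent_iff] at hli'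
  have h0 : ∀ s, algebraMap A L (c s) = 0 := by
    refine hli' (fun s => algebraMap A L (c s)) ?_
    rw [map_sum] at hm
    rw [← hm]
    refine Finset.sum_congr rfl fun s _ => ?_
    rw [map_smul, algebraMap_smul]
    congr 1
    exact (hG _).symm
  refine Finset.sum_eq_zero fun s _ => ?_
  rw [(FaithfulSMul.algebraMap_eq_zero_iff A L).1 (h0 s), zero_smul]

lemma KaehlerDifferential.span_map_eq_top_of_away {k B B' : Type*} [CommRing k] [CommRing B]
    [CommRing B'] [Algebra k B] [Algebra k B'] [Algebra B B'] [IsScalarTower k B B'] {h : B}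
    [IsLocalization.Away h B'] {n : ℕ} {w : Fin n → Ω[B⁄k]}
    (hw : ∀ v, h • v ∈ Submodule.span B (Set.range w)) :
    Submodule.span B' (Set.range fun i => KaehlerDifferential.map k k B B' (w i)) = ⊤ := by
  have hu : IsUnit (algebraMap B B' h) := IsLocalization.Away.algebraMap_isUnit h
  have key : ∀ v, KaehlerDifferential.map k k B B' v ∈
      Submodule.span B' (Set.range fun i => KaehlerDifferential.map k k B B' (w i)) := by
    intro v
    have h1 : KaehlerDifferential.map k k B B' (h • v) ∈
        Submodule.span B' (Set.range fun i => KaehlerDifferential.map k k B B' (w i)) := by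
      have h2 := hw v
      generalize h • v = v' at h2
      induction h2 using Submodule.span_induction with
      | mem x hx => obtain ⟨i, rfl⟩ := hx; exact Submodule.subset_span ⟨i, rfl⟩
      | zero => rw [map_zero]; exact zero_mem _
      | add x y _ _ hx hy => rw [map_add]; exact add_mem hx hy
      | smul a x _ hx =>
        rw [map_smul, ← algebraMap_smul B' a]
        exact Submodule.smul_mem _ _ hx
    rw [map_smul, ← algebraMap_smul B' h] at h1
    exact (Submodule.smul_mem_iff_of_isUnit _ hu).1 h1
  rw [eq_top_iff]
  intro v _
  obtain ⟨⟨x, s⟩, hx⟩ := IsLocalizedModule.surj (Submonoid.powers h)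
    (KaehlerDifferential.map k k B B') v
  have hs : IsUnit (algebraMap B B' s) := IsLocalization.map_units B' s
  rw [← Submodule.smul_mem_iff_of_isUnit _ hs, algebraMap_smul]
  exact (congrArg (· ∈ Submodule.span B' _) hx).mpr (key x)

lemma KaehlerDifferential.map_map_of_tower {k B R L : Type*} [CommRing k] [CommRing B] [CommRing R]
    [CommRing L] [Algebra k B] [Algebra k R] [Algebra k L] [Algebra B R] [Algebra B L] [Algebra R L]
    [IsScalarTower k B R] [IsScalarTower k B L] [IsScalarTower k R L] [IsScalarTower B R L]
    (v : Ω[B⁄k]) : KaehlerDifferential.map k k R L (KaehlerDifferential.map k k B R v) =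
      KaehlerDifferential.map k k B L v := by
  have : v ∈ Submodule.span B (Set.range (D k B)) := by
    rw [KaehlerDifferential.span_range_derivation]; trivial
  induction this using Submodule.span_induction with
  | mem x hx =>
    obtain ⟨b, rfl⟩ := hx
    simp only [KaehlerDifferential.map_D, ← IsScalarTower.algebraMap_apply]
  | zero => simp
  | add x y _ _ hx hy => simp [hx, hy]
  | smul a x _ hx =>
    rw [map_smul, ← algebraMap_smul R a, map_smul, algebraMap_smul, hx, map_smul]

/-- Coordinates at q spread out to a neighbourhood: clearing denominators in the dt_i gives elements
of Ω_B, and as Ω_B is finitely generated a single h outside q works for all of it. Independence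
survives because each dt_i is scaled by a nonzero element of L. -/
theorem exists_span_differentials {k B L : Type u} [Field k] [CharZero k] [CommRing B] [Field L]
    [Algebra k B] [Algebra k L] [Algebra B L] [IsScalarTower k B L] [FaithfulSMul B L]
    [Algebra.FiniteType k B] [Algebra.IsAlgebraic B L] (q : Ideal B) [q.IsPrime]
    [IsRegularLocalRing (Localization.AtPrime q)] :
    ∃ (h : B) (n : ℕ) (w : Fin n → Ω[B⁄k]), h ∉ q ∧
      (∀ v, h • v ∈ Submodule.span B (Set.range w)) ∧
      LinearIndependent L fun i => KaehlerDifferential.map k k B L (w i) := by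
  obtain ⟨_, h1, h2, h3⟩ := exists_algebra_localization (k := k) (L := L) q
  have : IsDomain B := (FaithfulSMul.algebraMap_injective B L).isDomain _
  have : Algebra.EssFiniteType k (Localization.AtPrime q) := .comp _ B _
  have : Algebra.IsAlgebraic (Localization.AtPrime q) L := .extendScalars (R := B)
    (IsLocalization.injective (Localization.AtPrime q) q.primeCompl_le_nonZeroDivisors)
  obtain ⟨n, t, ht, hli, -⟩ :=
    IsRegularLocalRing.exists_coordinates (k := k) (Localization.AtPrime q) L
  let R := Localization.AtPrime q
  let φ := KaehlerDifferential.map k k B R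
  choose ws hws using fun i => IsLocalizedModule.surj q.primeCompl φ (D k R (t i))
  let w : Fin n → Ω[B⁄k] := fun i => (ws i).1
  have hw : ∀ i, φ (w i) = algebraMap B R (ws i).2 • D k R (t i) := fun i => by
    rw [algebraMap_smul]; exact (hws i).symm
  have hspan : Submodule.span R (φ '' Set.range w) = ⊤ := by
    rw [eq_top_iff, ← ht, Submodule.span_le]
    rintro _ ⟨i, rfl⟩
    have hu : IsUnit (algebraMap B R (ws i).2) := IsLocalization.map_units R (ws i).2
    rw [SetLike.mem_coe, ← Submodule.smul_mem_iff_of_isUnit _ hu, ← hw]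
    exact Submodule.subset_span ⟨_, ⟨i, rfl⟩, rfl⟩
  have hkey : ∀ v : Ω[B⁄k], ∃ h, h ∉ q ∧ h • v ∈ Submodule.span B (Set.range w) := by
    intro v
    have hv : φ v ∈ Submodule.span R (φ '' Set.range w) := by rw [hspan]; trivial
    rw [← Submodule.localized'_span R q.primeCompl φ, Submodule.mem_localized'] at hv
    obtain ⟨m, hm, s, hs⟩ := hv
    rw [IsLocalizedModule.mk'_eq_iff, Submonoid.smul_def, ← map_smul] at hs
    obtain ⟨c, hc⟩ := (IsLocalizedModule.eq_iff_exists q.primeCompl φ).1 hs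
    refine ⟨c * s, Ideal.IsPrime.mul_notMem ‹_› c.2 s.2, ?_⟩
    rw [mul_smul, ← Submonoid.smul_def c, ← hc]
    exact Submodule.smul_mem _ _ hm
  classical
  obtain ⟨h, hq, hh⟩ : ∃ h, h ∉ q ∧ ∀ v : Ω[B⁄k], h • v ∈ Submodule.span B (Set.range w) := by
    obtain ⟨S, hS⟩ := (Module.Finite.fg_top : (⊤ : Submodule B Ω[B⁄k]).FG)
    choose f hfq hf using hkey
    refine ⟨∏ v ∈ S, f v, fun hmem => ?_, fun v => ?_⟩
    · obtain ⟨v, -, hv⟩ := (Ideal.IsPrime.prod_mem_iff).1 hmem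
      exact hfq v hv
    · have hv : v ∈ Submodule.span B (S : Set Ω[B⁄k]) := by rw [hS]; trivial
      induction hv using Submodule.span_induction with
      | mem x hx =>
        rw [← Finset.prod_erase_mul _ _ hx, mul_smul]
        exact Submodule.smul_mem _ _ (hf x)
      | zero => rw [smul_zero]; exact zero_mem _
      | add x y _ _ hx hy => rw [smul_add]; exact add_mem hx hy
      | smul a x _ hx => rw [smul_comm]; exact Submodule.smul_mem _ _ hx
  refine ⟨h, n, w, hq, hh, ?_⟩
  have hne : ∀ i, algebraMap B L (ws i).2 ≠ 0 := fun i h0 => by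
    rw [FaithfulSMul.algebraMap_eq_zero_iff] at h0
    exact (ws i).2.2 (by rw [h0]; exact q.zero_mem)
  have := hli.units_smul fun i => Units.mk0 _ (hne i)
  convert this using 1
  funext i
  rw [← KaehlerDifferential.map_map_of_tower (R := R), hw, map_smul, KaehlerDifferential.map_D, algebraMap_smul, ← algebraMap_smul L]
  rfl

/-- All models B' of the localization at h are allowed, so that the statement applies to the ring of
sections over a basic open set. -/
theorem exists_addHom_injective {k B L : Type u} [Field k] [CharZero k] [CommRing B] [Field L]
    [Algebra k B] [Algebra k L] [Algebra B L] [IsScalarTower k B L] [FaithfulSMul B L]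
    [Algebra.FiniteType k B] [Algebra.IsAlgebraic B L] (q : Ideal B) [q.IsPrime]
    [IsRegularLocalRing (Localization.AtPrime q)] (p : ℕ) :
    ∃ h, h ∉ q ∧ ∀ (B' : Type u) [CommRing B'] [Algebra k B'] [Algebra B B'] [IsScalarTower k B B']
      [IsLocalization.Away h B'] [Algebra B' L] [IsScalarTower B B' L] [IsScalarTower k B' L]
      [FaithfulSMul B' L] (F : (⋀[B']^p Ω[B'⁄k]) →+ ⋀[L]^p Ω[L⁄k])
      (_ : ∀ (r : B') (x : Fin p → B'), F (r • exteriorPower.ιMulti B' p fun i => D k B' (x i)) =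
        algebraMap B' L r • exteriorPower.ιMulti L p fun i => D k L (algebraMap B' L (x i))),
      Function.Injective F := by
  obtain ⟨h, n, w, hq, hh, hli⟩ := exists_span_differentials (k := k) (L := L) q
  refine ⟨h, hq, fun B' _ _ _ _ _ _ _ _ _ F hF => exteriorPower_addHom_injective
    (KaehlerDifferential.span_map_eq_top_of_away (B' := B') hh) ?_ hF⟩
  simpa only [KaehlerDifferential.map_map_of_tower] using hli

end

/-! ### Generic points up to algebraic extension, and determination of forms by their generic value.
-/

noncomputable section

namespace DiffForms

attribute [local instance] algebraSections

/-- `A` is of finite type over `k`, and `A ⟶ L` is injective and algebraic. -/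
structure IsGenericHom {k A L : CommRingCat.{u}} (f : k ⟶ A) (g : A ⟶ L) : Prop where
  finiteType : f.hom.FiniteType
  injective : Function.Injective g
  algebraic : ∀ c : L, ∃ P : Polynomial A, P ≠ 0 ∧ P.eval₂ g.hom c = 0

/-- `e : T ⟶ X` is a generic point of the variety `X`, up to an algebraic extension. -/
structure IsGeneric {k : CommRingCat.{u}} {T X : Over (Spec k)} (e : T ⟶ X) : Prop where
  dense : ∀ N : X.left.Opens, (N : Set X.left).Nonempty → ⊤ ≤ e.left ⁻¹ᵁ N
  isGenericHom : ∀ (N : X.left.Opens) (hN : ⊤ ≤ e.left ⁻¹ᵁ N), IsAffineOpen N →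
    IsGenericHom ((baseToSections X).app (op N)) (e.left.appLE N ⊤ hN)

lemma baseToSections_appLE {k : CommRingCat.{u}} {T X : Over (Spec k)} (e : T ⟶ X)
    {N : X.left.Opens} {M : T.left.Opens} (hN : M ≤ e.left ⁻¹ᵁ N) :
    (baseToSections X).app (op N) ≫ e.left.appLE N M hN = (baseToSections T).app (op M) := by
  rw [Scheme.Hom.appLE, ← Category.assoc, ← baseToSections_comp e (op N), Category.id_comp]
  exact ((baseToSections T).naturality (homOfLE hN).op).symm.trans (Category.id_comp _)

lemma mem_basicOpen_iff_notMem_primeIdealOf {X : Scheme.{u}} {N : X.Opens} (hN : IsAffineOpen N)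
    {x : X} (hx : x ∈ N) (h : Γ(X, N)) :
    x ∈ X.basicOpen h ↔ h ∉ (hN.primeIdealOf ⟨x, hx⟩).asIdeal := by
  have h1 : hN.primeIdealOf ⟨x, hx⟩ ∈ hN.fromSpec ⁻¹ᵁ X.basicOpen h ↔
      hN.primeIdealOf ⟨x, hx⟩ ∈ PrimeSpectrum.basicOpen h :=
    iff_of_eq (congrArg (hN.primeIdealOf ⟨x, hx⟩ ∈ ·) (hN.fromSpec_preimage_basicOpen h))
  have h2 : hN.fromSpec (hN.primeIdealOf ⟨x, hx⟩) = x := hN.fromSpec_primeIdealOf ⟨x, hx⟩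
  have h3 : hN.primeIdealOf ⟨x, hx⟩ ∈ hN.fromSpec ⁻¹ᵁ X.basicOpen h ↔ x ∈ X.basicOpen h :=
    iff_of_eq (congrArg (· ∈ X.basicOpen h) h2)
  exact h3.symm.trans h1

/-- The stalk of a scheme as a localization of an affine neighbourhood. -/
def stalkRingEquiv {X : Scheme.{u}} {N : X.Opens} (hN : IsAffineOpen N)
    {x : X} (hx : x ∈ N) : X.presheaf.stalk x ≃+*
      Localization.AtPrime (hN.primeIdealOf ⟨x, hx⟩).asIdeal :=
  letI := X.presheaf.algebra_section_stalk ⟨x, hx⟩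
  haveI := hN.isLocalization_stalk ⟨x, hx⟩
  (IsLocalization.algEquiv (hN.primeIdealOf ⟨x, hx⟩).asIdeal.primeCompl (X.presheaf.stalk x)
    (Localization.AtPrime (hN.primeIdealOf ⟨x, hx⟩).asIdeal)).toRingEquiv

section

variable {k : CommRingCat.{u}} {T X : Over (Spec k)} {e : T ⟶ X}

/-- Basic open sets form a basis at x, and their sections are fractions with denominator a power of
h. -/
lemma mem_valueRing_iff {N : X.left.Opens} (haff : IsAffineOpen N)
    (hN : ⊤ ≤ e.left ⁻¹ᵁ N) (hdense : ∀ N : X.left.Opens, (N : Set X.left).Nonempty → ⊤ ≤ e.left ⁻¹ᵁ N)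
    {x : X.left} (hx : x ∈ N) {c : Γ(T.left, ⊤)} :
    c ∈ valueRing e x ↔ ∃ a h : Γ(X.left, N), h ∉ (haff.primeIdealOf ⟨x, hx⟩).asIdeal ∧
      c * e.left.appLE N ⊤ hN h = e.left.appLE N ⊤ hN a := by
  have hres : ∀ (h a : Γ(X.left, N)) (hD : ⊤ ≤ e.left ⁻¹ᵁ (X.left.basicOpen h)),
      e.left.appLE (X.left.basicOpen h) ⊤ hD (algebraMap _ _ a) = e.left.appLE N ⊤ hN a := by
    intro h a hD
    change (X.left.presheaf.map (homOfLE (X.left.basicOpen_le h)).op ≫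
      e.left.appLE (X.left.basicOpen h) ⊤ hD) a = _
    rw [Scheme.Hom.map_appLE]
  constructor
  · rintro ⟨N', hx', hN', s, rfl⟩
    obtain ⟨h, hle, hxh⟩ := haff.exists_basicOpen_le ⟨x, hx'⟩ hx
    have hD := hdense _ ⟨x, hxh⟩
    have hloc := haff.isLocalization_basicOpen h
    obtain ⟨⟨a, ⟨_, n, rfl⟩⟩, ha⟩ := IsLocalization.surj (Submonoid.powers h)
      (X.left.presheaf.map (homOfLE hle).op s)
    refine ⟨a, h ^ n, fun hn => ?_, ?_⟩
    · exact (mem_basicOpen_iff_notMem_primeIdealOf haff hx h).1 hxh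
        (Ideal.IsPrime.mem_of_pow_mem inferInstance n hn)
    · rw [← hres h a hD, ← ha, map_mul]
      have h1 : e.left.appLE N' ⊤ hN' s = e.left.appLE (X.left.basicOpen h) ⊤ hD
          (X.left.presheaf.map (homOfLE hle).op s) := by
        rw [← CommRingCat.comp_apply, Scheme.Hom.map_appLE]
      rw [h1]
      congr 1
      exact (hres h (h ^ n) hD).symm
  · rintro ⟨a, h, hh, hc⟩
    have hxh := (mem_basicOpen_iff_notMem_primeIdealOf haff hx h).2 hh
    have hD := hdense _ ⟨x, hxh⟩
    have hloc := haff.isLocalization_basicOpen h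
    obtain ⟨v, hv⟩ := IsLocalization.Away.algebraMap_isUnit (S := Γ(X.left, X.left.basicOpen h)) h
    refine ⟨X.left.basicOpen h, hxh, hD, algebraMap _ _ a * (v⁻¹ : _ˣ), ?_⟩
    rw [map_mul, hres, ← hc, ← hres h h hD, mul_assoc, ← map_mul, ← hv, Units.mul_inv, map_one,
      mul_one]

end

/-- Naive forms on a variety are determined by their value at the generic point near regular
points. -/
theorem IsGeneric.locallyDetermined {K : Type u} [Field K] [CharZero K]
    {T X : Over (Spec (CommRingCat.of K))} [Unique T.left] (hT : IsField Γ(T.left, ⊤)) {e : T ⟶ X}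
    (he : IsGeneric e) (hreg : ∀ x, IsRegularLocalRing (X.left.presheaf.stalk x)) (p : ℕ) :
    LocallyDetermined e p := by
  intro x N hxN
  obtain ⟨N0, haff, hx, hle⟩ := exists_isAffineOpen_mem_and_subset hxN
  have hN0 := he.dense N0 ⟨x, hx⟩
  obtain ⟨h1, h2, h3⟩ := he.isGenericHom N0 hN0 haff
  let := hT.toField
  let : Algebra K Γ(X.left, N0) := algebraSections X N0
  let : Algebra K Γ(T.left, ⊤) := algebraSections T ⊤
  let : Algebra Γ(X.left, N0) Γ(T.left, ⊤) := (e.left.appLE N0 ⊤ hN0).hom.toAlgebra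
  have : IsScalarTower K Γ(X.left, N0) Γ(T.left, ⊤) :=
    .of_algebraMap_eq' (congrArg CommRingCat.Hom.hom (baseToSections_appLE e hN0)).symm
  have : FaithfulSMul Γ(X.left, N0) Γ(T.left, ⊤) := (faithfulSMul_iff_algebraMap_injective _ _).2 h2
  have : Algebra.FiniteType K Γ(X.left, N0) := h1
  have : Algebra.IsAlgebraic Γ(X.left, N0) Γ(T.left, ⊤) := ⟨fun c => by
    obtain ⟨P, hP, hc⟩ := h3 c
    exact ⟨P, hP, hc⟩⟩
  have : IsRegularLocalRing (Localization.AtPrime (haff.primeIdealOf ⟨x, hx⟩).asIdeal) :=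
    have := hreg x
    .of_ringEquiv (stalkRingEquiv haff hx)
  obtain ⟨h, hh, H⟩ := exists_addHom_injective (k := K) (B := Γ(X.left, N0)) (L := Γ(T.left, ⊤))
    (haff.primeIdealOf ⟨x, hx⟩).asIdeal p
  have hxh := (mem_basicOpen_iff_notMem_primeIdealOf haff hx h).2 hh
  have hD := he.dense _ ⟨x, hxh⟩
  refine ⟨X.left.basicOpen h, homOfLE ((X.left.basicOpen_le h).trans hle), hD, hxh, ?_⟩
  have hloc := haff.isLocalization_basicOpen h
  let : Algebra K Γ(X.left, X.left.basicOpen h) := algebraSections X (X.left.basicOpen h)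
  let : Algebra Γ(X.left, X.left.basicOpen h) Γ(T.left, ⊤) :=
    (e.left.appLE (X.left.basicOpen h) ⊤ hD).hom.toAlgebra
  have : IsScalarTower K Γ(X.left, N0) Γ(X.left, X.left.basicOpen h) :=
    .of_algebraMap_eq' (congrArg CommRingCat.Hom.hom
      (((baseToSections X).naturality (homOfLE (X.left.basicOpen_le h)).op).symm.trans
        (Category.id_comp _))).symm
  have : IsScalarTower Γ(X.left, N0) Γ(X.left, X.left.basicOpen h) Γ(T.left, ⊤) :=
    .of_algebraMap_eq' (congrArg CommRingCat.Hom.hom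
      (Scheme.Hom.map_appLE e.left hD (homOfLE (X.left.basicOpen_le h)).op)).symm
  have : IsScalarTower K Γ(X.left, X.left.basicOpen h) Γ(T.left, ⊤) :=
    .of_algebraMap_eq' (congrArg CommRingCat.Hom.hom (baseToSections_appLE e hD)).symm
  have : FaithfulSMul Γ(X.left, X.left.basicOpen h) Γ(T.left, ⊤) :=
    (faithfulSMul_iff_algebraMap_injective _ _).2
      (he.isGenericHom _ hD (haff.basicOpen h)).injective
  exact H Γ(X.left, X.left.basicOpen h) (naiveEval e hD) fun r x => naiveEval_mkForm e hD r x

end DiffForms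

end

noncomputable section

/-! ### Generic points -/

namespace SchemeProps

lemma locallyOfFiniteType_toSpecZero {R A : Type u} [CommRing R] [CommRing A] [Algebra R A]
    [Algebra.FiniteType R A] (𝒜 : ℕ → Submodule R A) [GradedAlgebra 𝒜] :
    LocallyOfFiniteType (Proj.toSpecZero 𝒜) :=
  have : IsScalarTower R (𝒜 0) A := ⟨fun r a b => smul_mul_assoc r (a : A) b⟩
  have : Algebra.FiniteType (𝒜 0) A := .of_restrictScalars_finiteType R _ _
  inferInstance

lemma locallyOfFiniteType_projectiveSpace (k : CommRingCat.{u}) (n : ℕ) :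
    LocallyOfFiniteType (projectiveSpace k n).hom := by
  have h : LocallyOfFiniteType (Spec.map (CommRingCat.ofHom
      (algebraMap k (MvPolynomial.homogeneousSubmodule (Fin (n + 1)) k 0)))) := by
    rw [HasRingHomProperty.Spec_iff (P := @LocallyOfFiniteType)]
    -- A homogeneous polynomial of degree zero is constant, so k surjects onto the degree-zero part.
    refine RingHom.FiniteType.of_surjective _ fun c => ?_
    obtain ⟨r, hr⟩ : ∃ r, c.1 = MvPolynomial.C r :=
      ⟨_, MvPolynomial.totalDegree_eq_zero_iff_eq_C.1
        ((MvPolynomial.totalDegree_zero_iff_isHomogeneous _).2 c.2)⟩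
    exact ⟨r, Subtype.ext hr.symm⟩
  exact @locallyOfFiniteType_comp _ _ _ _ _ (@locallyOfFiniteType_toSpecZero k
    (MvPolynomial (Fin (n + 1)) k) _ _ _ _ _ MvPolynomial.gradedAlgebra) h

/-- Immersions are locally of finite type, as is projective space over the base. Quasi-projectivity
enters the main theorem in this form. -/
lemma IsQuasiProjective.locallyOfFiniteType {k : CommRingCat.{u}} {X : Over (Spec k)}
    (hX : IsQuasiProjective X) : LocallyOfFiniteType X.hom := by
  obtain ⟨n, i, hi⟩ := hX
  have := locallyOfFiniteType_projectiveSpace k n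
  rw [← Over.w i]
  exact locallyOfFiniteType_comp _ _

end SchemeProps

namespace DiffForms

attribute [local instance] algebraSections

section GenericPoint

variable {k : CommRingCat.{u}} (X : Over (Spec k)) [IsIntegral X.left]

/-- The spectrum of the function field of an integral scheme. -/
def genericOver : Over (Spec k) :=
  Over.mk (X.left.fromSpecStalk (genericPoint X.left) ≫ X.hom)

/-- The generic point of an integral scheme. -/
def genericHom : genericOver X ⟶ X := Over.homMk (X.left.fromSpecStalk (genericPoint X.left))

instance : Unique (genericOver X).left :=
  inferInstanceAs (Unique (PrimeSpectrum X.left.functionField))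

/-- The ring of functions of the generic point is the function field. -/
def genericEquiv : Γ((genericOver X).left, ⊤) ≅ X.left.functionField :=
  Scheme.ΓSpecIso X.left.functionField

lemma isField_genericOver : IsField Γ((genericOver X).left, ⊤) :=
  (genericEquiv X).commRingCatIsoToRingEquiv.toMulEquiv.isField (Field.toIsField X.left.functionField)

variable {X}

lemma mem_of_nonempty {N : X.left.Opens} (hN : (N : Set X.left).Nonempty) :
    genericPoint X.left ∈ N :=
  (genericPoint_spec X.left).mem_open_set_iff N.2 |>.2 (by simpa using hN)

lemma top_le_genericHom_preimage (N : X.left.Opens) (hN : (N : Set X.left).Nonempty) :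
    ⊤ ≤ (genericHom X).left ⁻¹ᵁ N := by
  refine (Scheme.preimage_eq_top_of_closedPoint_mem (X.left.fromSpecStalk (genericPoint X.left))
    ?_).ge
  rw [Scheme.fromSpecStalk_closedPoint]
  exact mem_of_nonempty hN

lemma genericHom_appLE {N : X.left.Opens} (hN : (N : Set X.left).Nonempty) :
    (genericHom X).left.appLE N ⊤ (top_le_genericHom_preimage N hN) =
      X.left.presheaf.germ N _ (mem_of_nonempty hN) ≫ (genericEquiv X).inv := by
  have h := Scheme.fromSpecStalk_app (mem_of_nonempty hN)
  rw [Scheme.Hom.appLE]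
  refine (congrArg (· ≫ _) h).trans ?_
  refine (Category.assoc _ _ _).trans (congrArg (_ ≫ ·) ((Category.assoc _ _ _).trans ?_))
  refine (congrArg (_ ≫ ·) (((genericOver X).left.presheaf.map_comp _ _).symm.trans
    ((genericOver X).left.presheaf.map_id _))).trans (Category.comp_id _)

lemma genericHom_injective {N : X.left.Opens} (hN : ⊤ ≤ (genericHom X).left ⁻¹ᵁ N) :
    Function.Injective ((genericHom X).left.appLE N ⊤ hN) := by
  have hne : (N : Set X.left).Nonempty := ⟨_, hN (x := default) trivial⟩
  have := hne.to_subtype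
  rw [genericHom_appLE hne]
  exact (genericEquiv X).symm.commRingCatIsoToRingEquiv.injective.comp
    (germ_injective_of_isIntegral _ _ (mem_of_nonempty hne))

lemma isFractionRing_genericHom {N : X.left.Opens} (hN : (N : Set X.left).Nonempty)
    (haff : IsAffineOpen N) :
    let := ((genericHom X).left.appLE N ⊤ (top_le_genericHom_preimage N hN)).hom.toAlgebra
    IsFractionRing Γ(X.left, N) Γ((genericOver X).left, ⊤) := by
  have : Nonempty N := hN.to_subtype
  have h := functionField_isFractionRing_of_isAffineOpen X.left N haff
  let := ((genericHom X).left.appLE N ⊤ (top_le_genericHom_preimage N hN)).hom.toAlgebra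
  refine (IsLocalization.isLocalization_iff_of_algEquiv _ (S := X.left.functionField)
    (P := Γ((genericOver X).left, ⊤))
    { (genericEquiv X).commRingCatIsoToRingEquiv.symm with commutes' := fun r => ?_ }).1 h
  exact (CategoryTheory.congr_fun (genericHom_appLE hN) r).symm

lemma isGeneric_genericHom [LocallyOfFiniteType X.hom] : IsGeneric (genericHom X) where
  dense := top_le_genericHom_preimage
  isGenericHom N hN haff := by
    refine ⟨?_, genericHom_injective hN, fun c => ?_⟩
    · exact (X.hom.finiteType_appLE (isAffineOpen_top _) haff le_top).comp
        (.of_surjective _ (Scheme.ΓSpecIso k).symm.commRingCatIsoToRingEquiv.surjective)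
    · have hne : (N : Set X.left).Nonempty := ⟨_, hN (x := default) trivial⟩
      let := ((genericHom X).left.appLE N ⊤ hN).hom.toAlgebra
      have := isFractionRing_genericHom hne haff
      have := hne.to_subtype
      obtain ⟨⟨a, b⟩, h⟩ := IsLocalization.surj (nonZeroDivisors Γ(X.left, N)) c
      -- The fraction a / b is a root of bX - a.
      refine ⟨Polynomial.C b.1 * Polynomial.X - Polynomial.C a, fun h0 => ?_, ?_⟩
      · have h1 := congrArg (Polynomial.coeff · 1) h0
        simp only [Polynomial.coeff_sub, Polynomial.coeff_C_mul, Polynomial.coeff_X_one, mul_one,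
          Polynomial.coeff_C_succ, sub_zero, Polynomial.coeff_zero] at h1
        exact nonZeroDivisors.ne_zero b.2 h1
      · rw [Polynomial.eval₂_sub, Polynomial.eval₂_mul, Polynomial.eval₂_C, Polynomial.eval₂_X,
          Polynomial.eval₂_C, sub_eq_zero, mul_comm]
        exact h

/-- An automorphism extends to the generic point. -/
lemma exists_genericOver_hom (h : X ⟶ X) [IsIso h] :
    ∃ τ : genericOver X ⟶ genericOver X, τ ≫ genericHom X = genericHom X ≫ h := by
  have : IsIso h.left := inferInstanceAs (IsIso ((Over.forget _).map h))
  -- An automorphism fixes the generic point, so its stalk map there is an endomorphism of the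
  -- function field.
  have hs : h.left (genericPoint X.left) = genericPoint X.left :=
    genericPoint_eq_of_isOpenImmersion h.left
  have hτ : (Spec.map (h.left.stalkMap (genericPoint X.left)) ≫
      Spec.map (X.left.presheaf.stalkSpecializes (specializes_of_eq hs))) ≫
      X.left.fromSpecStalk (genericPoint X.left) =
      X.left.fromSpecStalk (genericPoint X.left) ≫ h.left := by
    rw [Category.assoc, Scheme.SpecMap_stalkSpecializes_fromSpecStalk,
      Scheme.SpecMap_stalkMap_fromSpecStalk]
  refine ⟨Over.homMk (U := genericOver X) (V := genericOver X)
    (Spec.map (h.left.stalkMap (genericPoint X.left)) ≫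
      Spec.map (X.left.presheaf.stalkSpecializes (specializes_of_eq hs))) ?_, ?_⟩
  · refine (Category.assoc _ _ _).symm.trans ((congrArg (· ≫ X.hom) hτ).trans ?_)
    exact (Category.assoc _ _ _).trans (congrArg (_ ≫ ·) (Over.w h))
  · exact Over.OverMorphism.ext hτ

end GenericPoint

/-! ### Passage between a scheme and its open subschemes. -/

section Open

open FiniteQuotient

variable {k : CommRingCat.{u}} {T X : Over (Spec k)} {O : X.left.Opens}

lemma exists_comp_incl {e : T ⟶ X} (he : ⊤ ≤ e.left ⁻¹ᵁ O) :
    ∃ e' : T ⟶ opn X O, e' ≫ incl X O = e := by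
  have hr : Set.range e.left ⊆ Set.range O.ι := by
    rintro _ ⟨t, rfl⟩
    rw [Scheme.Opens.range_ι]
    exact he (x := t) trivial
  have h := IsOpenImmersion.lift_fac O.ι e.left hr
  refine ⟨Over.homMk (IsOpenImmersion.lift O.ι e.left hr) ?_, Over.OverMorphism.ext h⟩
  refine (Category.assoc _ _ _).symm.trans ((congrArg (· ≫ X.hom) h).trans (Over.w e))

variable {e' : T ⟶ opn X O}

lemma top_le_preimage_image {N : (opn X O).left.Opens} (hN : ⊤ ≤ e'.left ⁻¹ᵁ N) :
    ⊤ ≤ (e' ≫ incl X O).left ⁻¹ᵁ (O.ι ''ᵁ N) :=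
  fun t ht => ⟨e'.left t, hN ht, rfl⟩

lemma appIso_appLE {N : (opn X O).left.Opens} (hN : ⊤ ≤ e'.left ⁻¹ᵁ N) :
    (O.ι.appIso N).hom ≫ e'.left.appLE N ⊤ hN =
      (e' ≫ incl X O).left.appLE (O.ι ''ᵁ N) ⊤ (top_le_preimage_image hN) := by
  rw [Scheme.Hom.appIso_hom']
  exact Scheme.Hom.appLE_comp_appLE e'.left O.ι _ _ _ _ _

lemma baseToSections_appIso (N : (opn X O).left.Opens) :
    (baseToSections X).app (op (O.ι ''ᵁ N)) ≫ (O.ι.appIso N).hom =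
      (baseToSections (opn X O)).app (op N) := by
  rw [Scheme.Hom.appIso_hom']
  exact baseToSections_appLE (incl X O) (N := O.ι ''ᵁ N) (M := N) _

lemma valueRing_opn (x : (opn X O).left) :
    valueRing e' x = valueRing (e' ≫ incl X O) (O.ι x) := by
  ext c
  constructor
  · rintro ⟨N, hx, hN, s, rfl⟩
    refine ⟨O.ι ''ᵁ N, ⟨x, hx, rfl⟩, top_le_preimage_image hN, (O.ι.appIso N).inv s, ?_⟩
    rw [← appIso_appLE hN]
    exact congrArg (e'.left.appLE N ⊤ hN)
      ((O.ι.appIso N).commRingCatIsoToRingEquiv.apply_symm_apply s)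
  · rintro ⟨N, hx, hN, s, rfl⟩
    refine ⟨O.ι ⁻¹ᵁ N, hx, hN, O.ι.app N s, ?_⟩
    rw [← CommRingCat.comp_apply, Scheme.Hom.app_eq_appLE]
    exact CategoryTheory.congr_fun (Scheme.Hom.appLE_comp_appLE e'.left O.ι _ _ _ _ _) s

lemma IsGeneric.of_comp_incl (he : IsGeneric (e' ≫ incl X O)) : IsGeneric e' where
  dense N hN t ht := by
    obtain ⟨x, hx⟩ := hN
    obtain ⟨y, hy, hyt⟩ := he.dense (O.ι ''ᵁ N) ⟨O.ι x, x, hx, rfl⟩ ht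
    have : y = e'.left t := O.ι.isOpenEmbedding.injective hyt
    exact (this ▸ hy : e'.left t ∈ N)
  isGenericHom N hN haff := by
    obtain ⟨h1, h2, h3⟩ := he.isGenericHom (O.ι ''ᵁ N) (top_le_preimage_image hN)
      (haff.image_of_isOpenImmersion O.ι)
    rw [← appIso_appLE hN] at h2 h3
    have hinj : Function.Injective (O.ι.appIso N).hom.hom :=
      (O.ι.appIso N).commRingCatIsoToRingEquiv.injective
    refine ⟨?_, ?_, fun c => ?_⟩
    · rw [← baseToSections_appIso]
      exact (RingHom.FiniteType.of_surjective _
        (O.ι.appIso N).commRingCatIsoToRingEquiv.surjective).comp h1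
    · intro a b hab
      obtain ⟨a, rfl⟩ := (O.ι.appIso N).commRingCatIsoToRingEquiv.surjective a
      obtain ⟨b, rfl⟩ := (O.ι.appIso N).commRingCatIsoToRingEquiv.surjective b
      exact congrArg _ (h2 hab)
    · obtain ⟨P, hP, hc⟩ := h3 c
      refine ⟨P.map (O.ι.appIso N).hom.hom, (Polynomial.map_ne_zero_iff hinj).2 hP, ?_⟩
      rw [Polynomial.eval₂_map]
      exact hc

lemma isRegularLocalRing_opn (x : (opn X O).left)
    (hx : IsRegularLocalRing (X.left.presheaf.stalk (O.ι x))) :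
    IsRegularLocalRing ((opn X O).left.presheaf.stalk x) :=
  have : IsRegularLocalRing (X.left.presheaf.stalk x.1) := hx
  .of_ringEquiv (O.stalkIso x).symm.commRingCatIsoToRingEquiv

end Open

end DiffForms

end

noncomputable section

/-! ### Quotients at the generic point -/

namespace DiffForms

attribute [local instance] algebraSections

lemma exists_primeIdealOf_eq {X : Scheme.{u}} {N : X.Opens} (hN : IsAffineOpen N)
    (P : PrimeSpectrum Γ(X, N)) : ∃ (x : X) (hx : x ∈ N), hN.primeIdealOf ⟨x, hx⟩ = P := by
  have hx : hN.fromSpec P ∈ N := by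
    have := Set.mem_range_self (f := hN.fromSpec) P
    rwa [hN.range_fromSpec] at this
  exact ⟨_, hx, hN.fromSpec.isOpenEmbedding.injective (hN.fromSpec_primeIdealOf ⟨_, hx⟩)⟩

lemma specializes_of_primeIdealOf_le {X : Scheme.{u}} {N : X.Opens} (hN : IsAffineOpen N) {x y : X}
    (hx : x ∈ N) (hy : y ∈ N)
    (h : (hN.primeIdealOf ⟨x, hx⟩).asIdeal ≤ (hN.primeIdealOf ⟨y, hy⟩).asIdeal) : x ⤳ y := by
  have h1 := ((PrimeSpectrum.le_iff_specializes _ _).1 h).map hN.fromSpec.continuous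
  rwa [hN.fromSpec_primeIdealOf, hN.fromSpec_primeIdealOf] at h1

/-- Bridge from geometry to algebra: on an affine open set, regularity at a point becomes regularity
along `locRing` of the corresponding prime. -/
lemma valueRing_eq_locRing {k : CommRingCat.{u}} {T X : Over (Spec k)} {e : T ⟶ X}
    (hT : IsField Γ(T.left, ⊤)) (he : IsGeneric e) {N : X.left.Opens} (haff : IsAffineOpen N)
    (hN : ⊤ ≤ e.left ⁻¹ᵁ N) {x : X.left} (hx : x ∈ N) :
    let := hT.toField
    let := (e.left.appLE N ⊤ hN).hom.toAlgebra
    valueRing e x = locRing Γ(T.left, ⊤) (haff.primeIdealOf ⟨x, hx⟩).asIdeal := by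
  intro _ _
  ext c
  refine (mem_valueRing_iff haff hN he.dense hx).trans ?_
  constructor
  · rintro ⟨a, h, hh, hc⟩
    have h0 : e.left.appLE N ⊤ hN h ≠ 0 := fun h0 => hh (by
      rw [(he.isGenericHom N hN haff).injective (h0.trans (map_zero _).symm)]
      exact zero_mem _)
    exact ⟨a, h, hh, h0, (eq_div_iff h0).2 hc⟩
  · rintro ⟨a, h, hh, h0, rfl⟩
    exact ⟨a, h, hh, div_mul_cancel₀ _ h0⟩

/-- The form `ω` at the generic point is regular at `x`. -/
def IsRegularAt {k : CommRingCat.{u}} {T X : Over (Spec k)} (e : T ⟶ X) (x : X.left) {p : ℕ}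
    (ω : NaiveForms T ⊤ p) : Prop :=
  ω ∈ regularForms k (valueRing e x) p

section

variable {K : Type u} [Field K] {T X : Over (Spec (CommRingCat.of K))} {e : T ⟶ X}
  {N : X.left.Opens} {p : ℕ} {ω : NaiveForms T ⊤ p}

lemma isRegularAt_iff (hT : IsField Γ(T.left, ⊤)) (he : IsGeneric e) (haff : IsAffineOpen N)
    (hN : ⊤ ≤ e.left ⁻¹ᵁ N) {x : X.left} (hx : x ∈ N) :
    let := hT.toField
    let := (e.left.appLE N ⊤ hN).hom.toAlgebra
    let : Algebra K Γ(T.left, ⊤) := algebraSections T ⊤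
    IsRegularAt e x ω ↔
      ω ∈ regularForms K (locRing Γ(T.left, ⊤) (haff.primeIdealOf ⟨x, hx⟩).asIdeal) p := by
  intro _ _ _
  have h := valueRing_eq_locRing hT he haff hN hx
  rw [← h]
  rfl

lemma forall_mem_regularForms_locRing (hT : IsField Γ(T.left, ⊤)) (he : IsGeneric e) (haff : IsAffineOpen N)
    (hN : ⊤ ≤ e.left ⁻¹ᵁ N) (hω : ∀ x ∈ N, IsRegularAt e x ω) :
    let := hT.toField
    let := (e.left.appLE N ⊤ hN).hom.toAlgebra
    let : Algebra K Γ(T.left, ⊤) := algebraSections T ⊤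
    ∀ (q : Ideal Γ(X.left, N)) [q.IsPrime],
      ω ∈ regularForms K (locRing Γ(T.left, ⊤) q) p := by
  intro _ _ _ q hq
  obtain ⟨z, hz, h⟩ := exists_primeIdealOf_eq haff ⟨q, hq⟩
  have h2 := (isRegularAt_iff hT he haff hN hz).1 (hω z hz)
  generalize haff.primeIdealOf ⟨z, hz⟩ = P at h h2
  subst h
  exact h2

end

lemma forall_isRegularLocalRing_localization {X : Scheme.{u}} {N : X.Opens} (hN : IsAffineOpen N)
    (hX : ∀ x ∈ N, IsRegularLocalRing (X.presheaf.stalk x)) (q : Ideal Γ(X, N)) [hq : q.IsPrime] :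
    IsRegularLocalRing (Localization.AtPrime q) := by
  obtain ⟨z, hz, h⟩ := exists_primeIdealOf_eq hN ⟨q, hq⟩
  have := hX z hz
  have h1 : IsRegularLocalRing (Localization.AtPrime (hN.primeIdealOf ⟨z, hz⟩).asIdeal) :=
    .of_ringEquiv (stalkRingEquiv hN hz)
  generalize hN.primeIdealOf ⟨z, hz⟩ = P at h h1
  subst h
  exact h1

end DiffForms

/-! ### The quotient map on affine opens and the algebraic criteria translated to schemes. -/

namespace FiniteQuotient

open DiffForms

attribute [local instance] algebraSections

section Action

variable {k : CommRingCat.{u}} {G : Type*} [Group G] {V Q : Over (Spec k)} {a : RightAction G V}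
  {f : V ⟶ Q}

lemma aut_one (a : RightAction G V) : a.aut 1 = 𝟙 V :=
  congrArg (fun t => (MulOpposite.unop t).hom) (map_one a)

lemma aut_mul (a : RightAction G V) (g h : G) : a.aut (g * h) = a.aut g ≫ a.aut h :=
  congrArg (fun t => (MulOpposite.unop t).hom) (map_mul a g h)

/-- The action of `G` on the functions on an invariant open subset. -/
abbrev sectionsAction (hf : IsInvariant a f) (N : Q.left.Opens) :
    MulSemiringAction G Γ(V.left, f.left ⁻¹ᵁ N) where
  smul g s := (a.aut g).left.appLE (f.left ⁻¹ᵁ N) (f.left ⁻¹ᵁ N) (hf.le g N) s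
  one_smul s := by
    have key : ∀ (h : V ⟶ V) (_ : h = 𝟙 V) (e : f.left ⁻¹ᵁ N ≤ h.left ⁻¹ᵁ (f.left ⁻¹ᵁ N)),
        h.left.appLE (f.left ⁻¹ᵁ N) (f.left ⁻¹ᵁ N) e s = s := by
      rintro _ rfl e
      change (𝟙 V.left : V.left ⟶ V.left).appLE _ _ _ s = s
      simp only [Scheme.Hom.appLE, Scheme.Hom.id_app]
      exact (congrArg (V.left.presheaf.map (homOfLE e).op) rfl).trans
        (CategoryTheory.congr_fun (V.left.presheaf.map_id _) s)
    exact key _ (aut_one a) _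
  mul_smul g h s := by
    have key : ∀ (t : V ⟶ V) (_ : t = a.aut g ≫ a.aut h)
        (e : f.left ⁻¹ᵁ N ≤ t.left ⁻¹ᵁ (f.left ⁻¹ᵁ N)),
        t.left.appLE (f.left ⁻¹ᵁ N) (f.left ⁻¹ᵁ N) e s =
          (a.aut g).left.appLE (f.left ⁻¹ᵁ N) (f.left ⁻¹ᵁ N) (hf.le g N)
            ((a.aut h).left.appLE (f.left ⁻¹ᵁ N) (f.left ⁻¹ᵁ N) (hf.le h N) s) := by
      rintro _ rfl e
      exact (CategoryTheory.congr_fun (Scheme.Hom.appLE_comp_appLE (a.aut g).left (a.aut h).left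
        _ _ _ _ _) s).symm
    exact key _ (aut_mul a g h) _
  smul_zero g := map_zero ((a.aut g).left.appLE _ _ _).hom
  smul_add g := map_add ((a.aut g).left.appLE _ _ _).hom
  smul_one g := map_one ((a.aut g).left.appLE _ _ _).hom
  smul_mul g := map_mul ((a.aut g).left.appLE _ _ _).hom

lemma IsQuotient.isInvariant (hf : IsQuotient a f) (N : Q.left.Opens) :
    let := sectionsAction hf.invariant N
    let := (f.left.app N).hom.toAlgebra
    Algebra.IsInvariant Γ(Q.left, N) Γ(V.left, f.left ⁻¹ᵁ N) G :=
  let := sectionsAction hf.invariant N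
  let := (f.left.app N).hom.toAlgebra
  ⟨fun _ hb => (hf.range_eq N).ge hb⟩

lemma IsQuotient.smulCommClass (hf : IsQuotient a f) (N : Q.left.Opens) :
    let := sectionsAction hf.invariant N
    let := (f.left.app N).hom.toAlgebra
    SMulCommClass G Γ(Q.left, N) Γ(V.left, f.left ⁻¹ᵁ N) :=
  let := sectionsAction hf.invariant N
  let := (f.left.app N).hom.toAlgebra
  ⟨fun g c b => by
    have hc : g • algebraMap Γ(Q.left, N) Γ(V.left, f.left ⁻¹ᵁ N) c = algebraMap _ _ c :=
      (hf.range_eq N).le ⟨c, rfl⟩ g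
    rw [Algebra.smul_def, Algebra.smul_def, smul_mul', hc]⟩

lemma IsQuotient.faithfulSMul (hf : IsQuotient a f) (N : Q.left.Opens) :
    let := (f.left.app N).hom.toAlgebra
    FaithfulSMul Γ(Q.left, N) Γ(V.left, f.left ⁻¹ᵁ N) :=
  let := (f.left.app N).hom.toAlgebra
  (faithfulSMul_iff_algebraMap_injective _ _).2 (hf.injective N)

/-- If the preimage were empty, its ring of functions would be zero and injectivity would give 1 = 0
on N. -/
lemma IsQuotient.nonempty_preimage (hf : IsQuotient a f) {N : Q.left.Opens}
    (hN : (N : Set Q.left).Nonempty) : ((f.left ⁻¹ᵁ N : V.left.Opens) : Set V.left).Nonempty := by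
  by_contra hcon
  have h0 : f.left ⁻¹ᵁ N = ⊥ := TopologicalSpace.Opens.ext (Set.not_nonempty_iff_eq_empty.1 hcon)
  have : Subsingleton Γ(V.left, f.left ⁻¹ᵁ N) := by
    rw [h0]; exact inferInstance
  have h1 : (1 : Γ(Q.left, N)) = 0 := hf.injective N (Subsingleton.elim _ _)
  obtain ⟨x, hx⟩ := hN
  have h2 : x ∈ Q.left.basicOpen (1 : Γ(Q.left, N)) := by
    rw [Scheme.basicOpen_one]; exact hx
  rw [h1, Scheme.basicOpen_zero] at h2
  exact h2

end Action

section Generic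

variable {K : Type u} [Field K] {G : Type*} [Group G] [Finite G]
  {V Q : Over (Spec (CommRingCat.of K))} [IsIntegral V.left] [LocallyOfFiniteType V.hom]
  {a : RightAction G V} {f : V ⟶ Q}

/-- The functions on an affine open of Q are of finite type by Noether's theorem, and those upstairs
are integral over them. So the function field of V serves as a generic point of Q too, and forms on
both schemes are compared in one ⋀^p Ω_L. -/
lemma IsQuotient.isGeneric (hf : IsQuotient a f) : IsGeneric (genericHom V ≫ f) where
  dense N hN := top_le_genericHom_preimage _ (hf.nonempty_preimage hN)
  isGenericHom N hN haff := by
    have := hf.isAffineHom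
    have haff' : IsAffineOpen (f.left ⁻¹ᵁ N) := haff.preimage f.left
    have hN' : ⊤ ≤ (genericHom V).left ⁻¹ᵁ (f.left ⁻¹ᵁ N) := hN
    obtain ⟨h1, h2, h3⟩ := isGeneric_genericHom.isGenericHom _ hN' haff'
    have hcomp : (genericHom V ≫ f).left.appLE N ⊤ hN =
        f.left.app N ≫ (genericHom V).left.appLE (f.left ⁻¹ᵁ N) ⊤ hN' := by
      rw [Scheme.Hom.app_eq_appLE]
      exact (Scheme.Hom.appLE_comp_appLE (genericHom V).left f.left _ _ _ _ _).symm
    let := sectionsAction hf.invariant N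
    let := (f.left.app N).hom.toAlgebra
    let := ((genericHom V).left.appLE (f.left ⁻¹ᵁ N) ⊤ hN').hom.toAlgebra
    let : Algebra K Γ(Q.left, N) := algebraSections Q N
    let : Algebra K Γ(V.left, f.left ⁻¹ᵁ N) :=
      algebraSections V (f.left ⁻¹ᵁ N)
    have : IsScalarTower K Γ(Q.left, N) Γ(V.left, f.left ⁻¹ᵁ N) :=
      .of_algebraMap_eq' (congrArg CommRingCat.Hom.hom (baseToSections_comp f (op N)))
    have := hf.isInvariant N
    have := hf.smulCommClass N
    have := hf.faithfulSMul N
    have : Algebra.FiniteType K Γ(V.left, f.left ⁻¹ᵁ N) := h1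
    have : Algebra.FiniteType K Γ(Q.left, N) :=
      Algebra.IsInvariant.finiteType K Γ(Q.left, N) Γ(V.left, f.left ⁻¹ᵁ N) G
    rw [hcomp]
    refine ⟨this, h2.comp (hf.injective N), fun c => ?_⟩
    have : Nonempty (f.left ⁻¹ᵁ N : V.left.Opens) := ⟨⟨_, hN' (x := default) trivial⟩⟩
    have : IsDomain Γ(Q.left, N) := (hf.injective N).isDomain (f.left.app N).hom
    have := Algebra.IsInvariant.isIntegral Γ(Q.left, N) Γ(V.left, f.left ⁻¹ᵁ N) G
    let := (f.left.app N ≫ (genericHom V).left.appLE (f.left ⁻¹ᵁ N) ⊤ hN').hom.toAlgebra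
    have : IsScalarTower Γ(Q.left, N) Γ(V.left, f.left ⁻¹ᵁ N) Γ((genericOver V).left, ⊤) :=
      .of_algebraMap_eq' rfl
    have hc : IsAlgebraic Γ(V.left, f.left ⁻¹ᵁ N) c := h3 c
    obtain ⟨P, hP, h⟩ := hc.restrictScalars Γ(Q.left, N)
    exact ⟨P, hP, h⟩

variable [CharZero K] {p : ℕ} {N : Q.left.Opens} {ω : NaiveForms (genericOver V) ⊤ p}

/-- A form that is regular on the regular part of the quotient is regular upstairs. -/
lemma IsQuotient.mem_regularForms_of_quotient (hf : IsQuotient a f) (haff : IsAffineOpen N)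
    (hV : ∀ x, IsRegularLocalRing (V.left.presheaf.stalk x)) (U : Q.left.Opens)
    (hU : ∀ x, x ∉ U → 2 ≤ ringKrullDim (Q.left.presheaf.stalk x))
    (hω : ∀ x ∈ N, x ∈ U → IsRegularAt (genericHom V ≫ f) x ω) {y : V.left}
    (hy : y ∈ f.left ⁻¹ᵁ N) : IsRegularAt (genericHom V) y ω := by
  have := hf.isAffineHom
  have haff' : IsAffineOpen (f.left ⁻¹ᵁ N) := haff.preimage f.left
  have hN' : ⊤ ≤ (genericHom V).left ⁻¹ᵁ (f.left ⁻¹ᵁ N) := top_le_genericHom_preimage _ ⟨y, hy⟩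
  have hN : ⊤ ≤ (genericHom V ≫ f).left ⁻¹ᵁ N := hN'
  have hcomp : f.left.app N ≫ (genericHom V).left.appLE (f.left ⁻¹ᵁ N) ⊤ hN' =
      (genericHom V ≫ f).left.appLE N ⊤ hN := by
    rw [Scheme.Hom.app_eq_appLE]
    exact Scheme.Hom.appLE_comp_appLE (genericHom V).left f.left _ _ _ _ _
  let := (isField_genericOver V).toField
  let := sectionsAction hf.invariant N
  let := (f.left.app N).hom.toAlgebra
  let := ((genericHom V).left.appLE (f.left ⁻¹ᵁ N) ⊤ hN').hom.toAlgebra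
  let := ((genericHom V ≫ f).left.appLE N ⊤ hN).hom.toAlgebra
  let : Algebra K Γ(Q.left, N) := algebraSections Q N
  let : Algebra K Γ(V.left, f.left ⁻¹ᵁ N) :=
      algebraSections V (f.left ⁻¹ᵁ N)
  let : Algebra K Γ((genericOver V).left, ⊤) := algebraSections (genericOver V) ⊤
  have : IsScalarTower K Γ(V.left, f.left ⁻¹ᵁ N) Γ((genericOver V).left, ⊤) :=
    .of_algebraMap_eq' (congrArg CommRingCat.Hom.hom (baseToSections_appLE (genericHom V) hN')).symm
  have : IsScalarTower Γ(Q.left, N) Γ(V.left, f.left ⁻¹ᵁ N) Γ((genericOver V).left, ⊤) :=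
    .of_algebraMap_eq' (congrArg CommRingCat.Hom.hom hcomp).symm
  have := hf.isInvariant N
  have := hf.smulCommClass N
  have := hf.faithfulSMul N
  have : Nonempty (f.left ⁻¹ᵁ N : V.left.Opens) := ⟨⟨y, hy⟩⟩
  have : IsFractionRing Γ(V.left, f.left ⁻¹ᵁ N) Γ((genericOver V).left, ⊤) :=
    isFractionRing_genericHom ⟨y, hy⟩ haff'
  have : Algebra.FiniteType K Γ(V.left, f.left ⁻¹ᵁ N) :=
    (isGeneric_genericHom.isGenericHom _ hN' haff').finiteType
  have : Algebra.FiniteType K Γ(Q.left, N) := (hf.isGeneric.isGenericHom _ hN haff).finiteType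
  have : IsNoetherianRing Γ(Q.left, N) := Algebra.FiniteType.isNoetherianRing K _
  have := Algebra.IsInvariant.hasGoingDown Γ(Q.left, N) Γ(V.left, f.left ⁻¹ᵁ N) G
  refine (isRegularAt_iff (isField_genericOver V) isGeneric_genericHom haff' hN' hy).2 ?_
  refine mem_regularForms_locRing_of_quotient (k := K) (A := Γ(Q.left, N))
    (B := Γ(V.left, f.left ⁻¹ᵁ N)) (L := Γ((genericOver V).left, ⊤))
    (forall_isRegularLocalRing_localization haff' fun y _ => hV y)
    {P | ∃ (x : Q.left) (hx : x ∈ N), x ∈ U ∧ haff.primeIdealOf ⟨x, hx⟩ = P} (fun P hP => ?_) ?_ _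
  · obtain ⟨x, hx, rfl⟩ := exists_primeIdealOf_eq haff P
    rw [← ringKrullDim_eq_of_ringEquiv (stalkRingEquiv haff hx)]
    exact hU x fun hxU => hP ⟨x, hx, hxU, rfl⟩
  · rintro _ ⟨x, hx, hxU, rfl⟩
    exact (isRegularAt_iff (isField_genericOver V) hf.isGeneric haff hN hx).1 (hω x hx hxU)

/-- An invariant regular form is regular on the regular part of the quotient. -/
lemma IsQuotient.mem_regularForms_of_invariant (hf : IsQuotient a f) (haff : IsAffineOpen N)
    (hV : ∀ x, IsRegularLocalRing (V.left.presheaf.stalk x))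
    (τ : G → (genericOver V ⟶ genericOver V))
    (hτ : ∀ g, τ g ≫ genericHom V = genericHom V ≫ a.aut g)
    (hinv : ∀ g, naiveEval (τ g) (N := ⊤) le_top ω = ω)
    (hω : ∀ y ∈ f.left ⁻¹ᵁ N, IsRegularAt (genericHom V) y ω) {x : Q.left}
    (hx : x ∈ N) (hreg : ∀ z, z ⤳ x → IsRegularLocalRing (Q.left.presheaf.stalk z)) :
    IsRegularAt (genericHom V ≫ f) x ω := by
  have := hf.isAffineHom
  have haff' : IsAffineOpen (f.left ⁻¹ᵁ N) := haff.preimage f.left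
  have hne := hf.nonempty_preimage ⟨x, hx⟩
  have hN' : ⊤ ≤ (genericHom V).left ⁻¹ᵁ (f.left ⁻¹ᵁ N) := top_le_genericHom_preimage _ hne
  have hN : ⊤ ≤ (genericHom V ≫ f).left ⁻¹ᵁ N := hN'
  have hcomp : f.left.app N ≫ (genericHom V).left.appLE (f.left ⁻¹ᵁ N) ⊤ hN' =
      (genericHom V ≫ f).left.appLE N ⊤ hN := by
    rw [Scheme.Hom.app_eq_appLE]
    exact Scheme.Hom.appLE_comp_appLE (genericHom V).left f.left _ _ _ _ _
  let := (isField_genericOver V).toField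
  let := sectionsAction hf.invariant N
  let := (f.left.app N).hom.toAlgebra
  let := ((genericHom V).left.appLE (f.left ⁻¹ᵁ N) ⊤ hN').hom.toAlgebra
  let := ((genericHom V ≫ f).left.appLE N ⊤ hN).hom.toAlgebra
  let : Algebra K Γ(Q.left, N) := algebraSections Q N
  let : Algebra K Γ(V.left, f.left ⁻¹ᵁ N) :=
      algebraSections V (f.left ⁻¹ᵁ N)
  let : Algebra K Γ((genericOver V).left, ⊤) := algebraSections (genericOver V) ⊤
  have : IsScalarTower K Γ(Q.left, N) Γ(V.left, f.left ⁻¹ᵁ N) :=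
    .of_algebraMap_eq' (congrArg CommRingCat.Hom.hom (baseToSections_comp f (op N)))
  have : IsScalarTower K Γ(V.left, f.left ⁻¹ᵁ N) Γ((genericOver V).left, ⊤) :=
    .of_algebraMap_eq' (congrArg CommRingCat.Hom.hom (baseToSections_appLE (genericHom V) hN')).symm
  have : IsScalarTower K Γ(Q.left, N) Γ((genericOver V).left, ⊤) :=
    .of_algebraMap_eq' (congrArg CommRingCat.Hom.hom
      (baseToSections_appLE (genericHom V ≫ f) hN)).symm
  have : IsScalarTower Γ(Q.left, N) Γ(V.left, f.left ⁻¹ᵁ N) Γ((genericOver V).left, ⊤) :=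
    .of_algebraMap_eq' (congrArg CommRingCat.Hom.hom hcomp).symm
  have := hf.isInvariant N
  have := hf.smulCommClass N
  have := hf.faithfulSMul N
  have : Nonempty (f.left ⁻¹ᵁ N : V.left.Opens) := hne.to_subtype
  have : IsDomain Γ(Q.left, N) := (hf.injective N).isDomain (f.left.app N).hom
  have : IsFractionRing Γ(V.left, f.left ⁻¹ᵁ N) Γ((genericOver V).left, ⊤) :=
    isFractionRing_genericHom hne haff'
  have : Algebra.FiniteType K Γ(V.left, f.left ⁻¹ᵁ N) :=
    (isGeneric_genericHom.isGenericHom _ hN' haff').finiteType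
  refine (isRegularAt_iff (isField_genericOver V) hf.isGeneric haff hN hx).2 ?_
  refine mem_regularForms_locRing_of_invariant (k := K) (A := Γ(Q.left, N)) (G := G)
    (B := Γ(V.left, f.left ⁻¹ᵁ N)) (L := Γ((genericOver V).left, ⊤))
    (forall_isRegularLocalRing_localization haff' fun y _ => hV y)
    (fun g => ((τ g).left.appLE ⊤ ⊤ le_top).hom) (fun g b => ?_)
    (fun g => naiveEval (τ g) (N := ⊤) le_top) (fun g c x => ?_) hinv
    (forall_mem_regularForms_locRing (isField_genericOver V) isGeneric_genericHom haff' hN' hω) _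
    (fun P hP hle => ?_)
  -- The action on L extends the action on functions because `τ g` lies over the automorphism `a.aut
  -- g`.
  · have h1 := Scheme.Hom.appLE_comp_appLE (τ g).left (genericHom V).left (f.left ⁻¹ᵁ N) ⊤ ⊤ hN'
      le_top
    have h2 := Scheme.Hom.appLE_comp_appLE (genericHom V).left (a.aut g).left (f.left ⁻¹ᵁ N)
      (f.left ⁻¹ᵁ N) ⊤ (hf.invariant.le g N) hN'
    have key : ∀ (t t' : genericOver V ⟶ V) (_ : t = t') (h : ⊤ ≤ t.left ⁻¹ᵁ (f.left ⁻¹ᵁ N))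
        (h' : ⊤ ≤ t'.left ⁻¹ᵁ (f.left ⁻¹ᵁ N)), t.left.appLE _ ⊤ h = t'.left.appLE _ ⊤ h' := by
      rintro t _ rfl h h'
      rfl
    exact CategoryTheory.congr_fun (h1.trans ((key _ _ (hτ g) _ _).trans h2.symm)) b
  · exact naiveEval_mkForm (τ g) le_top c x
  -- Primes below that of x correspond to generizations of x, where regularity is assumed.
  · obtain ⟨z, hz, h⟩ := exists_primeIdealOf_eq haff ⟨P, hP⟩
    have key : ∀ (P : PrimeSpectrum Γ(Q.left, N)), haff.primeIdealOf ⟨z, hz⟩ = P →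
        P.asIdeal ≤ (haff.primeIdealOf ⟨x, hx⟩).asIdeal →
        IsRegularLocalRing (Localization.AtPrime P.asIdeal) := by
      rintro _ rfl hle
      have := hreg z (specializes_of_primeIdealOf_le haff hz hx hle)
      exact .of_ringEquiv (stalkRingEquiv haff hz)
    exact key _ h hle

end Generic

end FiniteQuotient

end

noncomputable section

/-! ### Morphisms of modules from sections -/

namespace SchemeModules

variable {X : Scheme.{u}} {M N F : X.Modules}

/-- An empty set is covered by the empty family. This settles opens that do not contain the generic
point. -/
lemma subsingleton_sections {D : X.Opens} (hD : ¬ (D : Set X).Nonempty) :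
    Subsingleton Γ(M, D) where
  allEq s t := TopCat.Sheaf.eq_of_locally_eq' ⟨M.presheaf, M.isSheaf⟩ (fun _ : D => D) D
    (fun _ => 𝟙 D) (fun _ hx => (hD ⟨_, hx⟩).elim) s t fun x => (hD ⟨x.1, x.2⟩).elim

lemma mono_of_injective {β : N ⟶ F} (hβ : ∀ D, Function.Injective (β.app D)) : Mono β where
  right_cancellation g h hgh := by
    refine Scheme.Modules.hom_ext _ _ fun D => ?_
    ext s
    refine hβ D ?_
    exact CategoryTheory.congr_fun (congrArg (fun t => Scheme.Modules.Hom.app t D) hgh) s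

/-- A morphism factors through a sectionwise injective one if its sections do. -/
lemma exists_comp_eq (α : M ⟶ F) {β : N ⟶ F} (hβ : ∀ D, Function.Injective (β.app D))
    (h : ∀ D s, ∃ t, β.app D t = α.app D s) : ∃ ψ : M ⟶ N, ψ ≫ β = α := by
  choose t ht using h
  let ψ : M.val ⟶ N.val :=
    { app := fun D => ModuleCat.ofHom (X := M.val.obj D) (Y := N.val.obj D)
        { toFun := t D.unop
          map_add' := fun x y => hβ D.unop (by
            refine (ht _ _).trans (Eq.trans ?_ (map_add (β.app D.unop).hom _ _).symm)
            refine (map_add (α.app D.unop).hom x y).trans ?_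
            exact congrArg₂ (· + ·) (ht _ _).symm (ht _ _).symm)
          map_smul' := fun r x => hβ D.unop (by
            refine (ht _ _).trans (Eq.trans ?_ (Scheme.Modules.Hom.app_smul β r _).symm)
            refine (Scheme.Modules.Hom.app_smul α r x).trans ?_
            exact congrArg (fun z : Γ(F, D.unop) => (show Γ(X, D.unop) from r) • z) (ht _ _).symm) }
      naturality := fun {D E} i => by
        ext x
        refine hβ E.unop ?_
        refine (ht _ _).trans ?_
        refine (NatTrans.naturality_apply α.mapPresheaf i x).trans ?_
        refine (congrArg (F.presheaf.map i) (ht _ _).symm).trans ?_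
        exact (NatTrans.naturality_apply β.mapPresheaf i _).symm }
  refine ⟨Scheme.Modules.fullyFaithfulToPresheafOfModules.preimage ψ, ?_⟩
  refine Scheme.Modules.hom_ext _ _ fun D => ?_
  ext s
  exact ht D s

end SchemeModules

/-! ### Generic values under composition, the group action, restriction and pullback. -/

namespace DiffForms

attribute [local instance] algebraSections

variable {k : CommRingCat.{u}} {T T' X : Over (Spec k)} {p : ℕ}

lemma naiveEval_comp (τ : T' ⟶ T) (e : T ⟶ X) {N : X.left.Opens} (hN : ⊤ ≤ e.left ⁻¹ᵁ N)
    (hN' : ⊤ ≤ (τ ≫ e).left ⁻¹ᵁ N) (m : NaiveForms X N p) :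
    naiveEval (τ ≫ e) hN' m = naiveEval τ (N := ⊤) le_top (naiveEval e hN m) := by
  have : naiveEval (τ ≫ e) hN' = (naiveEval τ (N := ⊤) le_top).comp (naiveEval (p := p) e hN) :=
    exteriorPower_addHom_ext fun r x => by
      refine (naiveEval_mkForm _ _ _ _).trans ?_
      rw [AddMonoidHom.comp_apply]
      refine Eq.trans ?_ (congrArg _ (naiveEval_mkForm _ _ _ _).symm)
      refine Eq.trans ?_ (naiveEval_mkForm _ _ _ _).symm
      have h : ⊤ ≤ τ.left ⁻¹ᵁ (⊤ : T.left.Opens) := fun _ _ => trivial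
      have : ∀ c, τ.left.appLE ⊤ ⊤ h (e.left.appLE N ⊤ hN c) =
          (τ ≫ e).left.appLE N ⊤ hN' c := fun c =>
        CategoryTheory.congr_fun (Scheme.Hom.appLE_comp_appLE τ.left e.left N ⊤ ⊤ hN h) c
      simp only [this]
  rw [this]
  rfl

lemma eval_comp [Unique T.left] [Unique T'.left] (τ : T' ⟶ T) (e : T ⟶ X) {N : X.left.Opens}
    (hN : ⊤ ≤ e.left ⁻¹ᵁ N) (hN' : ⊤ ≤ (τ ≫ e).left ⁻¹ᵁ N) (s : Γ(forms X p, N)) :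
    eval (τ ≫ e) hN' s = naiveEval τ (N := ⊤) le_top (eval e hN s) := by
  obtain ⟨N', h, i, m, hm, hs⟩ := exists_eval_eq e hN s
  have h' : ⊤ ≤ (τ ≫ e).left ⁻¹ᵁ N' := fun x _ => h (x := τ.left x) trivial
  rw [hs, ← eval_map (τ ≫ e) hN' h' i, ← hm, eval_sec, naiveEval_comp τ e h]

end DiffForms

namespace FiniteQuotient

open DiffForms

attribute [local instance] algebraSections

variable {k : CommRingCat.{u}} {G : Type*} [Group G] {V Q : Over (Spec k)} {a : RightAction G V}
  {f : V ⟶ Q} {p : ℕ} {T : Over (Spec k)} [Unique T.left]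

/-- On generic values the action of g is pullback along τ, its lift to the generic point, so
invariance becomes a condition inside ⋀^p Ω_L. -/
lemma eval_actForms (hf : IsInvariant a f) (g : G) {e : T ⟶ V} {τ : T ⟶ T}
    (hτ : τ ≫ e = e ≫ a.aut g) {D : Q.left.Opens} (hD : ⊤ ≤ e.left ⁻¹ᵁ (f.left ⁻¹ᵁ D))
    (s : Γ(forms V p, f.left ⁻¹ᵁ D)) :
    eval e hD ((actForms hf p g).app D s) = naiveEval τ (N := ⊤) le_top (eval e hD s) := by
  have hD' : ⊤ ≤ e.left ⁻¹ᵁ ((a.aut g).left ⁻¹ᵁ (f.left ⁻¹ᵁ D)) := fun x hx =>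
    hf.le g D (hD hx)
  have hτD : ⊤ ≤ (τ ≫ e).left ⁻¹ᵁ (f.left ⁻¹ᵁ D) := fun x _ => hD (x := τ.left x) trivial
  refine (eval_map e hD' hD (homOfLE (hf.le g D)) ((forms.pullback (a.aut g) p).app _ s)).trans ?_
  rw [eval_pullback e (a.aut g) (τ ≫ e) hτ.symm hD' hτD, eval_comp]

/-- This and `eval_pullbackOnOpen` show that neither map into f_* w_* Ω^p_W changes the generic
value, so sections from both sides can be matched by value. -/
lemma eval_restrictToOpen {U : Q.left.Opens} {e : T ⟶ V} {e' : T ⟶ opn V (f.left ⁻¹ᵁ U)}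
    (he : e' ≫ incl V (f.left ⁻¹ᵁ U) = e) {D : Q.left.Opens}
    (hD : ⊤ ≤ e.left ⁻¹ᵁ (f.left ⁻¹ᵁ D))
    (hD' : ⊤ ≤ e'.left ⁻¹ᵁ ((incl V (f.left ⁻¹ᵁ U)).left ⁻¹ᵁ (f.left ⁻¹ᵁ D)))
    (s : Γ(forms V p, f.left ⁻¹ᵁ D)) :
    eval e' hD' ((restrictToOpen f U p).app D s) = eval e hD s :=
  eval_pullback e' (incl V (f.left ⁻¹ᵁ U)) e he hD' hD s

lemma eval_pullbackOnOpen {U : Q.left.Opens} {e' : T ⟶ opn V (f.left ⁻¹ᵁ U)} {e'' : T ⟶ opn Q U}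
    (he : e' ≫ resHom f U = e'') {D : Q.left.Opens}
    (hD : ⊤ ≤ e''.left ⁻¹ᵁ ((incl Q U).left ⁻¹ᵁ D))
    (hD' : ⊤ ≤ e'.left ⁻¹ᵁ ((incl V (f.left ⁻¹ᵁ U)).left ⁻¹ᵁ (f.left ⁻¹ᵁ D)))
    (s : Γ(forms (opn Q U) p, (incl Q U).left ⁻¹ᵁ D)) :
    eval e' hD' ((pullbackOnOpen f U p).app D s) = eval e'' hD s := by
  have hD2 : ⊤ ≤ e'.left ⁻¹ᵁ ((resHom f U).left ⁻¹ᵁ ((incl Q U).left ⁻¹ᵁ D)) := by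
    subst he; exact hD
  refine Eq.trans ?_ (eval_pullback e' (resHom f U) e'' he hD2 hD s)
  refine eval_map e' hD2 hD' (eqToHom ?_) ((forms.pullback (resHom f U) p).app _ s)
  rw [← Scheme.Hom.comp_preimage, ← Scheme.Hom.comp_preimage, resHom_comp_incl]

end FiniteQuotient

end

noncomputable section

/-! ### Forms on the quotient and invariant forms -/

namespace FiniteQuotient

open DiffForms

attribute [local instance] algebraSections

lemma isRegularAt_opn_iff {k : CommRingCat.{u}} {T X : Over (Spec k)} {O : X.left.Opens}
    {e' : T ⟶ opn X O} {e : T ⟶ X} (he : e' ≫ incl X O = e) {x : X.left} (hx : x ∈ O) {p : ℕ}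
    {ω : NaiveForms T ⊤ p} : IsRegularAt e' ⟨x, hx⟩ ω ↔ IsRegularAt e x ω := by
  subst he
  have h := valueRing_opn (e' := e') ⟨x, hx⟩
  exact iff_of_eq (congrArg (fun R => ω ∈ regularForms k R p) h)

section

variable {k : CommRingCat.{u}} {T X : Over (Spec k)} [Unique T.left] {e : T ⟶ X} {N : X.left.Opens}
  {p : ℕ}

lemma isRegularAt_eval (he : IsGeneric e) {x : X.left} (hx : x ∈ N) (hN : ⊤ ≤ e.left ⁻¹ᵁ N)
    (s : Γ(forms X p, N)) : IsRegularAt e x (eval e hN s) :=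
  eval_mem e hx hN he.dense s

lemma exists_eval_eq_of_isRegularAt (he : LocallyDetermined e p) (hN : ⊤ ≤ e.left ⁻¹ᵁ N)
    {ω : NaiveForms T ⊤ p} (hω : ∀ x ∈ N, IsRegularAt e x ω) :
    ∃ s : Γ(forms X p, N), eval e hN s = ω :=
  exists_eval_eq_of_forall_mem he hN hω

end

instance isIso_aut {k : CommRingCat.{u}} {G : Type*} [Group G] {V : Over (Spec k)}
    (a : RightAction G V) (g : G) : IsIso (a.aut g) :=
  Iso.isIso_hom (MulOpposite.unop (a g))

section

variable {k : CommRingCat.{u}} {G : Type*} [Group G] [Finite G] {V Q : Over (Spec k)}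
  {a : RightAction G V} {f : V ⟶ Q} {p : ℕ}

lemma invariantForms.ι_actForms (hf : IsInvariant a f) (g : G) :
    invariantForms.ι hf p ≫ actForms hf p g = invariantForms.ι hf p := by
  have h := congrArg (· ≫ Limits.Pi.π _ g) (Limits.kernel.condition (Limits.Pi.lift fun g : G =>
    actForms hf p g - 𝟙 ((Scheme.Modules.pushforward f.left).obj (forms V p))))
  simp only [Category.assoc, Limits.limit.lift_π, Limits.Fan.mk_pt, Limits.Fan.mk_π_app,
    Limits.zero_comp, Preadditive.comp_sub, Category.comp_id, sub_eq_zero] at h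
  exact h

lemma invariantForms.exists_comp_ι_eq (hf : IsInvariant a f) {M : Q.left.Modules}
    (ψ : M ⟶ (Scheme.Modules.pushforward f.left).obj (forms V p))
    (hψ : ∀ g, ψ ≫ actForms hf p g = ψ) :
    ∃ φ : M ⟶ invariantForms hf p, φ ≫ invariantForms.ι hf p = ψ :=
  ⟨Limits.kernel.lift _ ψ (by
    ext g
    simp [hψ]), Limits.kernel.lift_ι _ _ _⟩

end

section

variable {k : CommRingCat.{u}} {G : Type*} [Group G] {V Q : Over (Spec k)} [IsIntegral V.left]
  {a : RightAction G V} {f : V ⟶ Q} {U : Q.left.Opens} {e' : genericOver V ⟶ opn V (f.left ⁻¹ᵁ U)}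

/-- The zero ideal of an affine open of Q, whose ring is a domain inside that of V, gives a point
with local ring of dimension zero; such a point must lie in U. -/
lemma IsQuotient.nonempty_of_codim (hf : IsQuotient a f)
    (hU : ∀ x, x ∉ U → 2 ≤ ringKrullDim (Q.left.presheaf.stalk x)) :
    (U : Set Q.left).Nonempty := by
  obtain ⟨N, haff, hx, -⟩ := exists_isAffineOpen_mem_and_subset
    (X := Q.left) (U := ⊤) (x := f.left (genericPoint V.left)) trivial
  have : Nonempty (f.left ⁻¹ᵁ N : V.left.Opens) := ⟨⟨genericPoint V.left, hx⟩⟩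
  have : IsDomain Γ(Q.left, N) := (hf.injective N).isDomain (f.left.app N).hom
  obtain ⟨x, hx, h⟩ := exists_primeIdealOf_eq haff ⊥
  refine ⟨x, by_contra fun hxU => ?_⟩
  have h2 := hU x hxU
  rw [ringKrullDim_eq_of_ringEquiv (stalkRingEquiv haff hx),
    IsLocalization.AtPrime.ringKrullDim_eq_height (haff.primeIdealOf ⟨x, hx⟩).asIdeal, h] at h2
  have h3 : (⊥ : PrimeSpectrum Γ(Q.left, N)).asIdeal.height = 0 := Ideal.height_bot
  rw [h3] at h2
  have h4 : (2 : ℕ∞) ≤ 0 := WithBot.coe_le_coe.1 h2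
  norm_num at h4

lemma resHom_comp_incl_eq (he : e' ≫ incl V (f.left ⁻¹ᵁ U) = genericHom V) :
    (e' ≫ resHom f U) ≫ incl Q U = genericHom V ≫ f := by
  rw [← he, Category.assoc, Category.assoc]
  exact congrArg (e' ≫ ·) (Over.OverMorphism.ext (resHom_comp_incl f U))

lemma top_le_preimage_incl {D : Q.left.Opens}
    (he : e' ≫ incl V (f.left ⁻¹ᵁ U) = genericHom V)
    (hD : ⊤ ≤ (genericHom V).left ⁻¹ᵁ (f.left ⁻¹ᵁ D)) :
    ⊤ ≤ e'.left ⁻¹ᵁ ((incl V (f.left ⁻¹ᵁ U)).left ⁻¹ᵁ (f.left ⁻¹ᵁ D)) := by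
  rw [← he] at hD
  exact hD

lemma top_le_preimage_resHom {D : Q.left.Opens}
    (he : e' ≫ incl V (f.left ⁻¹ᵁ U) = genericHom V)
    (hD : ⊤ ≤ (genericHom V).left ⁻¹ᵁ (f.left ⁻¹ᵁ D)) :
    ⊤ ≤ (e' ≫ resHom f U).left ⁻¹ᵁ ((incl Q U).left ⁻¹ᵁ D) := by
  have hD' : ⊤ ≤ (genericHom V ≫ f).left ⁻¹ᵁ D := hD
  rw [← resHom_comp_incl_eq he] at hD'
  exact hD'

end

section

variable {K : Type u} [Field K] [CharZero K] {G : Type*} [Group G]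
  {V Q : Over (Spec (CommRingCat.of K))} [IsIntegral V.left] [LocallyOfFiniteType V.hom]
  {a : RightAction G V} {f : V ⟶ Q} {U : Q.left.Opens} {p : ℕ}
  {e' : genericOver V ⟶ opn V (f.left ⁻¹ᵁ U)}

lemma locallyDetermined_genericHom (hV : ∀ x, IsRegularLocalRing (V.left.presheaf.stalk x)) :
    LocallyDetermined (genericHom V) p :=
  isGeneric_genericHom.locallyDetermined (isField_genericOver V) hV p

lemma locallyDetermined_preimage (he : e' ≫ incl V (f.left ⁻¹ᵁ U) = genericHom V)
    (hV : ∀ x, IsRegularLocalRing (V.left.presheaf.stalk x)) : LocallyDetermined e' p :=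
  (IsGeneric.of_comp_incl (he ▸ isGeneric_genericHom)).locallyDetermined (isField_genericOver V)
    (fun _ => isRegularLocalRing_opn _ (hV _)) p

lemma IsQuotient.restrictToOpen_injective (hf : IsQuotient a f)
    (he : e' ≫ incl V (f.left ⁻¹ᵁ U) = genericHom V)
    (hV : ∀ x, IsRegularLocalRing (V.left.presheaf.stalk x)) (D : Q.left.Opens) :
    Function.Injective ((restrictToOpen f U p).app D) := by
  by_cases hD : (D : Set Q.left).Nonempty
  · have h1 := top_le_genericHom_preimage _ (hf.nonempty_preimage hD)
    intro s t hst
    refine eval_injective (locallyDetermined_genericHom hV) h1 ?_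
    have h3 := top_le_preimage_incl he h1
    exact (eval_restrictToOpen he h1 h3 s).symm.trans ((congrArg (eval e' h3) hst).trans
      (eval_restrictToOpen he h1 h3 t))
  · have := SchemeModules.subsingleton_sections
      (M := (Scheme.Modules.pushforward f.left).obj (forms V p)) hD
    exact Function.injective_of_subsingleton _

/-- A form on the regular part of the quotient, extended upstairs, is invariant. -/
lemma IsQuotient.comp_actForms_of_comp_restrictToOpen (hf : IsQuotient a f)
    (he : e' ≫ incl V (f.left ⁻¹ᵁ U) = genericHom V)
    (hV : ∀ x, IsRegularLocalRing (V.left.presheaf.stalk x))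
    (ψ : (Scheme.Modules.pushforward (incl Q U).left).obj (forms (opn Q U) p) ⟶
      (Scheme.Modules.pushforward f.left).obj (forms V p))
    (hψ : ψ ≫ restrictToOpen f U p = pullbackOnOpen f U p) (g : G) :
    ψ ≫ actForms hf.invariant p g = ψ := by
  refine Scheme.Modules.hom_ext _ _ fun D => ?_
  ext s
  by_cases hD : (D : Set Q.left).Nonempty
  · have h1 := top_le_genericHom_preimage _ (hf.nonempty_preimage hD)
    have h2 := top_le_preimage_resHom he h1
    have h3 := top_le_preimage_incl he h1
    obtain ⟨τ, hτ⟩ := exists_genericOver_hom (a.aut g)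
    have hs : eval (genericHom V) h1 (ψ.app D s) = eval (e' ≫ resHom f U) h2 s := by
      refine (eval_restrictToOpen he h1 h3 (ψ.app D s)).symm.trans
        (Eq.trans ?_ (eval_pullbackOnOpen rfl h2 h3 s))
      exact congrArg (fun t => eval e' h3 (Scheme.Modules.Hom.app t D s)) hψ
    -- The lift τ disappears after projecting to the quotient, since f is invariant. Hence the value
    -- of a form coming from U is fixed by τ.
    have hτ' : τ ≫ e' ≫ resHom f U = e' ≫ resHom f U := by
      have : Mono (incl Q U) := Over.mono_of_mono_left _
      rw [← cancel_mono (incl Q U), Category.assoc, resHom_comp_incl_eq he, ← Category.assoc, hτ,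
        Category.assoc, hf.invariant g]
    refine eval_injective (locallyDetermined_genericHom hV) h1 ?_
    refine (eval_actForms hf.invariant g hτ h1 (ψ.app D s)).trans ?_
    rw [hs]
    have key : ∀ (t : genericOver V ⟶ opn Q U) (_ : t = e' ≫ resHom f U)
        (h : ⊤ ≤ t.left ⁻¹ᵁ ((incl Q U).left ⁻¹ᵁ D)),
        eval t h s = eval (e' ≫ resHom f U) h2 s := by
      rintro _ rfl h
      rfl
    have h4 : ⊤ ≤ (τ ≫ e' ≫ resHom f U).left ⁻¹ᵁ ((incl Q U).left ⁻¹ᵁ D) := by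
      rw [hτ']; exact h2
    exact (eval_comp τ (e' ≫ resHom f U) h2 h4 s).symm.trans (key _ hτ' _)
  · have := SchemeModules.subsingleton_sections
      (M := (Scheme.Modules.pushforward f.left).obj (forms V p)) hD
    exact Subsingleton.elim _ _

variable [Finite G]

lemma IsQuotient.locallyDetermined (hf : IsQuotient a f)
    (he : e' ≫ incl V (f.left ⁻¹ᵁ U) = genericHom V)
    (hU : ∀ x ∈ U, IsRegularLocalRing (Q.left.presheaf.stalk x)) :
    LocallyDetermined (e' ≫ resHom f U) p :=
  (IsGeneric.of_comp_incl (resHom_comp_incl_eq he ▸ hf.isGeneric)).locallyDetermined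
    (isField_genericOver V) (fun x => isRegularLocalRing_opn x (hU _ x.2)) p

lemma IsQuotient.pullbackOnOpen_injective (hf : IsQuotient a f)
    (he : e' ≫ incl V (f.left ⁻¹ᵁ U) = genericHom V)
    (hU : ∀ x ∈ U, IsRegularLocalRing (Q.left.presheaf.stalk x)) (D : Q.left.Opens) :
    Function.Injective ((pullbackOnOpen f U p).app D) := by
  by_cases hD : (D : Set Q.left).Nonempty
  · have h1 := top_le_genericHom_preimage _ (hf.nonempty_preimage hD)
    intro s t hst
    have h2 := top_le_preimage_resHom he h1
    have h3 := top_le_preimage_incl he h1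
    refine eval_injective (hf.locallyDetermined he hU) h2 ?_
    exact (eval_pullbackOnOpen rfl h2 h3 s).symm.trans ((congrArg (eval e' h3) hst).trans
      (eval_pullbackOnOpen rfl h2 h3 t))
  · have := SchemeModules.subsingleton_sections
      (M := (Scheme.Modules.pushforward (incl Q U).left).obj (forms (opn Q U) p)) hD
    exact Function.injective_of_subsingleton _

/-- A form on `D ∩ U` extends to a form on `f⁻¹ D`. -/
lemma IsQuotient.exists_restrictToOpen_eq (hf : IsQuotient a f)
    (he : e' ≫ incl V (f.left ⁻¹ᵁ U) = genericHom V)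
    (hV : ∀ x, IsRegularLocalRing (V.left.presheaf.stalk x))
    (hU : ∀ x, x ∉ U → 2 ≤ ringKrullDim (Q.left.presheaf.stalk x)) {D : Q.left.Opens}
    (s : Γ((Scheme.Modules.pushforward (incl Q U).left).obj (forms (opn Q U) p), D)) :
    ∃ t, (restrictToOpen f U p).app D t = (pullbackOnOpen f U p).app D s := by
  by_cases hD : (D : Set Q.left).Nonempty
  · have h1 := top_le_genericHom_preimage _ (hf.nonempty_preimage hD)
    have h2 := top_le_preimage_resHom he h1
    have h3 := top_le_preimage_incl he h1
    have hgen : IsGeneric (e' ≫ resHom f U) :=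
      IsGeneric.of_comp_incl (resHom_comp_incl_eq he ▸ hf.isGeneric)
    -- The extension is the section of Ω^p_V whose generic value is that of s; regularity at points
    -- over the complement of U comes from purity.
    obtain ⟨t, ht⟩ := exists_eval_eq_of_isRegularAt (locallyDetermined_genericHom hV) h1
      (ω := eval (e' ≫ resHom f U) h2 s) fun y hy => by
        obtain ⟨N, haff, hN, hND⟩ := exists_isAffineOpen_mem_and_subset
          (show f.left y ∈ D from hy)
        refine hf.mem_regularForms_of_quotient haff hV U hU (fun x hx hxU => ?_) hN
        refine (isRegularAt_opn_iff (resHom_comp_incl_eq he) hxU).1 ?_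
        exact isRegularAt_eval hgen (hND hx) h2 s
    refine ⟨t, eval_injective (locallyDetermined_preimage he hV) h3 ?_⟩
    exact (eval_restrictToOpen he h1 h3 t).trans (ht.trans (eval_pullbackOnOpen rfl h2 h3 s).symm)
  · have := SchemeModules.subsingleton_sections (M := (Scheme.Modules.pushforward f.left).obj
      ((Scheme.Modules.pushforward (incl V (f.left ⁻¹ᵁ U)).left).obj
        (forms (opn V (f.left ⁻¹ᵁ U)) p))) hD
    exact ⟨0, Subsingleton.elim _ _⟩

/-- An invariant form on `f⁻¹ D` descends to a form on `D ∩ U`. -/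
lemma IsQuotient.exists_pullbackOnOpen_eq (hf : IsQuotient a f)
    (he : e' ≫ incl V (f.left ⁻¹ᵁ U) = genericHom V)
    (hV : ∀ x, IsRegularLocalRing (V.left.presheaf.stalk x))
    (hU : ∀ x ∈ U, IsRegularLocalRing (Q.left.presheaf.stalk x)) {D : Q.left.Opens}
    (t : Γ((Scheme.Modules.pushforward f.left).obj (forms V p), D))
    (ht : ∀ g, (actForms hf.invariant p g).app D t = t) :
    ∃ s, (pullbackOnOpen f U p).app D s = (restrictToOpen f U p).app D t := by
  by_cases hD : (D : Set Q.left).Nonempty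
  · have h1 := top_le_genericHom_preimage _ (hf.nonempty_preimage hD)
    have h2 := top_le_preimage_resHom he h1
    have h3 := top_le_preimage_incl he h1
    choose τ hτ using fun g => exists_genericOver_hom (a.aut g)
    obtain ⟨s, hs⟩ := exists_eval_eq_of_isRegularAt (hf.locallyDetermined he hU) h2
      (ω := eval (genericHom V) h1 t) fun x hx => by
        refine (isRegularAt_opn_iff (resHom_comp_incl_eq he) x.2).2 ?_
        obtain ⟨N, haff, hN, hND⟩ := exists_isAffineOpen_mem_and_subset
          (show x.1 ∈ D from hx)
        refine hf.mem_regularForms_of_invariant haff hV τ hτ (fun g => ?_) (fun y hy => ?_) hN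
          fun z hz => hU z (hz.mem_open U.2 x.2)
        · exact (eval_actForms hf.invariant g (hτ g) h1 t).symm.trans
            (congrArg (eval (genericHom V) h1) (ht g))
        · exact isRegularAt_eval isGeneric_genericHom
            (show y ∈ f.left ⁻¹ᵁ D from hND (show f.left y ∈ N from hy)) h1 t
    refine ⟨s, eval_injective (locallyDetermined_preimage he hV) h3 ?_⟩
    exact (eval_pullbackOnOpen rfl h2 h3 s).trans (hs.trans (eval_restrictToOpen he h1 h3 t).symm)
  · have := SchemeModules.subsingleton_sections (M := (Scheme.Modules.pushforward f.left).obj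
      ((Scheme.Modules.pushforward (incl V (f.left ⁻¹ᵁ U)).left).obj
        (forms (opn V (f.left ⁻¹ᵁ U)) p))) hD
    exact ⟨0, Subsingleton.elim _ _⟩

/-- Forms on the regular part of a quotient are the invariant forms. -/
theorem IsQuotient.existsUnique_iso (hf : IsQuotient a f)
    (hV : ∀ x, IsRegularLocalRing (V.left.presheaf.stalk x))
    (hU : ∀ x, x ∉ U → 2 ≤ ringKrullDim (Q.left.presheaf.stalk x))
    (hU' : ∀ x ∈ U, IsRegularLocalRing (Q.left.presheaf.stalk x)) :
    ∃! φ : (Scheme.Modules.pushforward (incl Q U).left).obj (forms (opn Q U) p) ≅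
        invariantForms hf.invariant p,
      φ.hom ≫ invariantForms.ι hf.invariant p ≫ restrictToOpen f U p = pullbackOnOpen f U p := by
  obtain ⟨e', he⟩ := exists_comp_incl (O := f.left ⁻¹ᵁ U) (e := genericHom V)
    (top_le_genericHom_preimage _ (hf.nonempty_preimage (hf.nonempty_of_codim hU)))
  have hr := hf.restrictToOpen_injective (p := p) he hV
  have hp := hf.pullbackOnOpen_injective (p := p) he hU'
  have := SchemeModules.mono_of_injective hr
  have := SchemeModules.mono_of_injective hp
  have : Mono (invariantForms.ι hf.invariant p) := Limits.equalizer.ι_mono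
  have hm : Mono (invariantForms.ι hf.invariant p ≫ restrictToOpen f U p) := mono_comp _ _
  -- Both modules are subobjects of f_* w_* Ω^p_W. Factoring each embedding through the other gives
  -- φ and χ; cancelling the monomorphisms shows that they are mutually inverse and that φ is
  -- unique.
  obtain ⟨ψ, hψ⟩ := SchemeModules.exists_comp_eq (pullbackOnOpen f U p) hr
    fun D s => hf.exists_restrictToOpen_eq he hV hU s
  obtain ⟨φ, rfl⟩ := invariantForms.exists_comp_ι_eq hf.invariant ψ
    (hf.comp_actForms_of_comp_restrictToOpen he hV ψ hψ)
  rw [Category.assoc] at hψ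
  obtain ⟨χ, hχ⟩ := SchemeModules.exists_comp_eq
    (invariantForms.ι hf.invariant p ≫ restrictToOpen f U p) hp fun D s => by
      refine hf.exists_pullbackOnOpen_eq he hV hU' ((invariantForms.ι hf.invariant p).app D s)
        fun g => ?_
      exact congrArg (fun t => Scheme.Modules.Hom.app t D s)
        (invariantForms.ι_actForms hf.invariant g)
  refine ⟨⟨φ, χ, ?_, ?_⟩, hψ, fun φ' hφ' => ?_⟩
  · rw [← cancel_mono (pullbackOnOpen f U p), Category.assoc, hχ, hψ, Category.id_comp]
  · rw [← cancel_mono (invariantForms.ι hf.invariant p ≫ restrictToOpen f U p), Category.assoc,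
      hψ, hχ, Category.id_comp]
  · ext1
    rw [← cancel_mono (invariantForms.ι hf.invariant p ≫ restrictToOpen f U p), hφ']
    exact hψ.symm

end

end FiniteQuotient

end

theorem mainTheorem6 {G : Type*} [Group G] [Finite G]
    (V Q : Over (Spec (CommRingCat.of ℚ)))
    (hV_integral : IsIntegral V.left)
    (hV_regular : SchemeProps.IsRegular V.left)
    (hV_quasiProjective : SchemeProps.IsQuasiProjective V)
    (a : FiniteQuotient.RightAction G V) (f : V ⟶ Q) (hf : FiniteQuotient.IsQuotient a f)
    (U : Q.left.Opens)
    (hU_codim : 2 ≤ SchemeProps.codim Q.left (U : Set Q.left)ᶜ)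
    (hU_singular : ∀ x : Q.left, ¬ SchemeProps.IsRegularAt Q.left x → x ∉ U)
    (p : ℕ) :
    ∃! φ : (Scheme.Modules.pushforward (FiniteQuotient.incl Q U).left).obj
        (DiffForms.forms (FiniteQuotient.opn Q U) p) ≅
        FiniteQuotient.invariantForms hf.invariant p,
      φ.hom ≫ FiniteQuotient.invariantForms.ι hf.invariant p ≫
          FiniteQuotient.restrictToOpen f U p =
        FiniteQuotient.pullbackOnOpen f U p := by
  have := hV_quasiProjective.locallyOfFiniteType
  exact hf.existsUnique_iso hV_regular
    (fun x hx => hU_codim.trans (iInf₂_le (α := WithBot ℕ∞) x hx))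
    fun x hx => by_contra fun h => hU_singular x h hx
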